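/- Theorem 2.2. Let $\{X(p)\}_p$ be independent random variables, indexed by the primes, each uniformly distributed on the unit circle, and for $\mathrm{Re}(s)>1/2$ put $$\log\zeta(s,X):=\sum_p -\log\Big(1-\frac{X(p)}{p^{s}}\Big),\qquad \log\zeta(s,\overline{X}):=\sum_p -\log\Big(1-\frac{\overline{X(p)}}{p^{s}}\Big)$$ (principal logarithms; the series are summed over the primes in increasing order and converge almost surely). For $s\in\mathbb{C}$ such that $\zeta$ has neither a zero nor a pole on the half-line $\{x+i\,\mathrm{Im}(s):x\ge \mathrm{Re}(s)\}$, let $\log\zeta(s)$ be the value at $s$ of the branch of the logarithm obtained by continuous variation along this half-line, starting from the limit $0$ at $x=+\infty$. Fix $1/2<\sigma_0<1$. There exist positive constants $c_3,c_4,c_5,C,T_0$ depending only on $\sigma_0$ such that the following holds for all real $T\ge T_0$. Let $k,\ell\ge 0$ be integers with $k,\ell\le c_4\,\log T/\log\log T$, and let $s_1,\dots,s_k,r_1,\dots,r_\ell$ be complex numbers in the rectangle $$\sigma_0<\mathrm{Re}(z)<1,\qquad |\mathrm{Im}(z)|\le T^{(\sigma_0-1/2)/4}.$$ Then there is a measurable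 set $\mathcal{E}(T)\subset[T,2T]$ of Lebesgue measure at most $C\,T^{1-c_3}$ such that for every $t\in[T,2T]\setminus\mathcal{E}(T)$ all the logarithms $\log\zeta(s_j+it)$ and $\log\zeta(r_j-it)$ are defined (that is, $\zeta$ has no zero on the corresponding half-lines), and $$\bigg|\frac1T\int_{[T,2T]\setminus\mathcal{E}(T)}\Big(\prod_{j=1}^k\log\zeta(s_j+it)\Big)\Big(\prod_{j=1}^{\ell}\log\zeta(r_j-it)\Big)dt-\mathbb{E}\bigg(\Big(\prod_{j=1}^k\log\zeta(s_j,X)\Big)\Big(\prod_{j=1}^{\ell}\log\zeta(r_j,\overline{X})\Big)\bigg)\bigg|\le C\,T^{-c_5},$$ where the integrand on the left and the random variable on the right are integrable. -/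

import Mathlib

open MeasureTheory ProbabilityTheory Filter Topology ComplexConjugate

/-- The logarithm of the Riemann zeta function obtained by continuous variation along the horizontal
half-line from `+∞ + i Im s` (where `log ζ` tends to `0`) to `s`. Since the derivative of `log ζ`
is `ζ' / ζ`, this is `log ζ(s) = - ∫_{Re s}^∞ (ζ'/ζ)(x + i Im s) dx`, an absolutely convergent
integral whenever the half-line `{x + i Im s : x ≥ Re s}` contains neither a zero nor the pole
of `ζ`. For `Re s > 1` it is the Dirichlet series `∑ Λ(n) / (log n * n ^ s)`. -/
noncomputable def logZeta (s : ℂ) : ℂ :=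
  -∫ x in Set.Ioi s.re, logDeriv riemannZeta ((x : ℂ) + (s.im : ℂ) * Complex.I)

/-- The half-line `{x + i Im s : x ≥ Re s}` contains no zero of the Riemann zeta function. -/
def ZetaFreeRight (s : ℂ) : Prop :=
  ∀ x : ℝ, s.re ≤ x → riemannZeta ((x : ℂ) + (s.im : ℂ) * Complex.I) ≠ 0

/-- The uniform probability measure on the unit circle, as a measure on `ℂ`. -/
noncomputable def uniformCircle : Measure ℂ :=
  ((ENNReal.ofReal (2 * Real.pi))⁻¹ • volume.restrict (Set.Ioc 0 (2 * Real.pi))).map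
    (circleMap 0 1)

/-- `X` is a family of independent random variables, indexed by the primes, each of them
uniformly distributed on the unit circle. -/
structure IsSteinhausFamily {Ω : Type*} [MeasurableSpace Ω] (P : Measure Ω)
    (X : Nat.Primes → Ω → ℂ) : Prop where
  measurable : ∀ p, Measurable (X p)
  map_eq : ∀ p, P.map (X p) = uniformCircle
  indep : iIndepFun X P

/-- The partial sum over the primes `p < N` of `-log (1 - x(p) / p ^ s)` (principal logarithm). -/
noncomputable def logEulerPartial (s : ℂ) (x : Nat.Primes → ℂ) (N : ℕ) : ℂ :=
  ∑ p ∈ (Finset.range N).subtype Nat.Prime,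
    -Complex.log (1 - x p / ((p : ℕ) : ℂ) ^ s)

/-- `log ζ(s, x) = ∑_p -log (1 - x(p) / p ^ s)`, summed over the primes in increasing order
(the series is in general only conditionally convergent). -/
noncomputable def logEuler (s : ℂ) (x : Nat.Primes → ℂ) : ℂ :=
  limUnder atTop (logEulerPartial s x)

/-! Put η = σ₀ - 1/2. Off a small set of t, the product of logarithms of ζ is close to a short
smoothed Dirichlet series in n^(-it). The mean value of such a series is essentially its diagonal,
and the diagonal is exactly what the random model produces. All estimates lose factors such as (log
T)^k or k^k. For k ≤ c₄ log T / log log T these are small powers of T (`mul_log_pow_le`), so it is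
enough to save a fixed power of T elsewhere.

The exceptional set comes from a zero density estimate. Let M be the partial sum of the Dirichlet
series of 1/ζ of length T^(κ/2). Then ζM - 1 has mean square O(T^(1-κ²/4)) on vertical lines to the
right of 1/2 + κ (`exists_integral_norm_mollified_sub_one_sq_le`). At a zero of ζ it equals -1, so
by subharmonicity each zero forces mass at least πκ² in a disc of radius κ. Hence few unit intervals
contain the ordinate of a zero to the right of 1/2 + 2κ (`exists_card_zero_intervals_le`). Away from
these intervals the Borel–Carathéodory theorem gives log ζ = O(log T) (`exists_norm_logZeta_le`).
`exists_exceptional_set` collects the t for which some shifted ordinate comes within about log T of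
a bad interval.

For the remaining t, integrate the product of log ζ(s_j + it + w) against X^w exp(w²)/w, with X a
small power of T, and truncate at height log T. Moving the line from Re w = 3 to Re w = -η/4 picks
up the wanted product at w = 0 and leaves an error that is a negative power of T
(`norm_contourMean_sub_le`, `norm_smoothedProd_sub_le`). On Re w = 3 the logarithms are absolutely
convergent Dirichlet series, which gives the smoothed series. Its off-diagonal contribution to the
mean value is bounded by a small power of T (`norm_integral_dirichlet_mul_conj_sub_le`). The same
contour shift, applied to n^(-w), shows that the smoothing weights on the diagonal may be replaced
by 1 (`norm_tsum_smoothed_sub_le`).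

On the random side, the completely multiplicative extensions of X to the integers are orthonormal
(`integral_eulerChar_mul_conj`). Truncated Euler products therefore have explicit second moments.
They converge almost surely, because the partial sums of each logarithm form an L²-bounded
martingale, and in L², because the coefficients are square summable to the right of 1/2. The limit
of the mixed moments is the same diagonal sum (`integral_prod_logEuler`). The factors at r_j - it
are turned into conjugates of factors at conj(r_j) + it throughout, by the reflection principle. -/

/-! ### A local Plancherel inequality with Gaussian weights -/

/-- The Fourier transform of the Gaussian `exp (-π b t²)`. -/
noncomputable def gaussianDual (b u : ℝ) : ℝ :=
  1 / Real.sqrt b * Real.exp (-(Real.pi / b) * u ^ 2)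

theorem gaussianDual_nonneg (b u : ℝ) : 0 ≤ gaussianDual b u := by
  unfold gaussianDual; positivity

theorem continuous_gaussianDual (b : ℝ) : Continuous (gaussianDual b) := by
  unfold gaussianDual; fun_prop

theorem integrable_gaussianDual {b : ℝ} (hb : 0 < b) : Integrable (gaussianDual b) :=
  (integrable_exp_neg_mul_sq (by positivity)).const_mul _

theorem integral_gaussianDual {b : ℝ} (hb : 0 < b) : ∫ u, gaussianDual b u = 1 := by
  unfold gaussianDual
  rw [integral_const_mul, integral_gaussian]
  have : Real.pi / (Real.pi / b) = b := by field_simp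
  rw [this]
  have : Real.sqrt b ≠ 0 := (Real.sqrt_pos.2 hb).ne'
  field_simp

theorem gaussianDual_le {b : ℝ} (hb : 0 < b) (u : ℝ) : gaussianDual b u ≤ 1 / Real.sqrt b := by
  unfold gaussianDual
  refine mul_le_of_le_one_right (by positivity) (Real.exp_le_one_iff.2 ?_)
  have : 0 ≤ Real.pi / b := by positivity
  nlinarith [sq_nonneg u]

theorem norm_fourier_gaussian {b : ℝ} (hb : 0 < b) (u : ℝ) :
    ‖FourierTransform.fourier (fun x : ℝ => Complex.exp (-Real.pi * b * (x : ℂ) ^ 2)) u‖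
      = gaussianDual b u := by
  rw [fourier_gaussian_pi (by simpa using hb)]
  have h1 : (-Real.pi / (b : ℂ) * (u : ℂ) ^ 2) = ((-(Real.pi / b) * u ^ 2 : ℝ) : ℂ) := by
    push_cast; ring
  simp only [norm_mul, norm_div, norm_one]
  rw [h1, Complex.norm_exp_ofReal, Complex.norm_cpow_eq_rpow_re_of_pos hb]
  simp [gaussianDual, Real.sqrt_eq_rpow]

/-- The conjugate of the transform of g is the transform of y ↦ conj (g (-y)). Moving the transform
across the pairing therefore leaves g integrated against translates of the transformed Gaussian,
which is positive with total mass 1. -/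
theorem norm_conj_fourier_gaussian_le {g : ℝ → ℂ} (hg : Integrable g) {b : ℝ} (hb : 0 < b)
    (x : ℝ) :
    ‖FourierTransform.fourier (fun t : ℝ => Complex.exp (-Real.pi * b * (t : ℂ) ^ 2) *
      conj (FourierTransform.fourier g t)) x‖ ≤ ∫ y, ‖g y‖ * gaussianDual b (x - y) := by
  set w : ℝ → ℂ := fun t => Complex.exp (-Real.pi * b * (t : ℂ) ^ 2) with hw
  have hwi : Integrable w := by
    have := integrable_cexp_neg_mul_sq (b := Real.pi * b) (by
      simp [← Complex.ofReal_mul]; positivity)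
    simpa [hw] using this
  have h1 : ∀ t : ℝ, conj (FourierTransform.fourier g t)
      = FourierTransform.fourier (fun y => conj (g (-y))) t := by
    intro t
    rw [Real.fourier_real_eq, Real.fourier_real_eq, ← integral_conj,
      ← integral_neg_eq_self]
    congr 1; ext v
    simp [Circle.smul_def, ← Circle.coe_inv_eq_conj, ← AddChar.map_neg_eq_inv]
  have h2 : FourierTransform.fourier (fun t : ℝ => w t * conj (FourierTransform.fourier g t)) x
      = ∫ t : ℝ, FourierTransform.fourier (fun y => conj (g (-y))) t •
          (((Real.fourierChar (-(t * x)) : Circle) : ℂ) * w t) := by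
    rw [Real.fourier_real_eq]
    congr 1; ext t
    rw [h1, Circle.smul_def]
    exact mul_left_comm _ _ _ |>.trans (by rw [smul_eq_mul]; ring)
  have hgi : Integrable (fun y => conj (g (-y))) := by
    have := hg.comp_neg
    exact (Complex.conjCLE.toContinuousLinearMap.integrable_comp this)
  have hwx : Integrable (fun t : ℝ => ((Real.fourierChar (-(t * x)) : Circle) : ℂ) * w t) := by
    refine hwi.bdd_mul (c := 1) ?_ (ae_of_all _ fun t => (Circle.norm_coe _).le)
    exact (Continuous.aestronglyMeasurable (by fun_prop))
  have h3 := VectorFourier.integral_fourierIntegral_smul_eq_flip (L := innerₗ ℝ) (μ := volume)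
    (ν := volume) Real.continuous_fourierChar
    (by exact continuous_inner) hgi hwx
  have h4 : ∀ y : ℝ, FourierTransform.fourier
      (fun t : ℝ => ((Real.fourierChar (-(t * x)) : Circle) : ℂ) * w t) y
      = FourierTransform.fourier w (x + y) := by
    intro y
    rw [Real.fourier_real_eq, Real.fourier_real_eq]
    congr 1; ext t
    simp only [Circle.smul_def, smul_eq_mul]
    rw [← mul_assoc, ← Circle.coe_mul, ← AddChar.map_add_eq_mul]
    congr 3; ring_nf
  have h5 : FourierTransform.fourier (fun t : ℝ => w t * conj (FourierTransform.fourier g t)) x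
      = ∫ y : ℝ, conj (g (-y)) • FourierTransform.fourier w (x + y) := by
    rw [h2]
    refine (Eq.trans ?_ h3).trans ?_
    · rfl
    · congr 1; ext y; rw [← h4]
      congr 1
      simp only [flip_innerₗ]
      rfl
  rw [h5]
  refine (norm_integral_le_integral_norm _).trans (le_of_eq ?_)
  rw [← integral_neg_eq_self]
  congr 1; ext y
  have h := norm_fourier_gaussian hb (x - y)
  rw [norm_smul, RCLike.norm_conj, neg_neg, ← sub_eq_add_neg, hw, h]

/-- A local form of Plancherel's inequality. -/
theorem setIntegral_norm_fourier_sq_le {g : ℝ → ℂ} (hg : Integrable g)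
    (hg2 : Integrable (fun x => ‖g x‖ ^ 2)) {A : ℝ} (hA : 0 < A) :
    ∫ t in Set.Icc (-A) A, ‖FourierTransform.fourier g t‖ ^ 2
      ≤ Real.exp 1 * ∫ x, ‖g x‖ ^ 2 := by
  -- With this b the Gaussian exp(-πbt²) is at least 1/e on [-A, A]; this is the source of the
  -- factor e.
  set b : ℝ := 1 / (Real.pi * A ^ 2) with hbdef
  have hb : 0 < b := by positivity
  set w : ℝ → ℂ := fun t => Complex.exp (-Real.pi * b * (t : ℂ) ^ 2) with hw
  have hwr : ∀ t, w t = ((Real.exp (-(Real.pi * b) * t ^ 2) : ℝ) : ℂ) := by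
    intro t; simp [hw]
  have hwri : Integrable (fun t : ℝ => Real.exp (-(Real.pi * b) * t ^ 2)) :=
    integrable_exp_neg_mul_sq (by positivity)
  have hgc : Continuous (FourierTransform.fourier g) :=
    VectorFourier.fourierIntegral_continuous Real.continuous_fourierChar
      (by exact continuous_inner) hg
  have hgb : ∀ t, ‖FourierTransform.fourier g t‖ ≤ ∫ x, ‖g x‖ := fun t =>
    VectorFourier.norm_fourierIntegral_le_integral_norm _ _ _ _ _
  have hwi : Integrable w := by
    have := hwri.ofReal (𝕜 := ℂ)
    exact this.congr (ae_of_all _ fun t => (hwr t).symm)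
  have hwg : Integrable (fun t => w t * conj (FourierTransform.fourier g t)) := by
    refine hwi.mul_bdd (c := ∫ x, ‖g x‖) ?_ (ae_of_all _ fun t => ?_)
    · exact (Complex.continuous_conj.comp hgc).aestronglyMeasurable
    · simpa using hgb t
  set K := FourierTransform.fourier (fun t => w t * conj (FourierTransform.fourier g t)) with hK
  have hKb : ∀ x, ‖K x‖ ≤ ∫ y, ‖g y‖ * gaussianDual b (x - y) :=
    fun x => norm_conj_fourier_gaussian_le hg hb x
  have hKc : Continuous K :=
    VectorFourier.fourierIntegral_continuous Real.continuous_fourierChar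
      (by exact continuous_inner) hwg
  have hKbd : ∀ t, ‖K t‖ ≤ ∫ x, ‖w x * conj (FourierTransform.fourier g x)‖ := fun t =>
    VectorFourier.norm_fourierIntegral_le_integral_norm _ _ _ _ _
  -- The Gaussian-weighted square norm of the transform becomes the integral of g K; convergence is
  -- never an issue because g is integrable and the weight decays.
  have h3 := VectorFourier.integral_fourierIntegral_smul_eq_flip (L := innerₗ ℝ) (μ := volume)
    (ν := volume) Real.continuous_fourierChar
    (by exact continuous_inner) hg hwg
  have h4 : ∫ t, FourierTransform.fourier g t * (w t * conj (FourierTransform.fourier g t))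
      = ∫ x, g x * K x := by
    refine (Eq.trans ?_ h3).trans ?_
    · rfl
    · congr 1; ext x
      simp only [flip_innerₗ]
      rfl
  have h5 : ((∫ t, Real.exp (-(Real.pi * b) * t ^ 2) * ‖FourierTransform.fourier g t‖ ^ 2 : ℝ) : ℂ)
      = ∫ x, g x * K x := by
    rw [← h4, ← integral_complex_ofReal]
    congr 1; ext t
    rw [hwr, mul_left_comm, Complex.mul_conj, Complex.normSq_eq_norm_sq]
    push_cast; ring
  have hW := integral_gaussianDual hb
  have hWi := integrable_gaussianDual hb
  have hbd : ∀ x y, ‖gaussianDual b (x - y)‖ ≤ 1 / Real.sqrt b := fun x y => by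
    rw [Real.norm_of_nonneg (gaussianDual_nonneg _ _)]; exact gaussianDual_le hb _
  have hcm : ∀ x, AEStronglyMeasurable (fun y => gaussianDual b (x - y)) volume := fun x =>
    ((continuous_gaussianDual b).comp (continuous_const.sub continuous_id)).aestronglyMeasurable
  have hi1 : ∀ x, Integrable (fun y => ‖g y‖ * gaussianDual b (x - y)) := fun x =>
    hg.norm.mul_bdd (c := 1 / Real.sqrt b) (hcm x) (ae_of_all _ (hbd x))
  have hi2 : ∀ x, Integrable (fun y => ‖g y‖ ^ 2 * gaussianDual b (x - y)) := fun x =>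
    hg2.mul_bdd (c := 1 / Real.sqrt b) (hcm x) (ae_of_all _ (hbd x))
  have hconv := integral_convolution (ContinuousLinearMap.mul ℝ ℝ) hg2 hWi
  have hconvi := hg2.integrable_convolution (ContinuousLinearMap.mul ℝ ℝ) hWi
  set V : ℝ → ℝ := fun x => ∫ y, ‖g y‖ ^ 2 * gaussianDual b (x - y) with hV
  have hVi : Integrable V := hconvi
  have hVint : ∫ x, V x = ∫ x, ‖g x‖ ^ 2 := by
    refine (Eq.trans ?_ hconv).trans ?_
    · rfl
    · simp [hW]
  -- Schur's test: |g x||g y| is at most half the sum of the squares. As the kernel has mass 1 in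
  -- each variable, both halves integrate to half the square norm of g.
  have hpt : ∀ x, ‖g x * K x‖ ≤ 2⁻¹ * ‖g x‖ ^ 2 + 2⁻¹ * V x := by
    intro x
    rw [norm_mul]
    have e1 : ‖g x‖ * ∫ y, ‖g y‖ * gaussianDual b (x - y)
        = ∫ y, ‖g x‖ * (‖g y‖ * gaussianDual b (x - y)) := (integral_const_mul _ _).symm
    have e2 : ∫ y, ‖g x‖ * (‖g y‖ * gaussianDual b (x - y)) ≤
        ∫ y, (2⁻¹ * ‖g x‖ ^ 2 * gaussianDual b (x - y)
          + 2⁻¹ * (‖g y‖ ^ 2 * gaussianDual b (x - y))) := by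
      refine integral_mono ((hi1 x).const_mul _)
        (((hWi.comp_sub_left x).const_mul _).add ((hi2 x).const_mul _)) fun y => ?_
      have := gaussianDual_nonneg b (x - y)
      have h := mul_nonneg this (sq_nonneg (‖g x‖ - ‖g y‖))
      simp only []
      nlinarith
    have e3 : ∫ y, (2⁻¹ * ‖g x‖ ^ 2 * gaussianDual b (x - y)
          + 2⁻¹ * (‖g y‖ ^ 2 * gaussianDual b (x - y))) = 2⁻¹ * ‖g x‖ ^ 2 + 2⁻¹ * V x := by
      rw [integral_add ((hWi.comp_sub_left x).const_mul _) ((hi2 x).const_mul _),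
        integral_const_mul, integral_const_mul, integral_sub_left_eq_self, hW, mul_one]
    calc ‖g x‖ * ‖K x‖ ≤ ‖g x‖ * ∫ y, ‖g y‖ * gaussianDual b (x - y) := by gcongr; exact hKb x
      _ ≤ _ := by rw [e1]; exact e2.trans e3.le
  have h6 : ∫ t, Real.exp (-(Real.pi * b) * t ^ 2) * ‖FourierTransform.fourier g t‖ ^ 2
      ≤ ∫ x, ‖g x‖ ^ 2 := by
    have e0 : 0 ≤ ∫ t, Real.exp (-(Real.pi * b) * t ^ 2) * ‖FourierTransform.fourier g t‖ ^ 2 :=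
      integral_nonneg fun t => by positivity
    have e1 := congrArg norm h5
    rw [Complex.norm_of_nonneg e0] at e1
    rw [e1]
    calc _ ≤ ∫ x, ‖g x * K x‖ := norm_integral_le_integral_norm _
      _ ≤ ∫ x, (2⁻¹ * ‖g x‖ ^ 2 + 2⁻¹ * V x) := by
        refine integral_mono_of_nonneg (ae_of_all _ fun x => norm_nonneg _)
          ((hg2.const_mul _).add (hVi.const_mul _)) (ae_of_all _ hpt)
      _ = _ := by
        rw [integral_add (hg2.const_mul _) (hVi.const_mul _), integral_const_mul,
          integral_const_mul, hVint]; ring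
  have hfin : Integrable
      (fun t => Real.exp (-(Real.pi * b) * t ^ 2) * ‖FourierTransform.fourier g t‖ ^ 2) := by
    refine hwri.mul_bdd (c := (∫ x, ‖g x‖) ^ 2) (hgc.norm.pow 2).aestronglyMeasurable
      (ae_of_all _ fun t => ?_)
    rw [Real.norm_of_nonneg (by positivity)]
    gcongr; exact hgb t
  calc _ ≤ ∫ t in Set.Icc (-A) A, Real.exp 1 *
        (Real.exp (-(Real.pi * b) * t ^ 2) * ‖FourierTransform.fourier g t‖ ^ 2) := by
        refine setIntegral_mono_on ?_ (hfin.const_mul _).integrableOn measurableSet_Icc ?_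
        · exact (hgc.norm.pow 2).continuousOn.integrableOn_compact isCompact_Icc
        · intro t ht
          rw [← mul_assoc, ← Real.exp_add]
          refine le_mul_of_one_le_left (by positivity) (Real.one_le_exp ?_)
          have : t ^ 2 ≤ A ^ 2 := sq_le_sq' ht.1 ht.2
          have h : Real.pi * b * A ^ 2 = 1 := by rw [hbdef]; field_simp
          have : Real.pi * b * t ^ 2 ≤ Real.pi * b * A ^ 2 := by gcongr
          linarith
    _ ≤ ∫ t, Real.exp 1 *
        (Real.exp (-(Real.pi * b) * t ^ 2) * ‖FourierTransform.fourier g t‖ ^ 2) :=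
        setIntegral_le_integral (hfin.const_mul _) (ae_of_all _ fun t => by positivity)
    _ ≤ _ := by rw [integral_const_mul]; gcongr


/-! ### The Euler–Maclaurin formula for ζ and the mean square of its tail -/

/-- The integral `∫_N^∞ {u} u^{-s-1} du` in the Euler–Maclaurin formula for `ζ`. -/
noncomputable def zetaTail (N : ℕ) (s : ℂ) : ℂ :=
  ∫ u in Set.Ioi (N : ℝ), ((Int.fract u : ℝ) : ℂ) * (u : ℂ) ^ (-s - 1)

/-- The fractional part, cut off below `N`. -/
noncomputable def fractAbove (N : ℕ) (u : ℝ) : ℂ :=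
  (Set.Ioi (N : ℝ)).indicator (fun u : ℝ => ((Int.fract u : ℝ) : ℂ)) u

theorem norm_fractAbove_le (N : ℕ) (u : ℝ) : ‖fractAbove N u‖ ≤ 1 := by
  unfold fractAbove
  refine (norm_indicator_le_norm_self _ _).trans ?_
  rw [Complex.norm_of_nonneg (Int.fract_nonneg u)]
  exact (Int.fract_lt_one u).le

theorem measurable_fractAbove (N : ℕ) : Measurable (fractAbove N) :=
  (Complex.measurable_ofReal.comp measurable_fract).indicator measurableSet_Ioi

/-- The Mellin form serves twice: it gives holomorphy of the tail, and it makes the restriction to a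
vertical line a Fourier transform. -/
theorem zetaTail_eq_mellin (N : ℕ) (s : ℂ) : zetaTail N s = mellin (fractAbove N) (-s) := by
  unfold zetaTail mellin
  rw [← integral_indicator measurableSet_Ioi, ← integral_indicator measurableSet_Ioi]
  congr 1; ext u
  by_cases h : (N : ℝ) < u
  · have h0 : (0 : ℝ) < u := lt_of_le_of_lt N.cast_nonneg h
    simp [fractAbove, Set.indicator, h, h0, mul_comm]
  · simp [fractAbove, Set.indicator, h]

theorem differentiableAt_zetaTail {N : ℕ} (hN : 1 ≤ N) {s : ℂ} (hs : 0 < s.re) :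
    DifferentiableAt ℂ (zetaTail N) s := by
  have h : DifferentiableAt ℂ (mellin (fractAbove N)) (-s) := by
    -- The function is bounded at infinity and vanishes on (0, 1), so any exponent below `(-s).re`
    -- would do at 0.
    refine mellin_differentiableAt_of_isBigO_rpow (a := 0) (b := (-s).re - 1) ?_ ?_ ?_ ?_ ?_
    · refine LocallyIntegrable.locallyIntegrableOn ?_ _
      exact (locallyIntegrable_const (1 : ℝ)).mono (measurable_fractAbove N).aestronglyMeasurable
        (ae_of_all _ fun x => by simpa using norm_fractAbove_le N x)
    · refine Asymptotics.IsBigO.of_bound 1 (Eventually.of_forall fun x => ?_)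
      simpa using norm_fractAbove_le N x
    · simpa using hs
    · refine Asymptotics.IsBigO.of_bound 1 ?_
      filter_upwards [mem_nhdsWithin_of_mem_nhds (Iio_mem_nhds (zero_lt_one (α := ℝ)))] with x hx
      have : ¬ (N : ℝ) < x := by
        have : (1 : ℝ) ≤ N := by exact_mod_cast hN
        have hx' : x < 1 := hx
        linarith
      simp [fractAbove, this]
    · linarith
  have e : zetaTail N = fun s => mellin (fractAbove N) (-s) := funext (zetaTail_eq_mellin N)
  rw [e]
  exact h.comp s differentiableAt_id.neg

theorem norm_zetaTail_le {N : ℕ} (hN : 1 ≤ N) {s : ℂ} (hs : 0 < s.re) :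
    ‖zetaTail N s‖ ≤ (N : ℝ) ^ (-s.re) / s.re := by
  have hN0 : (0 : ℝ) < N := by exact_mod_cast hN
  have h := integral_Ioi_rpow_of_lt (a := -s.re - 1) (by linarith) hN0
  have hi := integrableOn_Ioi_rpow_of_lt (a := -s.re - 1) (by linarith) hN0
  have : ‖zetaTail N s‖ ≤ ∫ u in Set.Ioi (N : ℝ), u ^ (-s.re - 1) := by
    refine norm_integral_le_of_norm_le hi ?_
    filter_upwards [ae_restrict_mem measurableSet_Ioi] with u hu
    have hu0 : 0 < u := hN0.trans hu
    rw [norm_mul, Complex.norm_cpow_eq_rpow_re_of_pos hu0, Complex.norm_of_nonneg (Int.fract_nonneg u)]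
    simp only [Complex.sub_re, Complex.neg_re, Complex.one_re]
    exact mul_le_of_le_one_left (by positivity) (Int.fract_lt_one u).le
  rw [h] at this
  refine this.trans (le_of_eq ?_)
  rw [show -s.re - 1 + 1 = -s.re by ring, neg_div_neg_eq]

/-- Abel summation for the indicator of n > N: its L-series is ζ minus the partial sum, its
summatory function is ⌊t⌋ - N for t > N, and ⌊t⌋ is t minus the fractional part. -/
theorem riemannZeta_eq_sum_add_of_one_lt {N : ℕ} (hN : 1 ≤ N) {s : ℂ} (hs : 1 < s.re) :
    riemannZeta s = ∑ n ∈ Finset.Icc 1 N, (n : ℂ) ^ (-s) + (N : ℂ) ^ (1 - s) / (s - 1)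
      - s * zetaTail N s := by
  have hN0 : (0 : ℝ) < N := by exact_mod_cast hN
  have hN1 : (1 : ℝ) ≤ N := by exact_mod_cast hN
  have hs0 : s ≠ 0 := by rintro rfl; simp at hs; linarith
  have hs1 : s - 1 ≠ 0 := by
    intro h; rw [sub_eq_zero.1 h] at hs; simp at hs
  set f : ℕ → ℂ := fun n => if N < n then 1 else 0 with hf
  have hz := LSeriesHasSum_one hs
  have hcount : ∀ n, ∑ k ∈ Finset.Icc 1 n, f k = ((n - N : ℕ) : ℂ) := by
    intro n
    rw [hf, Finset.sum_ite]
    simp only [Finset.sum_const, nsmul_eq_mul, mul_one, mul_zero, add_zero]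
    congr 1
    rw [show (Finset.Icc 1 n).filter (fun k => N < k) = Finset.Ioc N n by
      ext k; simp; omega]
    simp
  have hnorm : ∀ k, ‖f k‖ ≤ 1 := by
    intro k; simp only [hf]; split_ifs <;> simp
  have h1 := LSeries_eq_mul_integral' f (r := 1) zero_le_one hs (by
    refine Asymptotics.IsBigO.of_bound 1 (Eventually.of_forall fun n => ?_)
    rw [Real.norm_of_nonneg (Finset.sum_nonneg fun _ _ => norm_nonneg _)]
    refine (Finset.sum_le_sum fun k _ => hnorm k).trans ?_
    simp)
  have hsplit : LSeries f s = riemannZeta s - ∑ n ∈ Finset.Icc 1 N, (n : ℂ) ^ (-s) := by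
    have hg : HasSum (fun n => if n ∈ Finset.Icc 1 N then (n : ℂ) ^ (-s) else 0)
        (∑ n ∈ Finset.Icc 1 N, (n : ℂ) ^ (-s)) := by
      have := hasSum_sum_of_ne_finset_zero (L := SummationFilter.unconditional ℕ) (f := fun n : ℕ => if n ∈ Finset.Icc 1 N then (n : ℂ) ^ (-s) else 0)
        (s := Finset.Icc 1 N) (fun b hb => if_neg hb)
      rwa [Finset.sum_congr rfl fun n hn => if_pos hn] at this
    have hz' : HasSum (LSeries.term 1 s) (riemannZeta s) := hz
    refine ((hz'.sub hg).congr_fun fun n => ?_).tsum_eq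
    rcases Nat.eq_zero_or_pos n with rfl | hn
    · simp
    · rw [LSeries.term_of_ne_zero hn.ne', LSeries.term_of_ne_zero hn.ne']
      simp only [hf, Pi.one_apply, Finset.mem_Icc, Complex.cpow_neg]
      by_cases h : N < n
      · simp [h, not_le.2 h]
      · have h1 : 1 ≤ n := hn
        simp [h, not_lt.1 h, h1]
  have hint : ∫ t in Set.Ioi (1 : ℝ), (∑ k ∈ Finset.Icc 1 ⌊t⌋₊, f k) * (t : ℂ) ^ (-(s + 1))
      = ∫ t in Set.Ioi (N : ℝ), ((t : ℂ) ^ (-s) - N * (t : ℂ) ^ (-s - 1)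
        - ((Int.fract t : ℝ) : ℂ) * (t : ℂ) ^ (-s - 1)) := by
    rw [← integral_indicator measurableSet_Ioi, ← integral_indicator measurableSet_Ioi]
    congr 1; ext t
    by_cases h : (N : ℝ) < t
    · have h0 : (0 : ℝ) < t := hN0.trans h
      have h1 : (1 : ℝ) < t := hN1.trans_lt h
      have hle : N ≤ ⌊t⌋₊ := Nat.le_floor h.le
      rw [Set.indicator_of_mem (show t ∈ Set.Ioi (1:ℝ) from h1),
        Set.indicator_of_mem (show t ∈ Set.Ioi (N:ℝ) from h), hcount, Nat.cast_sub hle]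
      have e1 : ((⌊t⌋₊ : ℕ) : ℂ) = (t : ℂ) - ((Int.fract t : ℝ) : ℂ) := by
        have := natCast_floor_eq_intCast_floor (R := ℝ) h0.le
        have h2 := Int.self_sub_fract t
        have h3 : ((⌊t⌋₊ : ℕ) : ℝ) = t - Int.fract t := by rw [h2]; exact this
        rw [← Complex.ofReal_sub, ← h3]; simp
      have e2 : (t : ℂ) ^ (-s) = t * (t : ℂ) ^ (-s - 1) := by
        have ht : (t : ℂ) ≠ 0 := by exact_mod_cast h0.ne'
        rw [Complex.cpow_sub _ _ ht, Complex.cpow_one]; field_simp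
      rw [e1, e2, show -(s + 1) = -s - 1 by ring]; ring
    · rw [Set.indicator_of_notMem (show t ∉ Set.Ioi (N:ℝ) from h)]
      refine Set.indicator_apply_eq_zero.2 fun h1 => ?_
      have : ⌊t⌋₊ ≤ N := by
        have := Nat.floor_le_floor (not_lt.1 h); simpa using this
      rw [hcount, Nat.sub_eq_zero_of_le this]; simp
  have hi1 : IntegrableOn (fun t : ℝ => (t : ℂ) ^ (-s)) (Set.Ioi (N : ℝ)) :=
    integrableOn_Ioi_cpow_of_lt (by simpa using hs) hN0
  have hi2 : IntegrableOn (fun t : ℝ => (t : ℂ) ^ (-s - 1)) (Set.Ioi (N : ℝ)) :=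
    integrableOn_Ioi_cpow_of_lt (by simp; linarith) hN0
  have hi3 : IntegrableOn (fun t : ℝ => ((Int.fract t : ℝ) : ℂ) * (t : ℂ) ^ (-s - 1))
      (Set.Ioi (N : ℝ)) := by
    refine Integrable.bdd_mul (c := 1) hi2 ?_ (ae_of_all _ fun t => ?_)
    · exact (Complex.measurable_ofReal.comp measurable_fract).aestronglyMeasurable
    · rw [Complex.norm_of_nonneg (Int.fract_nonneg t)]; exact (Int.fract_lt_one t).le
  have hi4 : IntegrableOn (fun t : ℝ => (t : ℂ) ^ (-s) - N * (t : ℂ) ^ (-s - 1))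
      (Set.Ioi (N : ℝ)) := hi1.sub (hi2.const_mul _)
  rw [hint, integral_sub hi4 hi3, integral_sub hi1 (hi2.const_mul _),
    integral_const_mul, integral_Ioi_cpow_of_lt (by simpa using hs) hN0,
    integral_Ioi_cpow_of_lt (by simp; linarith) hN0, hsplit] at h1
  have hNc : (N : ℂ) ≠ 0 := by exact_mod_cast hN0.ne'
  have e3 : (N : ℂ) ^ (1 - s) = N * (N : ℂ) ^ (-s) := by
    rw [show (1 - s) = 1 + -s by ring, Complex.cpow_add _ _ hNc, Complex.cpow_one]
  simp only [Complex.ofReal_natCast] at h1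
  rw [show -s + 1 = 1 - s by ring, show -s - 1 + 1 = -s by ring, e3,
    show (1 - s) = -(s - 1) by ring] at h1
  rw [e3]
  have hm : -(s - 1) ≠ 0 := neg_ne_zero.2 hs1
  have key : riemannZeta s = ∑ n ∈ Finset.Icc 1 N, (n : ℂ) ^ (-s)
      + s * (-(N * (N : ℂ) ^ (-s)) / -(s - 1) - N * (-(N : ℂ) ^ (-s) / -s) - zetaTail N s) := by
    rw [zetaTail, ← h1]; ring
  rw [key]
  field_simp
  ring

/-- Analytic continuation from Re s > 1 by the identity theorem. Multiplication by s - 1 first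
removes the pole, so that the domain is the whole half-plane Re s > 0. -/
theorem riemannZeta_eq_sum_add {N : ℕ} (hN : 1 ≤ N) {s : ℂ} (hs : 0 < s.re) (hs1 : s ≠ 1) :
    riemannZeta s = ∑ n ∈ Finset.Icc 1 N, (n : ℂ) ^ (-s) + (N : ℂ) ^ (1 - s) / (s - 1)
      - s * zetaTail N s := by
  have hN0 : (N : ℂ) ≠ 0 := by exact_mod_cast (by omega : N ≠ 0)
  set U : Set ℂ := {s | 0 < s.re} with hU
  have hopen : IsOpen U := isOpen_lt continuous_const Complex.continuous_re
  have hconn : IsPreconnected U := (convex_halfSpace_re_gt 0).isPreconnected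
  have hd1 : DifferentiableOn ℂ riemannZeta₁ U := differentiable_riemannZeta₁.differentiableOn
  have hd2 : DifferentiableOn ℂ (fun s => (s - 1) * ∑ n ∈ Finset.Icc 1 N, (n : ℂ) ^ (-s)
      + (N : ℂ) ^ (1 - s) - (s - 1) * (s * zetaTail N s)) U := by
    intro z hz
    refine DifferentiableAt.differentiableWithinAt ?_
    refine DifferentiableAt.sub (DifferentiableAt.add ?_ ?_) ?_
    · refine (by fun_prop : DifferentiableAt ℂ (fun s : ℂ => s - 1) z).mul
        (DifferentiableAt.fun_sum fun n hn => ?_)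
      have : (n : ℂ) ≠ 0 := by
        have := (Finset.mem_Icc.1 hn).1
        exact_mod_cast (by omega : n ≠ 0)
      exact (differentiableAt_id.neg).const_cpow (Or.inl this)
    · exact DifferentiableAt.const_cpow (by fun_prop) (Or.inl hN0)
    · exact (by fun_prop : DifferentiableAt ℂ (fun s : ℂ => s - 1) z).mul
        (differentiableAt_id.mul (differentiableAt_zetaTail hN hz))
  have key := (hd1.analyticOnNhd hopen).eqOn_of_preconnected_of_eventuallyEq
    (hd2.analyticOnNhd hopen) hconn (z₀ := 2) (by simp [hU]) ?_ hs
  · have h1 : s - 1 ≠ 0 := sub_ne_zero.2 hs1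
    rw [riemannZeta_eq_inv_sub_mul hs1, key]
    field_simp
  have : {s : ℂ | 1 < s.re} ∈ 𝓝 (2 : ℂ) :=
    (isOpen_lt continuous_const Complex.continuous_re).mem_nhds (by simp)
  filter_upwards [this] with z hz
  have hz1 : z ≠ 1 := by rintro rfl; simp at hz
  have h1 : z - 1 ≠ 0 := sub_ne_zero.2 hz1
  have h2 := riemannZeta_eq_sum_add_of_one_lt hN hz
  rw [riemannZeta_eq_inv_sub_mul hz1] at h2
  field_simp at h2
  linear_combination h2

/-- The case N = 1 of the formula. A bound linear in |s| is all that is needed to control Re log ζ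
from above by log |t|. -/
theorem norm_riemannZeta_le {s : ℂ} (hs : 1 / 2 ≤ s.re) (him : 1 ≤ |s.im|) :
    ‖riemannZeta s‖ ≤ 2 + 2 * ‖s‖ := by
  have hs1 : s ≠ 1 := by rintro rfl; simp at him; linarith
  rw [riemannZeta_eq_sum_add le_rfl (by linarith) hs1]
  have h1 : 1 ≤ ‖s - 1‖ := by
    have := Complex.abs_im_le_norm (s - 1)
    simp at this; linarith
  have h2 := norm_zetaTail_le le_rfl (s := s) (by linarith)
  have h3 : ‖zetaTail 1 s‖ ≤ 2 := by
    refine h2.trans ?_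
    rw [Nat.cast_one, Real.one_rpow, div_le_iff₀ (by linarith)]; linarith
  simp only [Finset.Icc_self, Finset.sum_singleton, Nat.cast_one, Complex.one_cpow]
  calc _ ≤ ‖(1 : ℂ) + 1 / (s - 1)‖ + ‖s * zetaTail 1 s‖ := norm_sub_le _ _
    _ ≤ (‖(1 : ℂ)‖ + ‖1 / (s - 1)‖) + ‖s‖ * ‖zetaTail 1 s‖ := by
      rw [norm_mul]; gcongr; exact norm_add_le _ _
    _ ≤ (1 + 1) + ‖s‖ * 2 := by
      rw [norm_div, norm_one]
      gcongr
      rw [div_le_one (by linarith)]; exact h1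
    _ = _ := by ring

/-- After the substitution x = e^(-u) the tail on a vertical line is a Fourier transform, and the
local Plancherel inequality applies. The bound does not grow with A, which saves a factor A over the
pointwise bound `norm_zetaTail_le`. -/
theorem integral_norm_zetaTail_sq_le {N : ℕ} (hN : 1 ≤ N) {σ : ℝ} (hσ : 0 < σ) {A : ℝ}
    (hA : 0 < A) :
    ∫ t in (-A)..A, ‖zetaTail N (σ + t * Complex.I)‖ ^ 2
      ≤ 2 * Real.pi * Real.exp 1 * ((N : ℝ) ^ (-(2 * σ)) / (2 * σ)) := by
  have hN0 : (0 : ℝ) < N := by exact_mod_cast hN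
  set g : ℝ → ℂ := fun u => Real.exp (σ * u) • fractAbove N (Real.exp (-u)) with hg
  have hgm : Measurable g := by
    have h1 : Measurable fun u : ℝ => Real.exp (σ * u) := by fun_prop
    have h2 : Measurable fun u : ℝ => Real.exp (-u) := by fun_prop
    exact h1.smul ((measurable_fractAbove N).comp h2)
  have hgle : ∀ u, ‖g u‖ ≤ (Set.Iic (-Real.log N)).indicator (fun u => Real.exp (σ * u)) u := by
    intro u
    by_cases h : u ≤ -Real.log N
    · rw [Set.indicator_of_mem (show u ∈ Set.Iic (-Real.log N) from h), hg, norm_smul,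
        Real.norm_of_nonneg (Real.exp_pos _).le]
      exact mul_le_of_le_one_right (Real.exp_pos _).le (norm_fractAbove_le _ _)
    · have : ¬ (N : ℝ) < Real.exp (-u) := by
        rw [not_lt, ← Real.le_log_iff_exp_le hN0]; linarith
      simp [hg, fractAbove, this, Set.indicator, h]
  have hi1 : Integrable g := by
    refine Integrable.mono' ?_ hgm.aestronglyMeasurable (ae_of_all _ hgle)
    rw [integrable_indicator_iff measurableSet_Iic]
    exact integrableOn_exp_mul_Iic hσ _
  have hle2 : ∀ u, ‖g u‖ ^ 2
      ≤ (Set.Iic (-Real.log N)).indicator (fun u => Real.exp (2 * σ * u)) u := by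
    intro u
    refine (pow_le_pow_left₀ (norm_nonneg _) (hgle u) 2).trans (le_of_eq ?_)
    by_cases h : u ∈ Set.Iic (-Real.log N)
    · rw [Set.indicator_of_mem h, Set.indicator_of_mem h, ← Real.exp_nat_mul]
      congr 1; push_cast; ring
    · rw [Set.indicator_of_notMem h, Set.indicator_of_notMem h]; norm_num
  have hi2' : Integrable ((Set.Iic (-Real.log N)).indicator (fun u => Real.exp (2 * σ * u))) := by
    rw [integrable_indicator_iff measurableSet_Iic]
    exact integrableOn_exp_mul_Iic (by positivity) _
  have hi2 : Integrable (fun u => ‖g u‖ ^ 2) := by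
    refine Integrable.mono' hi2' (hgm.norm.pow_const 2).aestronglyMeasurable
      (ae_of_all _ fun u => ?_)
    rw [Real.norm_of_nonneg (by positivity)]; exact hle2 u
  have hint : ∫ u, ‖g u‖ ^ 2 ≤ (N : ℝ) ^ (-(2 * σ)) / (2 * σ) := by
    refine (integral_mono hi2 hi2' hle2).trans (le_of_eq ?_)
    rw [integral_indicator measurableSet_Iic, integral_exp_mul_Iic (by positivity)]
    congr 1
    rw [Real.rpow_def_of_pos hN0]; congr 1; ring
  have hF : ∀ t : ℝ, zetaTail N (σ + t * Complex.I)
      = FourierTransform.fourier g (-t / (2 * Real.pi)) := by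
    intro t
    rw [zetaTail_eq_mellin, mellin_eq_fourier]
    simp [hg]
  have hcomp : ∫ t in (-A)..A, ‖zetaTail N (σ + t * Complex.I)‖ ^ 2
      = 2 * Real.pi * ∫ t in (-(A / (2 * Real.pi)))..(A / (2 * Real.pi)),
        ‖FourierTransform.fourier g t‖ ^ 2 := by
    simp_rw [hF]
    have := intervalIntegral.integral_comp_div (a := -A) (b := A)
      (fun t => ‖FourierTransform.fourier g t‖ ^ 2) (c := -(2 * Real.pi))
      (neg_ne_zero.2 (by positivity))
    simp_rw [show ∀ t : ℝ, -t / (2 * Real.pi) = t / -(2 * Real.pi) from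
      fun t => by rw [neg_div, div_neg]]
    rw [this, intervalIntegral.integral_symm]
    simp [div_neg, neg_div]
  have hA2 : 0 < A / (2 * Real.pi) := by positivity
  have := setIntegral_norm_fourier_sq_le hi1 hi2 hA2
  rw [integral_Icc_eq_integral_Ioc, ← intervalIntegral.integral_of_le (by linarith)] at this
  rw [hcomp, mul_assoc (2 * Real.pi)]
  gcongr
  exact this.trans (by gcongr)


/-! ### The divisor bound and a mean value theorem for Dirichlet polynomials -/

/-- For every `ε > 0` the number of divisors of `n` is `O(n ^ ε)`. -/
theorem exists_card_divisors_le {ε : ℝ} (hε : 0 < ε) :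
    ∃ C : ℝ, 1 ≤ C ∧ ∀ n : ℕ, n ≠ 0 → (n.divisors.card : ℝ) ≤ C * (n : ℝ) ^ ε := by
  have hl : 0 < Real.log 2 := Real.log_pos one_lt_two
  -- For a prime p with p^ε ≥ 2 one has v + 1 ≤ 2^v ≤ p^(εv) with no loss. Only the primes below P ≥
  -- 2^(1/ε) cost a constant, namely B each, whence C = B^P.
  set B : ℝ := max 1 (1 / (ε * Real.log 2)) with hB
  have hB1 : 1 ≤ B := le_max_left _ _
  obtain ⟨P, hP⟩ := exists_nat_ge ((2 : ℝ) ^ (1 / ε))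
  have hloc : ∀ p v : ℕ, 2 ≤ p → ((v : ℝ) + 1) ≤ (if p < P then B else 1) * ((p : ℝ) ^ v) ^ ε := by
    intro p v hp
    have hp2 : (2 : ℝ) ≤ p := by exact_mod_cast hp
    have e : ((p : ℝ) ^ v) ^ ε = ((p : ℝ) ^ ε) ^ v := by
      rw [← Real.rpow_natCast, ← Real.rpow_natCast, ← Real.rpow_mul (by positivity),
        ← Real.rpow_mul (by positivity), mul_comm]
    rw [e]
    split_ifs with h
    · have h1 : 1 + (v : ℝ) * (ε * Real.log 2) ≤ ((p : ℝ) ^ ε) ^ v := by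
        have : (2 : ℝ) ^ ε ≤ (p : ℝ) ^ ε := Real.rpow_le_rpow (by norm_num) hp2 hε.le
        refine le_trans ?_ (pow_le_pow_left₀ (by positivity) this v)
        rw [Real.rpow_def_of_pos (by norm_num), ← Real.exp_nat_mul]
        have := Real.add_one_le_exp ((v : ℝ) * (Real.log 2 * ε))
        linarith
      have h2 : 1 ≤ B * (ε * Real.log 2) := by
        have : 1 / (ε * Real.log 2) ≤ B := le_max_right _ _
        rwa [div_le_iff₀ (by positivity)] at this
      calc (v : ℝ) + 1 ≤ B * (1 + v * (ε * Real.log 2)) := by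
            nlinarith [mul_le_mul_of_nonneg_left h2 (Nat.cast_nonneg (α := ℝ) v)]
        _ ≤ _ := by gcongr
    · have hPp : (P : ℝ) ≤ p := by exact_mod_cast not_lt.1 h
      have h1 : (2 : ℝ) ≤ (p : ℝ) ^ ε := by
        have := Real.rpow_le_rpow (by positivity) (hP.trans hPp) hε.le
        rwa [← Real.rpow_mul (by norm_num), one_div_mul_cancel hε.ne', Real.rpow_one] at this
      rw [one_mul]
      have h2 : ((v : ℝ) + 1) ≤ 2 ^ v := by
        exact_mod_cast (Nat.lt_two_pow_self : v < 2 ^ v)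
      exact h2.trans (pow_le_pow_left₀ (by norm_num) h1 v)
  refine ⟨B ^ P, one_le_pow₀ hB1, fun n hn => ?_⟩
  rw [Nat.card_divisors hn]
  have hn' : (n : ℝ) ^ ε = ∏ p ∈ n.primeFactors, ((p : ℝ) ^ (n.factorization p)) ^ ε := by
    rw [Real.finsetProd_rpow _ _ (fun _ _ => by positivity)]
    congr 1
    conv_lhs => rw [← Nat.prod_factorization_pow_eq_self hn]
    rw [Finsupp.prod, Nat.support_factorization]
    push_cast
    rfl
  rw [hn']
  push_cast
  calc ∏ p ∈ n.primeFactors, ((n.factorization p : ℝ) + 1)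
      ≤ ∏ p ∈ n.primeFactors,
          ((if p < P then B else 1) * ((p : ℝ) ^ (n.factorization p)) ^ ε) :=
        Finset.prod_le_prod (fun _ _ => by positivity)
          (fun p hp => hloc p _ (Nat.prime_of_mem_primeFactors hp).two_le)
    _ = (∏ p ∈ n.primeFactors, (if p < P then B else 1)) *
          ∏ p ∈ n.primeFactors, ((p : ℝ) ^ (n.factorization p)) ^ ε := Finset.prod_mul_distrib
    _ ≤ _ := by
        refine mul_le_mul_of_nonneg_right ?_ (Finset.prod_nonneg fun _ _ => by positivity)
        rw [Finset.prod_ite]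
        simp only [Finset.prod_const, mul_one, one_pow]
        refine pow_le_pow_right₀ hB1 ?_
        calc _ ≤ (Finset.range P).card := Finset.card_le_card fun p hp => by
              simp at hp ⊢; exact hp.2
          _ = P := Finset.card_range P

/-- The function `t ↦ n ^ (-it)`. -/
noncomputable def natPow (n : ℕ) (t : ℝ) : ℂ :=
  Complex.exp ((-(Real.log n * t) : ℝ) * Complex.I)

theorem norm_natPow (n : ℕ) (t : ℝ) : ‖natPow n t‖ = 1 := Complex.norm_exp_ofReal_mul_I _

theorem continuous_natPow (n : ℕ) : Continuous (natPow n) := by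
  unfold natPow; fun_prop

theorem natPow_mul_conj_self (n : ℕ) (t : ℝ) : natPow n t * conj (natPow n t) = 1 := by
  rw [Complex.mul_conj, Complex.normSq_eq_norm_sq, norm_natPow]; simp

theorem natCast_cpow_add_mul_I {n : ℕ} (hn : n ≠ 0) (z : ℂ) (t : ℝ) :
    (n : ℂ) ^ (-(z + t * Complex.I)) = (n : ℂ) ^ (-z) * natPow n t := by
  have h : (n : ℂ) ≠ 0 := by exact_mod_cast hn
  rw [neg_add, Complex.cpow_add _ _ h]
  congr 1
  rw [natPow, Complex.cpow_def_of_ne_zero h, ← Complex.natCast_log]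
  congr 1; push_cast; ring

/-- From log x ≥ 1 - 1/x at the quotient of the two integers. The factor 1/|n - m| is kept so that
the off-diagonal terms sum to a harmonic series. -/
theorem inv_abs_log_sub_log_le {n m : ℕ} (hn : n ≠ 0) (hm : m ≠ 0) (hnm : n ≠ m) :
    1 / |Real.log m - Real.log n| ≤ 1 + (min n m : ℕ) / |(n : ℝ) - m| := by
  wlog h : n < m generalizing n m
  · rw [abs_sub_comm, abs_sub_comm (n : ℝ), min_comm]
    exact this hm hn hnm.symm (lt_of_le_of_ne (not_lt.1 h) hnm.symm)
  have hn0 : (0 : ℝ) < n := by exact_mod_cast Nat.pos_of_ne_zero hn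
  have hm0 : (0 : ℝ) < m := by exact_mod_cast Nat.pos_of_ne_zero hm
  have hlt : (n : ℝ) < m := by exact_mod_cast h
  rw [← Real.log_div hm0.ne' hn0.ne', min_eq_left h.le, abs_sub_comm (n : ℝ),
    abs_of_pos (sub_pos.2 hlt)]
  have h1 := Real.one_sub_inv_le_log_of_pos (x := (m : ℝ) / n) (by positivity)
  rw [inv_div] at h1
  have h2 : 0 < 1 - (n : ℝ) / m := by rw [sub_pos, div_lt_one hm0]; exact hlt
  rw [abs_of_pos (h2.trans_le h1)]
  calc 1 / Real.log (m / n) ≤ 1 / (1 - n / m) := one_div_le_one_div_of_le h2 h1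
    _ = 1 + n / (m - n) := by
      have : (m : ℝ) - n ≠ 0 := (sub_pos.2 hlt).ne'
      have h3 : 1 - (n : ℝ) / m ≠ 0 := h2.ne'
      field_simp
      ring

theorem norm_integral_natPow_mul_conj_le {n m : ℕ} (hn : n ≠ 0) (hm : m ≠ 0) (hnm : n ≠ m)
    (a b : ℝ) :
    ‖∫ t in a..b, natPow n t * conj (natPow m t)‖
      ≤ 2 * (1 + (min n m : ℕ) / |(n : ℝ) - m|) := by
  set l : ℝ := Real.log m - Real.log n with hl
  have hl0 : l ≠ 0 := by
    rw [hl, sub_ne_zero]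
    intro h
    have hn0 : (0 : ℝ) < n := by exact_mod_cast Nat.pos_of_ne_zero hn
    have hm0 : (0 : ℝ) < m := by exact_mod_cast Nat.pos_of_ne_zero hm
    exact hnm (by exact_mod_cast (Real.log_injOn_pos hm0 hn0 h).symm)
  have e : ∀ t : ℝ, natPow n t * conj (natPow m t) = Complex.exp ((l * Complex.I) * t) := by
    intro t
    rw [natPow, natPow, ← Complex.exp_conj, ← Complex.exp_add]
    congr 1
    simp only [map_mul, Complex.conj_ofReal, Complex.conj_I, hl]
    push_cast; ring
  have hc : (l * Complex.I : ℂ) ≠ 0 := mul_ne_zero (by exact_mod_cast hl0) Complex.I_ne_zero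
  simp_rw [e]
  rw [integral_exp_mul_complex hc, norm_div]
  have h1 : ∀ x : ℝ, ‖Complex.exp (l * Complex.I * x)‖ = 1 := by
    intro x
    rw [show (l * Complex.I * x : ℂ) = ((l * x : ℝ) : ℂ) * Complex.I by push_cast; ring]
    exact Complex.norm_exp_ofReal_mul_I _
  have h2 : ‖(l * Complex.I : ℂ)‖ = |l| := by simp
  rw [h2]
  calc _ ≤ 2 / |l| := by
        gcongr
        refine (norm_sub_le _ _).trans ?_
        rw [h1, h1]; norm_num
    _ = 2 * (1 / |l|) := by ring
    _ ≤ _ := by gcongr; exact inv_abs_log_sub_log_le hn hm hnm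

/-- On each side of n the distances |n - m| are distinct integers between 1 and L, so each side is
at most a harmonic sum. -/
theorem sum_inv_abs_sub_le {L n : ℕ} (hn : n ∈ Finset.Icc 1 L) {S : Finset ℕ}
    (hS : S ⊆ Finset.Icc 1 L) :
    ∑ m ∈ S.erase n, 1 / |(n : ℝ) - m| ≤ 2 * (1 + Real.log L) := by
  have hH : ∑ j ∈ Finset.Icc 1 L, 1 / (j : ℝ) ≤ 1 + Real.log L := by
    have := harmonic_le_one_add_log L
    rw [harmonic_eq_sum_Icc] at this
    push_cast at this
    simpa [one_div] using this
  rw [Finset.mem_Icc] at hn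
  have h0 : ∀ T : Finset ℕ, ∀ φ : ℕ → ℕ, Set.InjOn φ T → (∀ m ∈ T, φ m ∈ Finset.Icc 1 L) →
      (∀ m ∈ T, |(n : ℝ) - m| = φ m) → ∑ m ∈ T, 1 / |(n : ℝ) - m| ≤ 1 + Real.log L := by
    intro T φ hinj hmaps heq
    rw [Finset.sum_congr rfl fun m hm => by rw [heq m hm],
      ← Finset.sum_image (f := fun j : ℕ => 1 / (j : ℝ)) hinj]
    refine le_trans (Finset.sum_le_sum_of_subset_of_nonneg ?_ fun _ _ _ => by positivity) hH
    intro j hj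
    obtain ⟨m, hm, rfl⟩ := Finset.mem_image.1 hj
    exact hmaps m hm
  rw [← Finset.sum_filter_add_sum_filter_not _ (fun m => m < n), two_mul]
  refine add_le_add (h0 _ (fun m => n - m) ?_ ?_ ?_) (h0 _ (fun m => m - n) ?_ ?_ ?_)
  · intro x hx y hy h
    simp at hx hy h; omega
  · intro m hm
    simp at hm ⊢
    omega
  · intro m hm
    simp at hm
    rw [Nat.cast_sub hm.2.le, abs_of_pos]
    have : (m : ℝ) < n := by exact_mod_cast hm.2
    linarith
  · intro x hx y hy h
    simp at hx hy h; omega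
  · intro m hm
    have := hS (Finset.mem_of_mem_erase (Finset.mem_filter.1 hm).1)
    simp at hm this ⊢
    omega
  · intro m hm
    simp at hm
    rw [Nat.cast_sub hm.2, abs_sub_comm, abs_of_nonneg]
    have : (n : ℝ) ≤ m := by exact_mod_cast hm.2
    linarith

/-- A mean value theorem for Dirichlet polynomials. -/
theorem integral_norm_dirichletPoly_sq_le {L : ℕ} {S : Finset ℕ} (hS : S ⊆ Finset.Icc 1 L)
    (c : ℕ → ℂ) {a b : ℝ} (hab : a ≤ b) :
    ∫ t in a..b, ‖∑ n ∈ S, c n * natPow n t‖ ^ 2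
      ≤ (b - a) * ∑ n ∈ S, ‖c n‖ ^ 2 + 2 * (∑ n ∈ S, ‖c n‖) ^ 2
        + 4 * (1 + Real.log L) * ∑ n ∈ S, (n : ℝ) * ‖c n‖ ^ 2 := by
  have hne : ∀ n ∈ S, n ≠ 0 := fun n hn => by
    have := hS hn; simp at this; omega
  set J : ℕ → ℕ → ℂ := fun n m => ∫ t in a..b, natPow n t * conj (natPow m t) with hJ
  have hJii : ∀ n m, IntervalIntegrable (fun t => natPow n t * conj (natPow m t)) volume a b :=
    fun n m => (((continuous_natPow n).mul
      (Complex.continuous_conj.comp (continuous_natPow m))).intervalIntegrable _ _)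
  have hexp : ((∫ t in a..b, ‖∑ n ∈ S, c n * natPow n t‖ ^ 2 : ℝ) : ℂ)
      = ∑ n ∈ S, ∑ m ∈ S, c n * conj (c m) * J n m := by
    rw [← intervalIntegral.integral_ofReal]
    have e : ∀ t, ((‖∑ n ∈ S, c n * natPow n t‖ ^ 2 : ℝ) : ℂ)
        = ∑ n ∈ S, ∑ m ∈ S, c n * conj (c m) * (natPow n t * conj (natPow m t)) := by
      intro t
      rw [← Complex.normSq_eq_norm_sq, ← Complex.mul_conj, map_sum, Finset.sum_mul_sum]
      refine Finset.sum_congr rfl fun n _ => Finset.sum_congr rfl fun m _ => ?_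
      rw [map_mul]; ring
    simp_rw [e]
    rw [intervalIntegral.integral_finsetSum]
    · refine Finset.sum_congr rfl fun n _ => ?_
      rw [intervalIntegral.integral_finsetSum]
      · refine Finset.sum_congr rfl fun m _ => ?_
        rw [intervalIntegral.integral_const_mul]
      · intro m _; exact (hJii n m).const_mul _
    · intro n _
      exact (continuous_finsetSum _ fun m _ => continuous_const.mul ((continuous_natPow n).mul
        (Complex.continuous_conj.comp (continuous_natPow m)))).intervalIntegrable _ _
  have hdiag : ∀ n, J n n = ((b - a : ℝ) : ℂ) := by
    intro n; simp [hJ, natPow_mul_conj_self]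
  have h0 : 0 ≤ ∫ t in a..b, ‖∑ n ∈ S, c n * natPow n t‖ ^ 2 :=
    intervalIntegral.integral_nonneg hab fun _ _ => by positivity
  have h1 := congrArg norm hexp
  rw [Complex.norm_of_nonneg h0] at h1
  rw [h1]
  -- The product 2|c n||c m| is split into squares, and min n m is replaced by the index belonging
  -- to each square. The two resulting families are exchanged by swapping n and m, so only the sum
  -- of n|c n|² times a harmonic sum remains.
  have hrow : ∀ n ∈ S, ‖∑ m ∈ S, c n * conj (c m) * J n m‖ ≤ (b - a) * ‖c n‖ ^ 2
      + (2 * ‖c n‖ * ∑ m ∈ S, ‖c m‖ + ∑ m ∈ S.erase n,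
        ((n : ℝ) * ‖c n‖ ^ 2 * (1 / |(n : ℝ) - m|) + (m : ℝ) * ‖c m‖ ^ 2 * (1 / |(m : ℝ) - n|))) := by
    intro n hn
    rw [← Finset.add_sum_erase _ _ hn]
    refine (norm_add_le _ _).trans (add_le_add ?_ ?_)
    · rw [hdiag, norm_mul, norm_mul, RCLike.norm_conj, Complex.norm_of_nonneg (by linarith)]
      exact le_of_eq (by ring)
    · refine (norm_sum_le _ _).trans ?_
      have h2 : ∑ m ∈ S.erase n, ‖c m‖ ≤ ∑ m ∈ S, ‖c m‖ :=
        Finset.sum_le_sum_of_subset_of_nonneg (Finset.erase_subset _ _) fun _ _ _ => norm_nonneg _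
      refine le_trans ?_ (add_le_add_left (mul_le_mul_of_nonneg_left h2 (by positivity)) _)
      rw [Finset.mul_sum, ← Finset.sum_add_distrib]
      refine Finset.sum_le_sum fun m hm => ?_
      obtain ⟨hmn, hmS⟩ := Finset.mem_erase.1 hm
      have h3 := norm_integral_natPow_mul_conj_le (hne n hn) (hne m hmS) hmn.symm a b
      rw [norm_mul, norm_mul, RCLike.norm_conj]
      rw [abs_sub_comm (m : ℝ)]
      set D : ℝ := 1 / |(n : ℝ) - m| with hD
      have hD0 : 0 ≤ D := by positivity
      have hmin : ((min n m : ℕ) : ℝ) / |(n : ℝ) - m| = (min n m : ℕ) * D := by rw [hD]; ring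
      rw [hmin] at h3
      calc ‖c n‖ * ‖c m‖ * ‖J n m‖ ≤ ‖c n‖ * ‖c m‖ * (2 * (1 + (min n m : ℕ) * D)) := by
            gcongr
        _ = 2 * ‖c n‖ * ‖c m‖ + (2 * ‖c n‖ * ‖c m‖) * ((min n m : ℕ) * D) := by ring
        _ ≤ 2 * ‖c n‖ * ‖c m‖ + (‖c n‖ ^ 2 + ‖c m‖ ^ 2) * ((min n m : ℕ) * D) := by
            gcongr; exact two_mul_le_add_sq _ _
        _ = 2 * ‖c n‖ * ‖c m‖ + (((min n m : ℕ) : ℝ) * ‖c n‖ ^ 2 * D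
              + ((min n m : ℕ) : ℝ) * ‖c m‖ ^ 2 * D) := by ring
        _ ≤ _ := by
            gcongr
            · exact min_le_left _ _
            · exact min_le_right _ _
  have hL : ∀ n ∈ S, ∑ m ∈ S.erase n, (n : ℝ) * ‖c n‖ ^ 2 * (1 / |(n : ℝ) - m|)
      ≤ 2 * (1 + Real.log L) * ((n : ℝ) * ‖c n‖ ^ 2) := by
    intro n hn
    rw [← Finset.mul_sum, mul_comm]
    gcongr
    exact sum_inv_abs_sub_le (hS hn) hS
  have hsym : ∑ n ∈ S, ∑ m ∈ S.erase n, (m : ℝ) * ‖c m‖ ^ 2 * (1 / |(m : ℝ) - n|)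
      = ∑ n ∈ S, ∑ m ∈ S.erase n, (n : ℝ) * ‖c n‖ ^ 2 * (1 / |(n : ℝ) - m|) := by
    refine Finset.sum_comm' fun x y => ?_
    simp only [Finset.mem_erase]
    tauto
  calc _ ≤ ∑ n ∈ S, ‖∑ m ∈ S, c n * conj (c m) * J n m‖ := norm_sum_le _ _
    _ ≤ _ := Finset.sum_le_sum hrow
    _ = (b - a) * ∑ n ∈ S, ‖c n‖ ^ 2 + 2 * (∑ n ∈ S, ‖c n‖) ^ 2
        + 2 * ∑ n ∈ S, ∑ m ∈ S.erase n, (n : ℝ) * ‖c n‖ ^ 2 * (1 / |(n : ℝ) - m|) := by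
      simp_rw [Finset.sum_add_distrib]
      rw [hsym, ← Finset.mul_sum, ← Finset.sum_mul, ← Finset.mul_sum]; ring
    _ ≤ _ := by
      have := Finset.sum_le_sum hL
      rw [← Finset.mul_sum] at this
      linarith


/-! ### The mollifier and the mean square of ζM - 1 -/

/-- The partial sum `∑_{d ≤ y} μ(d) d^{-s}` of the Dirichlet series of `1 / ζ`. -/
noncomputable def mollifier (y : ℕ) (s : ℂ) : ℂ :=
  ∑ d ∈ Finset.Icc 1 y, ((ArithmeticFunction.moebius d : ℤ) : ℂ) * (d : ℂ) ^ (-s)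

/-- The coefficients of `(∑_{m ≤ N} m^{-s}) * mollifier y s`. -/
noncomputable def mollifiedCoeff (N y n : ℕ) : ℂ :=
  ∑ d ∈ n.divisors with d ≤ y ∧ n / d ≤ N, ((ArithmeticFunction.moebius d : ℤ) : ℂ)

theorem norm_moebius_le_one (d : ℕ) : ‖((ArithmeticFunction.moebius d : ℤ) : ℂ)‖ ≤ 1 := by
  rw [Complex.norm_intCast]
  exact_mod_cast ArithmeticFunction.abs_moebius_le_one

theorem norm_mollifiedCoeff_le (N y n : ℕ) : ‖mollifiedCoeff N y n‖ ≤ n.divisors.card := by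
  unfold mollifiedCoeff
  refine (norm_sum_le _ _).trans ((Finset.sum_le_sum fun d _ => norm_moebius_le_one d).trans ?_)
  simp only [Finset.sum_const, nsmul_eq_mul, mul_one]
  exact_mod_cast Finset.card_filter_le _ _

/-- In this range both cut-offs are void and Möbius inversion applies. So the mollified partial sum
is 1 plus terms with n > y, and this is where the saving comes from. -/
theorem mollifiedCoeff_of_le {N y n : ℕ} (hy : n ≤ y) (hN : n ≤ N) :
    mollifiedCoeff N y n = if n = 1 then 1 else 0 := by
  unfold mollifiedCoeff
  rw [Finset.filter_true_of_mem]
  · have := ArithmeticFunction.coe_zeta_mul_moebius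
    have h2 := congrArg (fun f : ArithmeticFunction ℤ => f n) this
    simp only [ArithmeticFunction.coe_zeta_mul_apply, ArithmeticFunction.one_apply] at h2
    rw [← Int.cast_sum, h2]; split_ifs <;> simp
  · intro d hd
    exact ⟨(Nat.divisor_le hd).trans hy, (Nat.div_le_self _ _).trans hN⟩

theorem sum_mul_mollifier {N y : ℕ} (s : ℂ) :
    (∑ m ∈ Finset.Icc 1 N, (m : ℂ) ^ (-s)) * mollifier y s
      = ∑ n ∈ Finset.Icc 1 (N * y), mollifiedCoeff N y n * (n : ℂ) ^ (-s) := by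
  rw [mollifier, Finset.sum_mul_sum, ← Finset.sum_product',
    ← Finset.sum_fiberwise_of_maps_to (g := fun p : ℕ × ℕ => p.1 * p.2)
      (t := Finset.Icc 1 (N * y))]
  · refine Finset.sum_congr rfl fun n hn => ?_
    have hn0 : n ≠ 0 := by simp at hn; omega
    rw [mollifiedCoeff, Finset.sum_mul]
    refine Finset.sum_bij' (fun p _ => p.2) (fun d _ => (n / d, d)) ?_ ?_ ?_ ?_ ?_
    · rintro ⟨m, d⟩ h
      simp only [Finset.mem_filter, Finset.mem_product, Finset.mem_Icc, Nat.mem_divisors] at h ⊢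
      obtain ⟨⟨⟨h1, h2⟩, h3, h4⟩, rfl⟩ := h
      refine ⟨⟨Dvd.intro_left _ rfl, hn0⟩, h4, ?_⟩
      rw [Nat.mul_div_cancel _ (by omega)]; exact h2
    · intro d h
      simp only [Finset.mem_filter, Finset.mem_product, Finset.mem_Icc, Nat.mem_divisors] at h ⊢
      obtain ⟨⟨h1, _⟩, h2, h3⟩ := h
      have hd : 0 < d := Nat.pos_of_dvd_of_pos h1 (Nat.pos_of_ne_zero hn0)
      exact ⟨⟨⟨Nat.div_pos (Nat.le_of_dvd (Nat.pos_of_ne_zero hn0) h1) hd, h3⟩, hd, h2⟩,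
        Nat.div_mul_cancel h1⟩
    · rintro ⟨m, d⟩ h
      simp only [Finset.mem_filter, Finset.mem_product, Finset.mem_Icc] at h
      obtain ⟨⟨⟨h1, h2⟩, h3, h4⟩, rfl⟩ := h
      simp only [Prod.mk.injEq, and_true]
      exact Nat.mul_div_cancel _ (by omega)
    · intro d h; rfl
    · rintro ⟨m, d⟩ h
      simp only [Finset.mem_filter, Finset.mem_product, Finset.mem_Icc] at h
      obtain ⟨⟨⟨h1, h2⟩, h3, h4⟩, rfl⟩ := h
      rw [Nat.cast_mul, Complex.natCast_mul_natCast_cpow]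
      ring
  · rintro ⟨m, d⟩ h
    simp only [Finset.mem_product, Finset.mem_Icc] at h ⊢
    exact ⟨Nat.mul_pos h.1.1 h.2.1, Nat.mul_le_mul h.1.2 h.2.2⟩

theorem sum_mul_mollifier_sub_one {N y : ℕ} (hy : 1 ≤ y) (hN : y ≤ N) (s : ℂ) :
    (∑ m ∈ Finset.Icc 1 N, (m : ℂ) ^ (-s)) * mollifier y s - 1
      = ∑ n ∈ Finset.Icc (y + 1) (N * y), mollifiedCoeff N y n * (n : ℂ) ^ (-s) := by
  rw [sum_mul_mollifier]
  have hle : y ≤ N * y := Nat.le_mul_of_pos_left _ (by omega)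
  have hsplit : Finset.Icc 1 (N * y) = Finset.Icc 1 y ∪ Finset.Icc (y + 1) (N * y) := by
    ext n; simp; omega
  rw [hsplit, Finset.sum_union]
  · rw [Finset.sum_eq_single_of_mem 1 (by simp; omega)]
    · rw [mollifiedCoeff_of_le hy (hy.trans hN)]; simp
    · intro n hn hn1
      simp at hn
      rw [mollifiedCoeff_of_le hn.2 (hn.2.trans hN)]; simp [hn1]
  · rw [Finset.disjoint_left]; intro n h1 h2; simp at h1 h2; omega

theorem norm_mollifier_le {y : ℕ} {s : ℂ} (hs : 0 ≤ s.re) : ‖mollifier y s‖ ≤ y := by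
  unfold mollifier
  refine (norm_sum_le _ _).trans ?_
  calc _ ≤ ∑ d ∈ Finset.Icc 1 y, (1 : ℝ) := by
        refine Finset.sum_le_sum fun d hd => ?_
        have hd1 : 1 ≤ d := (Finset.mem_Icc.1 hd).1
        rw [norm_mul, Complex.norm_natCast_cpow_of_pos (by omega)]
        refine mul_le_one₀ (norm_moebius_le_one d) (by positivity) ?_
        exact Real.rpow_le_one_of_one_le_of_nonpos (by exact_mod_cast hd1) (by simpa using hs)
    _ = y := by simp

theorem differentiable_mollifier (y : ℕ) : Differentiable ℂ (mollifier y) := by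
  unfold mollifier
  refine Differentiable.fun_sum fun d hd => ?_
  have hd1 : (d : ℂ) ≠ 0 := by
    have := (Finset.mem_Icc.1 hd).1
    exact_mod_cast (by omega : d ≠ 0)
  intro s
  exact ((differentiableAt_id.neg).const_cpow (Or.inl hd1)).const_mul _

theorem rpow_sq {x : ℝ} (hx : 0 ≤ x) (a : ℝ) : (x ^ a) ^ 2 = x ^ (2 * a) := by
  rw [← Real.rpow_natCast, ← Real.rpow_mul hx]; congr 1; push_cast; ring

/-- The mean square of the tail of `ζ`-partial-sum times mollifier. -/
theorem exists_integral_norm_mollified_partial_sq_le {κ : ℝ} (hκ : 0 < κ) (hκ1 : κ ≤ 1 / 4) :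
    ∃ C : ℝ, 0 < C ∧ ∀ T : ℝ, 1 ≤ T → ∀ y N : ℕ, 1 ≤ y → y ≤ N → T ^ (κ / 2) ≤ y + 1 →
      (y : ℝ) ≤ T ^ (κ / 2) → (N : ℝ) ≤ 2 * T → ∀ σ : ℝ, 1 / 2 + κ ≤ σ →
      ∫ t in (T / 2)..(3 * T),
        ‖(∑ m ∈ Finset.Icc 1 N, (m : ℂ) ^ (-(σ + t * Complex.I : ℂ))) *
          mollifier y (σ + t * Complex.I) - 1‖ ^ 2 ≤ C * T ^ (1 - κ ^ 2 / 4) := by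
  obtain ⟨C₀, hC₀, hdiv⟩ := exists_card_divisors_le (ε := κ / 4) (by positivity)
  set Z : ℝ := ∑' n : ℕ, 1 / (n : ℝ) ^ (1 + κ / 4) with hZ
  have hsum : Summable fun n : ℕ => 1 / (n : ℝ) ^ (1 + κ / 4) :=
    Real.summable_one_div_nat_rpow.2 (by linarith)
  have hZ0 : 0 ≤ Z := tsum_nonneg fun n => by positivity
  have hZle : ∀ S : Finset ℕ, ∑ n ∈ S, 1 / (n : ℝ) ^ (1 + κ / 4) ≤ Z := fun S =>
    hsum.sum_le_tsum S fun n _ => by positivity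
  refine ⟨3 * C₀ ^ 2 * Z + 4 * (C₀ * Z) ^ 2 + 8 * (1 + 4 / κ) * (C₀ ^ 2 * Z) + 1, by positivity, ?_⟩
  intro T hT y N hy hyN hyT hyT' hNT σ hσ
  have hT0 : 0 < T := by linarith
  set L := N * y with hL
  have hL1 : 1 ≤ L := Nat.mul_pos (by omega) hy
  have hL1' : (1 : ℝ) ≤ L := by exact_mod_cast hL1
  set S := Finset.Icc (y + 1) L with hS
  have hSL : S ⊆ Finset.Icc 1 L := by intro n hn; simp [hS] at hn ⊢; omega
  set c : ℕ → ℂ := fun n => mollifiedCoeff N y n * (n : ℂ) ^ (-σ : ℂ) with hc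
  have hpoly : ∀ t : ℝ, (∑ m ∈ Finset.Icc 1 N, (m : ℂ) ^ (-(σ + t * Complex.I : ℂ))) *
          mollifier y (σ + t * Complex.I) - 1 = ∑ n ∈ S, c n * natPow n t := by
    intro t
    rw [sum_mul_mollifier_sub_one hy hyN]
    refine Finset.sum_congr rfl fun n hn => ?_
    have hn0 : n ≠ 0 := by simp [hS] at hn; omega
    rw [natCast_cpow_add_mul_I hn0, hc, mul_assoc]
  simp_rw [hpoly]
  have hcn : ∀ n ∈ S, ‖c n‖ ≤ C₀ * (n : ℝ) ^ (-(1 / 2) - 3 * κ / 4) := by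
    intro n hn
    have hn0 : n ≠ 0 := by simp [hS] at hn; omega
    have hn1 : (1 : ℝ) ≤ n := by exact_mod_cast Nat.pos_of_ne_zero hn0
    rw [hc, norm_mul, Complex.norm_natCast_cpow_of_pos (Nat.pos_of_ne_zero hn0)]
    calc _ ≤ (C₀ * (n : ℝ) ^ (κ / 4)) * (n : ℝ) ^ (-(1 / 2) - κ) := by
          gcongr
          · exact (norm_mollifiedCoeff_le N y n).trans (hdiv n hn0)
          · simp; linarith
      _ = _ := by rw [mul_assoc, ← Real.rpow_add (by linarith)]; congr 2; ring
  -- The polynomial is longer than T, but the distance κ from the critical line compensates: (1 +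
  -- κ/2)(1 - κ) < 1 - κ²/4.
  have hLT : (L : ℝ) ^ (1 - κ) ≤ 2 * T ^ (1 - κ ^ 2 / 4) := by
    have h1 : (L : ℝ) ≤ 2 * T ^ (1 + κ / 2) := by
      rw [hL, Nat.cast_mul, Real.rpow_add hT0, Real.rpow_one, ← mul_assoc]
      gcongr
    calc (L : ℝ) ^ (1 - κ) ≤ (2 * T ^ (1 + κ / 2)) ^ (1 - κ) :=
          Real.rpow_le_rpow (by positivity) h1 (by linarith)
      _ = 2 ^ (1 - κ) * T ^ ((1 + κ / 2) * (1 - κ)) := by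
          rw [Real.mul_rpow (by norm_num) (by positivity), ← Real.rpow_mul hT0.le]
      _ ≤ 2 ^ (1 : ℝ) * T ^ (1 - κ ^ 2 / 4) := by
          gcongr
          · norm_num
          · linarith
          · nlinarith
      _ = _ := by rw [Real.rpow_one]
  -- All three sums in the mean value theorem are compared with the convergent series of n^(-1-κ/4),
  -- the excess being bounded by a power of L.
  have hpow : ∀ n ∈ S, ∀ e : ℝ, 0 ≤ e → ∀ f : ℝ, f = -(1 + κ / 4) + e →
      (n : ℝ) ^ f ≤ (L : ℝ) ^ e * (1 / (n : ℝ) ^ (1 + κ / 4)) := by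
    intro n hn e he f hf
    have hn1 : (1 : ℝ) ≤ n := by
      have : 1 ≤ n := by simp [hS] at hn; omega
      exact_mod_cast this
    have hnL : (n : ℝ) ≤ L := by
      have : n ≤ L := by simp [hS] at hn; omega
      exact_mod_cast this
    rw [hf, Real.rpow_add (by linarith), Real.rpow_neg (by linarith), mul_comm, one_div]
    gcongr
  have hM := integral_norm_dirichletPoly_sq_le hSL c (a := T / 2) (b := 3 * T) (by linarith)
  -- The diagonal saving: n ≥ y + 1 ≥ T^(κ/2), hence n^(-κ/2) ≤ T^(-κ²/4).
  have b1 : ∑ n ∈ S, ‖c n‖ ^ 2 ≤ C₀ ^ 2 * Z * T ^ (-(κ ^ 2 / 4)) := by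
    calc _ ≤ ∑ n ∈ S, C₀ ^ 2 * T ^ (-(κ ^ 2 / 4)) * (1 / (n : ℝ) ^ (1 + κ / 4)) := by
          refine Finset.sum_le_sum fun n hn => ?_
          have hn1 : (1 : ℝ) ≤ n := by
            have : 1 ≤ n := by simp [hS] at hn; omega
            exact_mod_cast this
          have hny : (y : ℝ) + 1 ≤ n := by
            have : y + 1 ≤ n := by simp [hS] at hn; omega
            exact_mod_cast this
          calc ‖c n‖ ^ 2 ≤ (C₀ * (n : ℝ) ^ (-(1 / 2) - 3 * κ / 4)) ^ 2 := by
                gcongr; exact hcn n hn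
            _ = C₀ ^ 2 * ((n : ℝ) ^ (-(5 * κ / 4)) * (1 / (n : ℝ) ^ (1 + κ / 4))) := by
                rw [mul_pow, rpow_sq (by linarith), one_div ((n : ℝ) ^ (1 + κ / 4)),
                  ← Real.rpow_neg (by linarith), ← Real.rpow_add (by linarith)]
                congr 2; ring
            _ ≤ C₀ ^ 2 * (T ^ (-(κ ^ 2 / 4)) * (1 / (n : ℝ) ^ (1 + κ / 4))) := by
                gcongr
                calc (n : ℝ) ^ (-(5 * κ / 4)) ≤ (n : ℝ) ^ (-(κ / 2)) := by
                      exact Real.rpow_le_rpow_of_exponent_le hn1 (by linarith)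
                  _ ≤ (T ^ (κ / 2)) ^ (-(κ / 2)) :=
                      Real.rpow_le_rpow_of_nonpos (by positivity) (hyT.trans hny) (by linarith)
                  _ = _ := by rw [← Real.rpow_mul hT0.le]; congr 1; ring
            _ = _ := by ring
      _ ≤ _ := by
          rw [← Finset.mul_sum]
          calc _ ≤ C₀ ^ 2 * T ^ (-(κ ^ 2 / 4)) * Z := by gcongr; exact hZle S
            _ = _ := by ring
  have b2 : ∑ n ∈ S, ‖c n‖ ≤ C₀ * Z * (L : ℝ) ^ ((1 - κ) / 2) := by
    calc _ ≤ ∑ n ∈ S, C₀ * ((L : ℝ) ^ ((1 - κ) / 2) * (1 / (n : ℝ) ^ (1 + κ / 4))) := by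
          refine Finset.sum_le_sum fun n hn => (hcn n hn).trans ?_
          gcongr
          exact hpow n hn _ (by linarith) _ (by ring)
      _ ≤ _ := by
          rw [← Finset.mul_sum, ← Finset.mul_sum]
          calc _ ≤ C₀ * ((L : ℝ) ^ ((1 - κ) / 2) * Z) := by gcongr; exact hZle S
            _ = _ := by ring
  have b3 : ∑ n ∈ S, (n : ℝ) * ‖c n‖ ^ 2 ≤ C₀ ^ 2 * Z * (L : ℝ) ^ (1 - 5 * κ / 4) := by
    calc _ ≤ ∑ n ∈ S, C₀ ^ 2 * ((L : ℝ) ^ (1 - 5 * κ / 4) * (1 / (n : ℝ) ^ (1 + κ / 4))) := by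
          refine Finset.sum_le_sum fun n hn => ?_
          have hn1 : (1 : ℝ) ≤ n := by
            have : 1 ≤ n := by simp [hS] at hn; omega
            exact_mod_cast this
          calc (n : ℝ) * ‖c n‖ ^ 2 ≤ n * (C₀ * (n : ℝ) ^ (-(1 / 2) - 3 * κ / 4)) ^ 2 := by
                gcongr; exact hcn n hn
            _ = C₀ ^ 2 * ((n : ℝ) ^ (1 : ℝ) * (n : ℝ) ^ (2 * (-(1 / 2) - 3 * κ / 4))) := by
                rw [mul_pow, rpow_sq (by linarith), Real.rpow_one]
                ring
            _ = C₀ ^ 2 * (n : ℝ) ^ (-(3 * κ / 2)) := by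
                rw [← Real.rpow_add (by linarith)]; congr 2; ring
            _ ≤ _ := by gcongr; exact hpow n hn _ (by linarith) _ (by ring)
      _ ≤ _ := by
          rw [← Finset.mul_sum, ← Finset.mul_sum]
          calc _ ≤ C₀ ^ 2 * ((L : ℝ) ^ (1 - 5 * κ / 4) * Z) := by gcongr; exact hZle S
            _ = _ := by ring
  have hlog : 1 + Real.log L ≤ (1 + 4 / κ) * (L : ℝ) ^ (κ / 4) := by
    have h1 := Real.log_le_rpow_div (x := (L : ℝ)) (by positivity) (ε := κ / 4) (by positivity)
    have h2 : 1 ≤ (L : ℝ) ^ (κ / 4) := Real.one_le_rpow hL1' (by positivity)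
    have h3 : (L : ℝ) ^ (κ / 4) / (κ / 4) = 4 / κ * (L : ℝ) ^ (κ / 4) := by field_simp
    linarith
  have hlog0 : 0 ≤ 1 + Real.log L := by have := Real.log_nonneg hL1'; linarith
  have e1 : T * T ^ (-(κ ^ 2 / 4)) = T ^ (1 - κ ^ 2 / 4) := by
    rw [sub_eq_add_neg, Real.rpow_add hT0, Real.rpow_one]
  have e2 : ((L : ℝ) ^ ((1 - κ) / 2)) ^ 2 = (L : ℝ) ^ (1 - κ) := by
    rw [rpow_sq (by linarith)]; congr 1; ring
  have e3 : (L : ℝ) ^ (κ / 4) * (L : ℝ) ^ (1 - 5 * κ / 4) = (L : ℝ) ^ (1 - κ) := by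
    rw [← Real.rpow_add (by linarith)]; congr 1; ring
  have hTp : 0 < T ^ (1 - κ ^ 2 / 4) := by positivity
  refine hM.trans ?_
  calc (3 * T - T / 2) * ∑ n ∈ S, ‖c n‖ ^ 2 + 2 * (∑ n ∈ S, ‖c n‖) ^ 2
        + 4 * (1 + Real.log L) * ∑ n ∈ S, (n : ℝ) * ‖c n‖ ^ 2
      ≤ 3 * T * (C₀ ^ 2 * Z * T ^ (-(κ ^ 2 / 4))) + 2 * (C₀ * Z * (L : ℝ) ^ ((1 - κ) / 2)) ^ 2
        + 4 * ((1 + 4 / κ) * (L : ℝ) ^ (κ / 4)) * (C₀ ^ 2 * Z * (L : ℝ) ^ (1 - 5 * κ / 4)) := by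
        gcongr
        linarith
    _ = 3 * C₀ ^ 2 * Z * (T * T ^ (-(κ ^ 2 / 4))) + 2 * (C₀ * Z) ^ 2 * ((L : ℝ) ^ ((1 - κ) / 2)) ^ 2
        + 4 * (1 + 4 / κ) * (C₀ ^ 2 * Z) * ((L : ℝ) ^ (κ / 4) * (L : ℝ) ^ (1 - 5 * κ / 4)) := by ring
    _ ≤ 3 * C₀ ^ 2 * Z * T ^ (1 - κ ^ 2 / 4) + 2 * (C₀ * Z) ^ 2 * (2 * T ^ (1 - κ ^ 2 / 4))
        + 4 * (1 + 4 / κ) * (C₀ ^ 2 * Z) * (2 * T ^ (1 - κ ^ 2 / 4)) := by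
        rw [e1, e2, e3]; gcongr
    _ ≤ _ := by nlinarith


theorem continuous_vertical (σ : ℝ) : Continuous fun t : ℝ => (σ + t * Complex.I : ℂ) := by
  fun_prop

/-- The mean square of `ζ M - 1`, with `M` a mollifier of length `T ^ (κ / 2)`, on vertical lines to
the right of `Re s = 1 / 2 + κ`. -/
theorem exists_integral_norm_mollified_sub_one_sq_le {κ : ℝ} (hκ : 0 < κ) (hκ1 : κ ≤ 1 / 4) :
    ∃ C : ℝ, 0 < C ∧ ∀ T : ℝ, 1 ≤ T → ∀ σ : ℝ, 1 / 2 + κ ≤ σ → σ ≤ 2 →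
      ∫ t in (T / 2)..(3 * T), ‖riemannZeta (σ + t * Complex.I) *
          mollifier ⌊T ^ (κ / 2)⌋₊ (σ + t * Complex.I) - 1‖ ^ 2 ≤ C * T ^ (1 - κ ^ 2 / 4) := by
  obtain ⟨C₁, hC₁, hpart⟩ := exists_integral_norm_mollified_partial_sq_le hκ hκ1
  refine ⟨2 * C₁ + 192 + 100 * (2 * Real.pi * Real.exp 1), by positivity, ?_⟩
  intro T hT σ hσ hσ2
  have hT0 : 0 < T := by linarith
  have hTκ : 1 ≤ T ^ (κ / 2) := Real.one_le_rpow hT (by linarith)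
  set y := ⌊T ^ (κ / 2)⌋₊ with hy
  -- A partial sum of length about T makes N^(1-s)/(s-1) pointwise of size T^(-1/2-κ), while the
  -- remaining tail is small in mean square.
  set N := ⌈T⌉₊ with hN
  have hy1 : 1 ≤ y := Nat.le_floor (by simpa using hTκ)
  have hyT : (y : ℝ) ≤ T ^ (κ / 2) := Nat.floor_le (by linarith)
  have hyT' : T ^ (κ / 2) ≤ y + 1 := (Nat.lt_floor_add_one _).le
  have hTN : T ≤ N := Nat.le_ceil T
  have hN2 : (N : ℝ) ≤ 2 * T := by
    have := Nat.ceil_lt_add_one hT0.le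
    linarith
  have hyN : y ≤ N := by
    have : T ^ (κ / 2) ≤ T := by
      calc _ ≤ T ^ (1 : ℝ) := Real.rpow_le_rpow_of_exponent_le hT (by linarith)
        _ = T := Real.rpow_one T
    exact_mod_cast hyT.trans (this.trans hTN)
  have hN1 : 1 ≤ N := hy1.trans hyN
  have hN0 : (0 : ℝ) < N := by linarith
  have hy2 : (y : ℝ) ^ 2 ≤ T ^ κ := by
    calc (y : ℝ) ^ 2 ≤ (T ^ (κ / 2)) ^ 2 := by gcongr
      _ = T ^ κ := by rw [rpow_sq hT0.le]; congr 1; ring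
  have hP := hpart T hT y N hy1 hyN hyT' hyT hN2 σ hσ
  set P : ℝ → ℂ := fun t => (∑ m ∈ Finset.Icc 1 N, (m : ℂ) ^ (-(σ + t * Complex.I : ℂ))) *
    mollifier y (σ + t * Complex.I) with hPdef
  have hpt : ∀ t ∈ Set.Icc (T / 2) (3 * T), ‖riemannZeta (σ + t * Complex.I) *
      mollifier y (σ + t * Complex.I) - 1‖ ^ 2 ≤ 2 * ‖P t - 1‖ ^ 2 + (64 * T ^ κ * T ^ (-1 - 2 * κ)
        + 100 * T ^ κ * T ^ 2 * ‖zetaTail N (σ + t * Complex.I)‖ ^ 2) := by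
    rintro t ⟨ht1, ht2⟩
    set s : ℂ := σ + t * Complex.I with hs
    have hre : s.re = σ := by simp [hs]
    have him : s.im = t := by simp [hs]
    have ht0 : 0 < t := by linarith
    have hs1 : s ≠ 1 := by intro h; rw [h] at him; simp at him; linarith
    have hz := riemannZeta_eq_sum_add hN1 (s := s) (by rw [hre]; linarith) hs1
    set E : ℂ := (N : ℂ) ^ (1 - s) / (s - 1) - s * zetaTail N s with hE
    have hf : riemannZeta s * mollifier y s - 1 = (P t - 1) + E * mollifier y s := by
      rw [hz, hPdef, hE]; ring
    have hM : ‖mollifier y s‖ ≤ y := norm_mollifier_le (by rw [hre]; linarith)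
    have h1 : T / 2 ≤ ‖s - 1‖ := by
      have := Complex.abs_im_le_norm (s - 1)
      simp only [Complex.sub_im, him, Complex.one_im, sub_zero] at this
      rw [abs_of_pos ht0] at this; linarith
    have h2 : ‖s‖ ≤ 5 * T := by
      calc ‖s‖ ≤ ‖(σ : ℂ)‖ + ‖(t : ℂ) * Complex.I‖ := norm_add_le _ _
        _ = |σ| + |t| := by simp
        _ ≤ 5 * T := by rw [abs_of_pos (by linarith), abs_of_pos ht0]; linarith
    have h3 : ‖(N : ℂ) ^ (1 - s) / (s - 1)‖ ≤ 4 * T ^ (-(1 / 2) - κ) := by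
      rw [norm_div, Complex.norm_natCast_cpow_of_pos hN1]
      have e1 : (N : ℝ) ^ (1 - s).re ≤ 2 * T ^ (1 / 2 - κ) := by
        simp only [Complex.sub_re, Complex.one_re, hre]
        calc (N : ℝ) ^ (1 - σ) ≤ (N : ℝ) ^ (1 / 2 - κ) :=
              Real.rpow_le_rpow_of_exponent_le (by exact_mod_cast hN1) (by linarith)
          _ ≤ (2 * T) ^ (1 / 2 - κ) := Real.rpow_le_rpow hN0.le hN2 (by linarith)
          _ = 2 ^ (1 / 2 - κ) * T ^ (1 / 2 - κ) := Real.mul_rpow (by norm_num) hT0.le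
          _ ≤ 2 ^ (1 : ℝ) * T ^ (1 / 2 - κ) := by
              gcongr
              · norm_num
              · linarith
          _ = _ := by rw [Real.rpow_one]
      calc _ ≤ 2 * T ^ (1 / 2 - κ) / (T / 2) := by gcongr
        _ = 4 * (T ^ (1 / 2 - κ) * T ^ (-1 : ℝ)) := by
            rw [Real.rpow_neg_one]; field_simp; norm_num
        _ = _ := by rw [← Real.rpow_add hT0]; congr 2; ring
    have hEsq : ‖E‖ ^ 2 ≤ 32 * T ^ (-1 - 2 * κ) + 50 * T ^ 2 * ‖zetaTail N s‖ ^ 2 := by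
      have e2 : ‖E‖ ≤ 4 * T ^ (-(1 / 2) - κ) + 5 * T * ‖zetaTail N s‖ := by
        refine (norm_sub_le _ _).trans (add_le_add h3 ?_)
        rw [norm_mul]; gcongr
      have e3 : (T ^ (-(1 / 2) - κ)) ^ 2 = T ^ (-1 - 2 * κ) := by
        rw [rpow_sq hT0.le]; congr 1; ring
      calc ‖E‖ ^ 2 ≤ (4 * T ^ (-(1 / 2) - κ) + 5 * T * ‖zetaTail N s‖) ^ 2 := by gcongr
        _ ≤ 2 * ((4 * T ^ (-(1 / 2) - κ)) ^ 2 + (5 * T * ‖zetaTail N s‖) ^ 2) := add_sq_le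
        _ = 32 * (T ^ (-(1 / 2) - κ)) ^ 2 + 50 * T ^ 2 * ‖zetaTail N s‖ ^ 2 := by ring
        _ = _ := by rw [e3]
    rw [hf]
    calc ‖P t - 1 + E * mollifier y s‖ ^ 2 ≤ (‖P t - 1‖ + ‖E * mollifier y s‖) ^ 2 := by
          gcongr; exact norm_add_le _ _
      _ ≤ 2 * (‖P t - 1‖ ^ 2 + ‖E * mollifier y s‖ ^ 2) := add_sq_le
      _ = 2 * ‖P t - 1‖ ^ 2 + 2 * (‖E‖ ^ 2 * ‖mollifier y s‖ ^ 2) := by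
          rw [norm_mul]; ring
      _ ≤ 2 * ‖P t - 1‖ ^ 2 + 2 * ((32 * T ^ (-1 - 2 * κ) + 50 * T ^ 2 * ‖zetaTail N s‖ ^ 2)
            * T ^ κ) := by
          have : ‖mollifier y s‖ ^ 2 ≤ T ^ κ := le_trans (by gcongr) hy2
          gcongr
      _ = _ := by ring
  have hTle : T / 2 ≤ 3 * T := by linarith
  have hvert := continuous_vertical σ
  have hMc : Continuous fun t : ℝ => mollifier y (σ + t * Complex.I) :=
    (differentiable_mollifier y).continuous.comp hvert
  have hne : ∀ t ∈ Set.Icc (T / 2) (3 * T), (σ + t * Complex.I : ℂ) ≠ 1 := by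
    intro t ht h
    have := congrArg Complex.im h
    simp at this
    linarith [ht.1]
  have hzc : ContinuousOn (fun t : ℝ => riemannZeta (σ + t * Complex.I)) (Set.Icc (T / 2) (3 * T)) :=
    fun t ht => ((differentiableAt_riemannZeta (hne t ht)).continuousAt.comp (f := fun t : ℝ =>
      (σ + t * Complex.I : ℂ)) hvert.continuousAt).continuousWithinAt
  have hi0 : IntervalIntegrable (fun t : ℝ => ‖riemannZeta (σ + t * Complex.I) *
      mollifier y (σ + t * Complex.I) - 1‖ ^ 2) volume (T / 2) (3 * T) := by
    refine ContinuousOn.intervalIntegrable ?_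
    rw [Set.uIcc_of_le hTle]
    exact ((hzc.mul hMc.continuousOn).sub continuousOn_const).norm.pow 2
  have hPc : Continuous P := by
    refine Continuous.mul (continuous_finsetSum _ fun m hm => ?_) hMc
    have hm0 : (m : ℂ) ≠ 0 := by
      have := (Finset.mem_Icc.1 hm).1
      exact_mod_cast (by omega : m ≠ 0)
    exact Continuous.const_cpow (by fun_prop) (Or.inl hm0)
  have hi1 : IntervalIntegrable (fun t : ℝ => 2 * ‖P t - 1‖ ^ 2) volume (T / 2) (3 * T) :=
    (((hPc.sub continuous_const).norm.pow 2).const_mul 2).intervalIntegrable _ _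
  have htc : Continuous fun t : ℝ => ‖zetaTail N (σ + t * Complex.I)‖ ^ 2 := by
    refine (Continuous.norm ?_).pow 2
    refine continuous_iff_continuousAt.2 fun t => ?_
    exact (differentiableAt_zetaTail hN1 (s := (σ + t * Complex.I : ℂ))
      (by simp; linarith)).continuousAt.comp (f := fun t : ℝ => (σ + t * Complex.I : ℂ))
      hvert.continuousAt
  have hi2 : IntervalIntegrable (fun t : ℝ => 100 * T ^ κ * T ^ 2 *
      ‖zetaTail N (σ + t * Complex.I)‖ ^ 2) volume (T / 2) (3 * T) :=
    (htc.const_mul _).intervalIntegrable _ _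
  -- The tail is multiplied by |s|² ≤ 25T² and by the squared mollifier, at most T^κ. Only the mean
  -- square bound, of size T^(-1-2κ) for the whole segment, makes the total T^(1-κ).
  have htail : ∫ t in (T / 2)..(3 * T), ‖zetaTail N (σ + t * Complex.I)‖ ^ 2
      ≤ 2 * Real.pi * Real.exp 1 * T ^ (-1 - 2 * κ) := by
    calc _ ≤ ∫ t in (-(3 * T))..(3 * T), ‖zetaTail N (σ + t * Complex.I)‖ ^ 2 := by
          refine intervalIntegral.integral_mono_interval (by linarith) hTle le_rfl
            (ae_of_all _ fun t => by positivity) (htc.intervalIntegrable _ _)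
      _ ≤ _ := integral_norm_zetaTail_sq_le hN1 (by linarith) (by linarith)
      _ ≤ _ := by
          gcongr
          have e1 : (N : ℝ) ^ (-(2 * σ)) ≤ T ^ (-1 - 2 * κ) := by
            calc (N : ℝ) ^ (-(2 * σ)) ≤ T ^ (-(2 * σ)) :=
                  Real.rpow_le_rpow_of_nonpos hT0 hTN (by linarith)
              _ ≤ _ := Real.rpow_le_rpow_of_exponent_le hT (by linarith)
          exact (div_le_self (by positivity) (by linarith)).trans e1
  have hmono := intervalIntegral.integral_mono_on hTle hi0
    (hi1.add ((intervalIntegrable_const).add hi2)) hpt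
  refine hmono.trans ?_
  rw [intervalIntegral.integral_add hi1 (intervalIntegrable_const.add hi2),
    intervalIntegral.integral_add intervalIntegrable_const hi2, intervalIntegral.integral_const,
    intervalIntegral.integral_const_mul, intervalIntegral.integral_const_mul, smul_eq_mul]
  have e1 : T ^ κ * T ^ (-1 - 2 * κ) * T ≤ T ^ (1 - κ ^ 2 / 4) := by
    calc T ^ κ * T ^ (-1 - 2 * κ) * T = T ^ (κ + (-1 - 2 * κ) + 1) := by
          rw [Real.rpow_add hT0, Real.rpow_add hT0, Real.rpow_one]
      _ ≤ _ := Real.rpow_le_rpow_of_exponent_le hT (by nlinarith)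
  have e2 : T ^ κ * T ^ 2 * T ^ (-1 - 2 * κ) ≤ T ^ (1 - κ ^ 2 / 4) := by
    calc T ^ κ * T ^ 2 * T ^ (-1 - 2 * κ) = T ^ (κ + 2 + (-1 - 2 * κ)) := by
          rw [Real.rpow_add hT0, Real.rpow_add hT0]; norm_cast
      _ ≤ _ := Real.rpow_le_rpow_of_exponent_le hT (by nlinarith)
  have h0 : 0 ≤ T ^ κ * T ^ (-1 - 2 * κ) := by positivity
  calc _ ≤ 2 * (C₁ * T ^ (1 - κ ^ 2 / 4)) + (3 * T * (64 * T ^ κ * T ^ (-1 - 2 * κ))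
        + 100 * T ^ κ * T ^ 2 * (2 * Real.pi * Real.exp 1 * T ^ (-1 - 2 * κ))) := by
        gcongr
        linarith
    _ = 2 * C₁ * T ^ (1 - κ ^ 2 / 4) + 192 * (T ^ κ * T ^ (-1 - 2 * κ) * T)
        + 100 * (2 * Real.pi * Real.exp 1) * (T ^ κ * T ^ 2 * T ^ (-1 - 2 * κ)) := by ring
    _ ≤ 2 * C₁ * T ^ (1 - κ ^ 2 / 4) + 192 * T ^ (1 - κ ^ 2 / 4)
        + 100 * (2 * Real.pi * Real.exp 1) * T ^ (1 - κ ^ 2 / 4) := by gcongr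
    _ = _ := by ring


/-! ### A zero density estimate from subharmonicity -/

theorem measurable_riemannZeta : Measurable riemannZeta :=
  measurable_of_continuousOn_compl_singleton 1 fun _ hs =>
    (differentiableAt_riemannZeta hs).continuousAt.continuousWithinAt

/-- The sub-mean value property on circles for the square of a holomorphic function. -/
theorem two_pi_mul_norm_sq_le_integral {f : ℂ → ℂ} {c : ℂ} {u : ℝ} (hu : 0 < u)
    (hf : ∀ z ∈ Metric.closedBall c u, DifferentiableAt ℂ f z) :
    2 * Real.pi * ‖f c‖ ^ 2 ≤ ∫ θ in (-Real.pi)..Real.pi, ‖f (circleMap c u θ)‖ ^ 2 := by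
  have h1 : Real.circleAverage (fun z => f z ^ 2) c u = f c ^ 2 := by
    refine circleAverage_of_differentiable_on_off_countable (s := ∅) Set.countable_empty ?_ ?_
    · rw [abs_of_pos hu]
      exact fun z hz => ((hf z hz).pow 2).continuousAt.continuousWithinAt
    · rw [abs_of_pos hu]
      exact fun z hz => (hf z (Metric.ball_subset_closedBall hz.1)).pow 2
  rw [Real.circleAverage] at h1
  have hper : Function.Periodic (fun θ => ‖f (circleMap c u θ)‖ ^ 2) (2 * Real.pi) := fun θ => by
    simp only [periodic_circleMap c u θ]
  have h2 : ∫ θ in (-Real.pi)..Real.pi, ‖f (circleMap c u θ)‖ ^ 2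
      = ∫ θ in (0 : ℝ)..(2 * Real.pi), ‖f (circleMap c u θ)‖ ^ 2 := by
    have := hper.intervalIntegral_add_eq (-Real.pi) 0
    rw [show -Real.pi + 2 * Real.pi = Real.pi by ring, zero_add] at this
    exact this
  rw [h2]
  have h3 := congrArg norm h1
  rw [norm_smul, norm_pow, Real.norm_of_nonneg (by positivity)] at h3
  have h4 : ‖∫ θ in (0 : ℝ)..(2 * Real.pi), f (circleMap c u θ) ^ 2‖
      ≤ ∫ θ in (0 : ℝ)..(2 * Real.pi), ‖f (circleMap c u θ)‖ ^ 2 := by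
    refine (intervalIntegral.norm_integral_le_integral_norm (by positivity)).trans (le_of_eq ?_)
    simp_rw [norm_pow]
  rw [← h3, ← mul_assoc, mul_inv_cancel₀ (by positivity), one_mul]
  exact h4

/-- The sub-mean value property on discs for the square of a holomorphic function. -/
theorem ofReal_mul_enorm_sq_le_lintegral_ball {f : ℂ → ℂ} (hfm : Measurable f) {c : ℂ} {r : ℝ}
    (hr : 0 < r) (hf : ∀ z ∈ Metric.closedBall c r, DifferentiableAt ℂ f z) :
    ENNReal.ofReal (Real.pi * r ^ 2) * ENNReal.ofReal (‖f c‖ ^ 2)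
      ≤ ∫⁻ z in Metric.ball c r, ENNReal.ofReal (‖f z‖ ^ 2) := by
  set g : ℂ → ENNReal := (Metric.ball (0 : ℂ) r).indicator
    fun z => ENNReal.ofReal (‖f (c + z)‖ ^ 2) with hg
  have hgm : Measurable g := by
    refine Measurable.indicator ?_ Metric.isOpen_ball.measurableSet
    exact ((hfm.comp (measurable_const_add c)).norm.pow_const 2).ennreal_ofReal
  have e1 : ∫⁻ z in Metric.ball c r, ENNReal.ofReal (‖f z‖ ^ 2) = ∫⁻ z, g z := by
    rw [← lintegral_indicator Metric.isOpen_ball.measurableSet,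
      ← lintegral_add_left_eq_self _ c]
    congr 1; ext z
    simp [hg, Set.indicator]
  rw [e1, ← Complex.lintegral_comp_polarCoord_symm, polarCoord_target, Measure.volume_eq_prod,
    ← Measure.prod_restrict, lintegral_prod]
  swap
  · refine Measurable.aemeasurable ?_
    refine Measurable.smul (f := fun p : ℝ × ℝ => ENNReal.ofReal p.1) (by fun_prop)
      (hgm.comp ?_)
    have : (Complex.polarCoord.symm : ℝ × ℝ → ℂ)
        = fun p => (p.1 : ℂ) * (Real.cos p.2 + Real.sin p.2 * Complex.I) := by
      ext p; simp [Complex.polarCoord_symm_apply]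
    rw [this]
    fun_prop
  have hinner : ∀ u ∈ Set.Ioo 0 r, ENNReal.ofReal u * (ENNReal.ofReal (2 * Real.pi)
      * ENNReal.ofReal (‖f c‖ ^ 2)) ≤ ∫⁻ θ in Set.Ioo (-Real.pi) Real.pi,
        ENNReal.ofReal u • g (Complex.polarCoord.symm (u, θ)) := by
    rintro u ⟨hu0, hur⟩
    have hcirc : ∀ θ : ℝ, g (Complex.polarCoord.symm (u, θ))
        = ENNReal.ofReal (‖f (circleMap c u θ)‖ ^ 2) := by
      intro θ
      have hz : Complex.polarCoord.symm (u, θ) = u * Complex.exp (θ * Complex.I) := by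
        rw [Complex.polarCoord_symm_apply, Complex.exp_mul_I]; simp
      have hmem : Complex.polarCoord.symm (u, θ) ∈ Metric.ball (0 : ℂ) r := by
        rw [hz, mem_ball_zero_iff, norm_mul, Complex.norm_exp_ofReal_mul_I, mul_one,
          Complex.norm_of_nonneg hu0.le]
        exact hur
      rw [hg, Set.indicator_of_mem hmem, hz, circleMap]
    simp_rw [hcirc, smul_eq_mul]
    rw [lintegral_const_mul _ (by
      exact (((hfm.comp (continuous_circleMap c u).measurable).norm.pow_const 2).ennreal_ofReal))]
    gcongr
    have hd : ∀ z ∈ Metric.closedBall c u, DifferentiableAt ℂ f z := fun z hz =>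
      hf z (Metric.closedBall_subset_closedBall hur.le hz)
    have h1 := two_pi_mul_norm_sq_le_integral hu0 hd
    have hcont : Continuous fun θ => ‖f (circleMap c u θ)‖ ^ 2 := by
      refine (Continuous.norm ?_).pow 2
      refine continuous_iff_continuousAt.2 fun θ => ?_
      have hz : circleMap c u θ ∈ Metric.closedBall c u := by
        rw [Metric.mem_closedBall, dist_eq_norm]
        simp [abs_of_pos hu0]
      exact (hd _ hz).continuousAt.comp (continuous_circleMap c u).continuousAt
    rw [intervalIntegral.integral_of_le (by linarith [Real.pi_pos]),
      integral_Ioc_eq_integral_Ioo] at h1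
    rw [← ENNReal.ofReal_mul (by positivity)]
    refine (ENNReal.ofReal_le_ofReal h1).trans (le_of_eq ?_)
    rw [ofReal_integral_eq_lintegral_ofReal]
    · exact (hcont.continuousOn.integrableOn_compact (isCompact_Icc (a := -Real.pi)
        (b := Real.pi))).mono_set Set.Ioo_subset_Icc_self
    · exact ae_of_all _ fun θ => by positivity
  calc _ = ∫⁻ u in Set.Ioo 0 r, ENNReal.ofReal u * (ENNReal.ofReal (2 * Real.pi)
      * ENNReal.ofReal (‖f c‖ ^ 2)) := by
        rw [lintegral_mul_const _ (by fun_prop), ← mul_assoc]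
        congr 1
        have hI : ∫⁻ u in Set.Ioo 0 r, ENNReal.ofReal u = ENNReal.ofReal (r ^ 2 / 2) := by
          rw [← ofReal_integral_eq_lintegral_ofReal]
          · rw [← integral_Ioc_eq_integral_Ioo, ← intervalIntegral.integral_of_le hr.le,
              integral_id]
            simp
          · exact (continuous_id.continuousOn.integrableOn_compact (isCompact_Icc (a := (0 : ℝ))
              (b := r))).mono_set Set.Ioo_subset_Icc_self
          · filter_upwards [ae_restrict_mem measurableSet_Ioo] with u hu using hu.1.le
        rw [hI, ← ENNReal.ofReal_mul (by positivity)]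
        congr 1; ring
    _ ≤ ∫⁻ u in Set.Ioo 0 r, ∫⁻ θ in Set.Ioo (-Real.pi) Real.pi,
        ENNReal.ofReal u • g (Complex.polarCoord.symm (u, θ)) :=
        setLIntegral_mono' measurableSet_Ioo hinner
    _ ≤ _ := lintegral_mono_set Set.Ioo_subset_Ioi_self

/-- The number of unit intervals in `[T / 2 + 1, 3 T - 1]` that contain the ordinate of a zero of
`ζ` with real part at least `1 / 2 + 2 κ`. -/
theorem exists_card_zero_intervals_le {κ : ℝ} (hκ : 0 < κ) (hκ1 : κ ≤ 1 / 4) :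
    ∃ C : ℝ, 0 < C ∧ ∀ T : ℝ, 4 ≤ T → ∀ S : Finset ℤ,
      (∀ m ∈ S, T / 2 + 1 ≤ m ∧ m + 2 ≤ 3 * T ∧ ∃ ρ : ℂ, riemannZeta ρ = 0 ∧
        1 / 2 + 2 * κ ≤ ρ.re ∧ ρ.re ≤ 1 ∧ m ≤ ρ.im ∧ ρ.im ≤ m + 1) →
      (S.card : ℝ) ≤ C * T ^ (1 - κ ^ 2 / 4) := by
  obtain ⟨C, hC, hmean⟩ := exists_integral_norm_mollified_sub_one_sq_le hκ hκ1
  refine ⟨8 * C / (Real.pi * κ ^ 2), by positivity, ?_⟩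
  intro T hT S hS
  have hT0 : 0 < T := by linarith
  set y := ⌊T ^ (κ / 2)⌋₊ with hy
  set f : ℂ → ℂ := fun s => riemannZeta s * mollifier y s - 1 with hf
  have hfm : Measurable f :=
    (measurable_riemannZeta.mul (differentiable_mollifier y).continuous.measurable).sub_const 1
  set q : ℂ → ENNReal := fun z => ENNReal.ofReal (‖f z‖ ^ 2) with hq
  have hqm : Measurable q := (hfm.norm.pow_const 2).ennreal_ofReal
  -- The box for m is large enough to hold every disc of radius κ ≤ 1/4 about a zero with ordinate
  -- in [m, m + 1] and real part between 1/2 + 2κ and 1.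
  set Rm : ℤ → Set ℂ := fun m => Set.Icc (1 / 2 + κ) 2 ×ℂ Set.Icc (m - 1 : ℝ) (m + 2) with hRm
  set R : Set ℂ := Set.Icc (1 / 2 + κ) 2 ×ℂ Set.Icc (T / 2) (3 * T) with hR
  have hRmm : ∀ m, MeasurableSet (Rm m) := fun m =>
    (Complex.measurable_re measurableSet_Icc).inter (Complex.measurable_im measurableSet_Icc)
  have hRM : MeasurableSet R :=
    (Complex.measurable_re measurableSet_Icc).inter (Complex.measurable_im measurableSet_Icc)
  have hone : ∀ m ∈ S, ENNReal.ofReal (Real.pi * κ ^ 2) ≤ ∫⁻ z in Rm m, q z := by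
    intro m hm
    obtain ⟨h1, h2, ρ, h0, h3, h4, h5, h6⟩ := hS m hm
    have hd : ∀ z ∈ Metric.closedBall ρ κ, DifferentiableAt ℂ f z := by
      intro z hz
      have hz1 : z ≠ 1 := by
        rintro rfl
        rw [Metric.mem_closedBall, dist_eq_norm] at hz
        have := (Complex.abs_im_le_norm _).trans hz
        simp only [Complex.sub_im, Complex.one_im, zero_sub, abs_neg] at this
        have := (le_abs_self _).trans this
        linarith
      exact ((differentiableAt_riemannZeta hz1).mul (differentiable_mollifier y z)).sub_const 1
    -- At a zero of ζ the mollified function f equals -1, whatever the mollifier, so the disc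
    -- carries at least its own area.
    have h7 := ofReal_mul_enorm_sq_le_lintegral_ball hfm hκ hd
    have h8 : f ρ = -1 := by simp [hf, h0]
    rw [h8] at h7
    simp only [norm_neg, norm_one, one_pow, ENNReal.ofReal_one, mul_one] at h7
    refine h7.trans (lintegral_mono_set fun z hz => ?_)
    rw [Metric.mem_ball, dist_eq_norm] at hz
    have hre := (Complex.abs_re_le_norm _).trans hz.le
    have him := (Complex.abs_im_le_norm _).trans hz.le
    rw [Complex.sub_re, abs_le] at hre
    rw [Complex.sub_im, abs_le] at him
    refine ⟨⟨by linarith, by linarith⟩, by linarith, by linarith⟩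
  -- The boxes have height 3, so a point lies in at most four of them: those with m between Im z - 2
  -- and Im z + 1.
  have hcover : ∀ z, ∑ m ∈ S, (Rm m).indicator q z ≤ 4 * R.indicator q z := by
    intro z
    have hsub : ∀ m ∈ S, Rm m ⊆ R := by
      intro m hm z hz
      obtain ⟨h1, h2, -⟩ := hS m hm
      exact ⟨hz.1, by linarith [hz.2.1], by linarith [hz.2.2]⟩
    have hle : ∀ m ∈ S, (Rm m).indicator q z
        ≤ if m ∈ Finset.Icc ⌈z.im - 2⌉ (⌈z.im - 2⌉ + 3) then R.indicator q z else 0 := by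
      intro m hm
      by_cases h : z ∈ Rm m
      · have h1 : z.im - 2 ≤ m := by linarith [h.2.2]
        have h2 : (m : ℝ) ≤ ⌈z.im - 2⌉ + 3 := by
          have := Int.le_ceil (z.im - 2); linarith [h.2.1]
        rw [if_pos (Finset.mem_Icc.2 ⟨Int.ceil_le.2 h1, by exact_mod_cast h2⟩),
          Set.indicator_of_mem h, Set.indicator_of_mem (hsub m hm h)]
      · rw [Set.indicator_of_notMem h]; exact zero_le
    refine (Finset.sum_le_sum hle).trans ?_
    rw [← Finset.sum_filter, Finset.sum_const, nsmul_eq_mul]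
    gcongr
    have : (S.filter (fun m => m ∈ Finset.Icc ⌈z.im - 2⌉ (⌈z.im - 2⌉ + 3))).card ≤ 4 := by
      refine (Finset.card_le_card (t := Finset.Icc ⌈z.im - 2⌉ (⌈z.im - 2⌉ + 3))
        fun m hm => (Finset.mem_filter.1 hm).2).trans ?_
      rw [Int.card_Icc]; omega
    exact_mod_cast this
  have harea : ∫⁻ z in R, q z ≤ ENNReal.ofReal (2 * (C * T ^ (1 - κ ^ 2 / 4))) := by
    have hmp := Complex.volume_preserving_equiv_real_prod.symm
    have hpre : R = Complex.measurableEquivRealProd ⁻¹'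
        (Set.Icc (1 / 2 + κ) 2 ×ˢ Set.Icc (T / 2) (3 * T)) := by
      ext z; simp [hR, Complex.mem_reProdIm]; tauto
    have e1 : ∫⁻ z in R, q z = ∫⁻ p in Set.Icc (1 / 2 + κ) 2 ×ˢ Set.Icc (T / 2) (3 * T),
        q (p.1 + p.2 * Complex.I) := by
      rw [hpre, ← lintegral_indicator (by
          exact Complex.measurableEquivRealProd.measurable
            (measurableSet_Icc.prod measurableSet_Icc)),
        ← lintegral_indicator (measurableSet_Icc.prod measurableSet_Icc),
        ← Complex.volume_preserving_equiv_real_prod.symm.lintegral_comp_emb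
          (MeasurableEquiv.measurableEmbedding _)]
      congr 1; ext p
      have : Complex.measurableEquivRealProd.symm p = p.1 + p.2 * Complex.I := by
        rw [Complex.measurableEquivRealProd_symm_apply]
        apply Complex.ext <;> simp
      have h2 : Complex.measurableEquivRealProd (p.1 + p.2 * Complex.I) = p := by
        rw [← this, MeasurableEquiv.apply_symm_apply]
      simp only [Set.indicator, Set.mem_preimage, this, h2]
    rw [e1, Measure.volume_eq_prod, ← Measure.prod_restrict, lintegral_prod]
    swap
    · exact (hqm.comp (by fun_prop)).aemeasurable
    have hin : ∀ σ ∈ Set.Icc (1 / 2 + κ) 2, ∫⁻ t in Set.Icc (T / 2) (3 * T),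
        q (σ + t * Complex.I) ≤ ENNReal.ofReal (C * T ^ (1 - κ ^ 2 / 4)) := by
      intro σ hσ
      have hm := hmean T (by linarith) σ hσ.1 hσ.2
      rw [intervalIntegral.integral_of_le (by linarith), ← integral_Icc_eq_integral_Ioc] at hm
      refine le_trans (le_of_eq ?_) (ENNReal.ofReal_le_ofReal hm)
      rw [ofReal_integral_eq_lintegral_ofReal]
      · refine ContinuousOn.integrableOn_compact isCompact_Icc ?_
        refine (ContinuousOn.norm ?_).pow 2
        intro t ht
        have hz1 : (σ + t * Complex.I : ℂ) ≠ 1 := by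
          intro h
          have := congrArg Complex.im h
          simp at this
          linarith [ht.1]
        have hfd : DifferentiableAt ℂ f (σ + t * Complex.I) :=
          ((differentiableAt_riemannZeta hz1).mul (differentiable_mollifier y _)).sub_const 1
        exact (hfd.continuousAt.comp (f := fun t : ℝ => (σ + t * Complex.I : ℂ))
          (continuous_vertical σ).continuousAt).continuousWithinAt
      · exact ae_of_all _ fun t => by positivity
    calc _ ≤ ∫⁻ σ in Set.Icc (1 / 2 + κ) 2, ENNReal.ofReal (C * T ^ (1 - κ ^ 2 / 4)) :=
          setLIntegral_mono' measurableSet_Icc hin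
      _ = ENNReal.ofReal (C * T ^ (1 - κ ^ 2 / 4)) * ENNReal.ofReal (2 - (1 / 2 + κ)) := by
          rw [setLIntegral_const, Real.volume_Icc]
      _ ≤ _ := by
          rw [mul_comm, ENNReal.ofReal_mul zero_le_two]
          gcongr
          linarith
  have hfinal : (S.card : ENNReal) * ENNReal.ofReal (Real.pi * κ ^ 2)
      ≤ ENNReal.ofReal (8 * C * T ^ (1 - κ ^ 2 / 4)) := by
    calc (S.card : ENNReal) * ENNReal.ofReal (Real.pi * κ ^ 2)
        = ∑ m ∈ S, ENNReal.ofReal (Real.pi * κ ^ 2) := by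
          rw [Finset.sum_const, nsmul_eq_mul]
      _ ≤ ∑ m ∈ S, ∫⁻ z in Rm m, q z := Finset.sum_le_sum hone
      _ = ∫⁻ z, ∑ m ∈ S, (Rm m).indicator q z := by
          rw [lintegral_finsetSum _ fun m _ => hqm.indicator (hRmm m)]
          exact Finset.sum_congr rfl fun m _ => (lintegral_indicator (hRmm m) _).symm
      _ ≤ ∫⁻ z, 4 * R.indicator q z := lintegral_mono hcover
      _ = 4 * ∫⁻ z in R, q z := by
          rw [lintegral_const_mul _ (hqm.indicator hRM), lintegral_indicator hRM]
      _ ≤ 4 * ENNReal.ofReal (2 * (C * T ^ (1 - κ ^ 2 / 4))) := by gcongr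
      _ = _ := by
          rw [show (4 : ENNReal) = ENNReal.ofReal 4 by simp, ← ENNReal.ofReal_mul (by norm_num)]
          congr 1; ring
  have hreal : (S.card : ℝ) * (Real.pi * κ ^ 2) ≤ 8 * C * T ^ (1 - κ ^ 2 / 4) := by
    rw [← ENNReal.ofReal_natCast, ← ENNReal.ofReal_mul (by positivity)] at hfinal
    exact (ENNReal.ofReal_le_ofReal_iff (by positivity)).1 hfinal
  rw [div_mul_eq_mul_div, le_div_iff₀ (by positivity)]
  exact hreal


/-! ### The logarithm of ζ: Dirichlet series, primitives and a bound away from zeros -/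

/-- The coefficients `Λ(n) / log n` of the Dirichlet series of `log ζ`. -/
noncomputable def logCoeff (n : ℕ) : ℝ := ArithmeticFunction.vonMangoldt n / Real.log n

theorem logCoeff_nonneg (n : ℕ) : 0 ≤ logCoeff n :=
  div_nonneg ArithmeticFunction.vonMangoldt_nonneg (Real.log_natCast_nonneg n)

theorem logCoeff_le_one (n : ℕ) : logCoeff n ≤ 1 :=
  div_le_one_of_le₀ ArithmeticFunction.vonMangoldt_le_log (Real.log_natCast_nonneg n)

theorem logCoeff_zero : logCoeff 0 = 0 := by simp [logCoeff]

theorem logCoeff_one : logCoeff 1 = 0 := by simp [logCoeff]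

theorem log_mul_logCoeff (n : ℕ) :
    Real.log n * logCoeff n = ArithmeticFunction.vonMangoldt n := by
  rcases lt_or_ge 1 n with h | h
  · have : Real.log n ≠ 0 := (Real.log_pos (by exact_mod_cast h)).ne'
    rw [logCoeff, mul_div_cancel₀ _ this]
  · have : n = 0 ∨ n = 1 := by omega
    rcases this with rfl | rfl <;> simp

/-- The Dirichlet series `∑ Λ(n) / (log n * n ^ s)`. -/
noncomputable def logDirichlet (s : ℂ) : ℂ := LSeries (fun n => (logCoeff n : ℂ)) s

theorem norm_logCoeff_le (n : ℕ) : ‖(logCoeff n : ℂ)‖ ≤ 1 := by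
  rw [Complex.norm_of_nonneg (logCoeff_nonneg n)]; exact logCoeff_le_one n

theorem lseriesSummable_logCoeff {s : ℂ} (hs : 1 < s.re) :
    LSeriesSummable (fun n => (logCoeff n : ℂ)) s :=
  LSeriesSummable_of_bounded_of_one_lt_re (m := 1) (fun n _ => norm_logCoeff_le n) hs

/-- Termwise differentiation multiplies the coefficient by -log n, which turns Λ(n)/log n into the
coefficient -Λ(n) of ζ'/ζ. -/
theorem hasDerivAt_logDirichlet {s : ℂ} (hs : 1 < s.re) :
    HasDerivAt logDirichlet (logDeriv riemannZeta s) s := by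
  have habs : LSeries.abscissaOfAbsConv (fun n => (logCoeff n : ℂ)) < s.re := by
    refine lt_of_le_of_lt (LSeries.abscissaOfAbsConv_le_of_forall_lt_LSeriesSummable
      (x := 1) fun y hy => lseriesSummable_logCoeff (by simpa using hy)) ?_
    exact_mod_cast hs
  have h := LSeries_hasDerivAt habs
  have e : -LSeries (LSeries.logMul fun n => (logCoeff n : ℂ)) s = logDeriv riemannZeta s := by
    have h1 := ArithmeticFunction.LSeries_vonMangoldt_eq_deriv_riemannZeta_div hs
    have h2 : logDeriv riemannZeta s
        = -LSeries (fun n => (ArithmeticFunction.vonMangoldt n : ℂ)) s := by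
      rw [logDeriv_apply, h1, neg_div, neg_neg]
    rw [h2]
    congr 1
    refine LSeries_congr (fun {n} _ => ?_) s
    rw [LSeries.logMul, ← Complex.natCast_log, ← Complex.ofReal_mul, log_mul_logCoeff]
  rw [← e]; exact h

/-- With no constant term the series is led by 2^(-s); comparison with its absolute convergence at s
= 2 gives the decay. It is used to integrate ζ'/ζ up to +∞ and to see that the logarithm tends to 0
there. -/
theorem exists_norm_LSeries_le {f : ℕ → ℂ} (hf1 : f 1 = 0) (hf : LSeriesSummable f 2) :
    ∃ C : ℝ, 0 ≤ C ∧ ∀ s : ℂ, 2 ≤ s.re → ‖LSeries f s‖ ≤ C * Real.exp (-Real.log 2 * s.re) := by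
  have hsum : Summable fun n => ‖LSeries.term f 2 n‖ := hf.norm
  refine ⟨4 * ∑' n, ‖LSeries.term f 2 n‖, by positivity, fun s hs => ?_⟩
  have hterm : ∀ n, ‖LSeries.term f s n‖
      ≤ ‖LSeries.term f 2 n‖ * (4 * Real.exp (-Real.log 2 * s.re)) := by
    intro n
    rcases Nat.lt_or_ge n 2 with h | h
    · have : n = 0 ∨ n = 1 := by omega
      rcases this with rfl | rfl
      · simp
      · simp [LSeries.term, hf1]
    · have hn : (2 : ℝ) ≤ n := by exact_mod_cast h
      have hn0 : n ≠ 0 := by omega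
      rw [LSeries.norm_term_eq, LSeries.norm_term_eq, if_neg hn0, if_neg hn0]
      -- The constant 4 is 2², so that the claimed factor is 2^(2 - Re s), which dominates n^(2 - Re
      -- s) for n ≥ 2.
      have e1 : (4 : ℝ) * Real.exp (-Real.log 2 * s.re) = 2 ^ (2 - s.re) := by
        rw [Real.rpow_def_of_pos (by norm_num), show Real.log 2 * (2 - s.re)
          = Real.log 2 + Real.log 2 + -Real.log 2 * s.re by ring, Real.exp_add, Real.exp_add,
          Real.exp_log (by norm_num)]; norm_num
      have e2 : (2 : ℝ) ^ (2 - s.re) ≥ (n : ℝ) ^ (2 - s.re) :=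
        Real.rpow_le_rpow_of_nonpos (by norm_num) hn (by linarith)
      have hn0' : (0 : ℝ) < n := by linarith
      rw [e1]
      calc ‖f n‖ / (n : ℝ) ^ s.re = ‖f n‖ / (n : ℝ) ^ (2 : ℂ).re * (n : ℝ) ^ (2 - s.re) := by
            rw [Real.rpow_sub hn0']
            have : ((2 : ℂ).re : ℝ) = 2 := rfl
            rw [this]
            field_simp
        _ ≤ _ := by gcongr
  have hs2 : Summable fun n => ‖LSeries.term f 2 n‖ * (4 * Real.exp (-Real.log 2 * s.re)) :=
    hsum.mul_right _
  refine (tsum_of_norm_bounded hs2.hasSum hterm).trans (le_of_eq ?_)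
  rw [tsum_mul_right]; ring

theorem exists_norm_logDirichlet_le :
    ∃ C : ℝ, 0 ≤ C ∧ ∀ s : ℂ, 2 ≤ s.re →
      ‖logDirichlet s‖ ≤ C * Real.exp (-Real.log 2 * s.re) :=
  exists_norm_LSeries_le (by simp [logCoeff_one]) (lseriesSummable_logCoeff (by simp))

theorem exists_norm_logDeriv_riemannZeta_le :
    ∃ C : ℝ, 0 ≤ C ∧ ∀ s : ℂ, 2 ≤ s.re →
      ‖logDeriv riemannZeta s‖ ≤ C * Real.exp (-Real.log 2 * s.re) := by
  obtain ⟨C, hC, h⟩ := exists_norm_LSeries_le (f := fun n => (ArithmeticFunction.vonMangoldt n : ℂ))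
    (by simp) (ArithmeticFunction.LSeriesSummable_vonMangoldt (by simp))
  refine ⟨C, hC, fun s hs => ?_⟩
  have h1 := ArithmeticFunction.LSeries_vonMangoldt_eq_deriv_riemannZeta_div
    (s := s) (by linarith)
  rw [logDeriv_apply, ← norm_neg, ← neg_div, ← h1]
  exact h s hs

theorem differentiableAt_logDeriv_riemannZeta {z : ℂ} (hz : z ≠ 1) (h0 : riemannZeta z ≠ 0) :
    DifferentiableAt ℂ (logDeriv riemannZeta) z := by
  have h1 : DifferentiableOn ℂ riemannZeta {1}ᶜ := fun w hw =>
    (differentiableAt_riemannZeta hw).differentiableWithinAt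
  have h2 : DifferentiableAt ℂ (deriv riemannZeta) z :=
    (h1.deriv isOpen_compl_singleton).differentiableAt
      (isOpen_compl_singleton.mem_nhds hz)
  exact h2.div (differentiableAt_riemannZeta hz) h0

theorem hasDerivAt_horizontal (y x : ℝ) :
    HasDerivAt (fun x : ℝ => (x : ℂ) + (y : ℂ) * Complex.I) 1 x :=
  (Complex.ofRealCLM.hasDerivAt).add_const _

theorem tendsto_logDirichlet_horizontal (y : ℝ) :
    Tendsto (fun x : ℝ => logDirichlet (x + y * Complex.I)) atTop (𝓝 0) := by
  obtain ⟨C, hC, h⟩ := exists_norm_logDirichlet_le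
  have hlim : Tendsto (fun x : ℝ => C * Real.exp (-Real.log 2 * x)) atTop (𝓝 0) := by
    have h1 : Tendsto (fun x : ℝ => -Real.log 2 * x) atTop atBot :=
      tendsto_id.const_mul_atTop_of_neg (neg_lt_zero.2 (Real.log_pos one_lt_two))
    simpa using (Real.tendsto_exp_atBot.comp h1).const_mul C
  refine squeeze_zero_norm' ?_ hlim
  filter_upwards [eventually_ge_atTop 2] with x hx
  simpa using h (x + y * Complex.I) (by simpa using hx)

theorem integrableOn_logDeriv_horizontal (y : ℝ) {a : ℝ} (ha : 2 ≤ a) :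
    IntegrableOn (fun x : ℝ => logDeriv riemannZeta (x + y * Complex.I)) (Set.Ioi a) := by
  obtain ⟨C, hC, h⟩ := exists_norm_logDeriv_riemannZeta_le
  have hi : IntegrableOn (fun x => C * Real.exp (-Real.log 2 * x)) (Set.Ioi a) :=
    (exp_neg_integrableOn_Ioi a (Real.log_pos one_lt_two)).const_mul C
  refine Integrable.mono' hi ?_ ?_
  · refine ContinuousOn.aestronglyMeasurable ?_ measurableSet_Ioi
    intro x hx
    have hx' : a < x := hx
    refine ContinuousAt.continuousWithinAt ?_
    refine (differentiableAt_logDeriv_riemannZeta ?_ ?_).continuousAt.comp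
      (f := fun x : ℝ => (x : ℂ) + (y : ℂ) * Complex.I)
      (hasDerivAt_horizontal y x).continuousAt
    · intro h
      have := congrArg Complex.re h
      simp at this; linarith
    · exact riemannZeta_ne_zero_of_one_lt_re (by simp; linarith)
  · filter_upwards [ae_restrict_mem measurableSet_Ioi] with x hx
    have hx' : a < x := hx
    simpa using h (x + y * Complex.I) (by simp; linarith)

theorem integral_logDeriv_horizontal (y : ℝ) {a : ℝ} (ha : 2 ≤ a) :
    ∫ x in Set.Ioi a, logDeriv riemannZeta (x + y * Complex.I)
      = -logDirichlet (a + y * Complex.I) := by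
  have h : ∀ x : ℝ, 1 < x → HasDerivAt (fun x : ℝ => logDirichlet (x + y * Complex.I))
      (logDeriv riemannZeta (x + y * Complex.I)) x := by
    intro x hx
    have h1 : HasDerivAt logDirichlet (logDeriv riemannZeta (x + y * Complex.I))
      (x + y * Complex.I) := hasDerivAt_logDirichlet (by simpa using hx)
    have h2 := h1.comp x (hasDerivAt_horizontal y x)
    rw [mul_one] at h2
    exact h2
  rw [integral_Ioi_of_hasDerivAt_of_tendsto
    (h a (by linarith)).continuousAt.continuousWithinAt
    (fun x hx => h x (by have : a < x := hx; linarith)) (integrableOn_logDeriv_horizontal y ha)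
    (tendsto_logDirichlet_horizontal y), zero_sub]

/-- `logZeta` agrees with any primitive of `ζ' / ζ` along a horizontal segment that takes the value
of the Dirichlet series at abscissa `2`. -/
theorem logZeta_eq_of_primitive {F : ℂ → ℂ} {z : ℂ} (hz : z.re ≤ 2)
    (hF : ∀ x ∈ Set.Icc z.re 2, HasDerivAt F (logDeriv riemannZeta (x + z.im * Complex.I))
      (x + z.im * Complex.I))
    (hne : ∀ x ∈ Set.Icc z.re 2, riemannZeta (x + z.im * Complex.I) ≠ 0 ∧
      (x + z.im * Complex.I : ℂ) ≠ 1)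
    (h2 : F (2 + z.im * Complex.I) = logDirichlet (2 + z.im * Complex.I)) :
    logZeta z = F z := by
  have hcont : ContinuousOn (fun x : ℝ => logDeriv riemannZeta (x + z.im * Complex.I))
      (Set.Icc z.re 2) := fun x hx =>
    ((differentiableAt_logDeriv_riemannZeta (hne x hx).2 (hne x hx).1).continuousAt.comp
      (f := fun x : ℝ => (x : ℂ) + (z.im : ℂ) * Complex.I)
      (hasDerivAt_horizontal z.im x).continuousAt).continuousWithinAt
  have hii : IntervalIntegrable (fun x : ℝ => logDeriv riemannZeta (x + z.im * Complex.I)) volume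
      z.re 2 := by
    refine ContinuousOn.intervalIntegrable ?_
    rwa [Set.uIcc_of_le hz]
  have hftc := intervalIntegral.integral_eq_sub_of_hasDerivAt
    (f := fun x : ℝ => F (x + z.im * Complex.I)) (a := z.re) (b := 2) (fun x hx => by
      rw [Set.uIcc_of_le hz] at hx
      have h := (hF x hx).comp x (hasDerivAt_horizontal z.im x)
      rw [mul_one] at h
      exact h) hii
  have hi2 := integrableOn_logDeriv_horizontal z.im (le_refl 2)
  have hsplit := intervalIntegral.integral_interval_add_Ioi (a := z.re) (b := 2)
    (f := fun x : ℝ => logDeriv riemannZeta (x + z.im * Complex.I)) (μ := volume) ?_ hi2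
  · rw [logZeta, ← hsplit, hftc, integral_logDeriv_horizontal _ le_rfl]
    push_cast
    rw [h2, Complex.re_add_im]; ring
  · rw [← Set.Ioc_union_Ioi_eq_Ioi hz]
    exact ((intervalIntegrable_iff_integrableOn_Ioc_of_le hz).1 hii).union hi2

theorem logZeta_eq_logDirichlet {z : ℂ} (hz : 1 < z.re) : logZeta z = logDirichlet z := by
  rcases le_total z.re 2 with h | h
  · refine logZeta_eq_of_primitive h (fun x hx => ?_) (fun x hx => ⟨?_, ?_⟩) rfl
    · exact hasDerivAt_logDirichlet (by simpa using hz.trans_le hx.1)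
    · exact riemannZeta_ne_zero_of_one_lt_re (by simpa using hz.trans_le hx.1)
    · intro h
      have := congrArg Complex.re h
      simp at this; linarith [hx.1]
  · rw [logZeta, integral_logDeriv_horizontal _ h, neg_neg, Complex.re_add_im]

/-- The reflection principle for ζ'/ζ. It reduces the factors at r_j - it to the same vertical
direction as those at s_j + it. -/
theorem logZeta_conj (s : ℂ) : logZeta (conj s) = conj (logZeta s) := by
  have h1 : ∀ z, logDeriv riemannZeta (conj z) = conj (logDeriv riemannZeta z) := by
    intro z
    have e : (conj ∘ riemannZeta ∘ conj : ℂ → ℂ) = riemannZeta := by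
      ext w; simp [riemannZeta_conj]
    have h2 : deriv riemannZeta (conj z) = conj (deriv riemannZeta z) := by
      have := congrFun (deriv_conj_conj (f := riemannZeta)) (conj z)
      rw [e] at this
      rw [this]; simp
    rw [logDeriv_apply, logDeriv_apply, h2, riemannZeta_conj, map_div₀]
  rw [logZeta, logZeta, map_neg, ← integral_conj]
  congr 2
  ext x
  rw [← h1]
  simp

theorem zetaFreeRight_conj {s : ℂ} (h : ZetaFreeRight s) : ZetaFreeRight (conj s) := by
  intro x hx h0
  refine h x (by simpa using hx) ?_
  have := congrArg conj h0
  rw [← riemannZeta_conj] at this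
  simpa using this

/-- The quotient of the two sides has derivative zero on a convex set. Some nonzero constant
suffices for the bounds below, so its value is not determined. -/
theorem exists_riemannZeta_eq_mul_exp :
    ∃ K : ℂ, K ≠ 0 ∧ ∀ z : ℂ, 1 < z.re → riemannZeta z = K * Complex.exp (logDirichlet z) := by
  have hopen : IsOpen {z : ℂ | 1 < z.re} := isOpen_lt continuous_const Complex.continuous_re
  have hd : ∀ z ∈ {z : ℂ | 1 < z.re},
      HasDerivAt (fun z => riemannZeta z * Complex.exp (-logDirichlet z)) 0 z := by
    intro z hz
    have hz' : 1 < z.re := hz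
    have h0 := riemannZeta_ne_zero_of_one_lt_re hz'
    have hz1 : z ≠ 1 := by rintro rfl; simp at hz'
    have h1 := ((differentiableAt_riemannZeta hz1).hasDerivAt).mul
      ((hasDerivAt_logDirichlet hz').neg.cexp)
    refine h1.congr_deriv ?_
    rw [logDeriv_apply]; field_simp; ring
  refine ⟨riemannZeta 2 * Complex.exp (-logDirichlet 2),
    mul_ne_zero (riemannZeta_ne_zero_of_one_lt_re (by simp)) (Complex.exp_ne_zero _), ?_⟩
  intro z hz
  have hc := hopen.is_const_of_deriv_eq_zero (convex_halfSpace_re_gt 1).isPreconnected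
    (fun w hw => (hd w hw).differentiableAt.differentiableWithinAt)
    (fun w hw => (hd w hw).deriv) (show z ∈ {z : ℂ | 1 < z.re} from hz)
    (show (2 : ℂ) ∈ {z : ℂ | 1 < z.re} by simp)
  rw [← hc, mul_assoc, ← Complex.exp_add, neg_add_cancel, Complex.exp_zero, mul_one]

/-- On a disc with centre of real part `2` that is free of zeros of `ζ`, the function `logZeta` is
a primitive of `ζ' / ζ`, and a logarithm of `ζ` up to an additive constant. -/
theorem hasDerivAt_logZeta_of_mem_ball {τ R : ℝ} (hR : R ≤ 3 / 2) (hR1 : 1 < R) (hτ : 4 ≤ |τ|)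
    (h0 : ∀ z ∈ Metric.ball (2 + τ * Complex.I) R, riemannZeta z ≠ 0) :
    ∀ z ∈ Metric.ball (2 + τ * Complex.I) R, HasDerivAt logZeta (logDeriv riemannZeta z) z := by
  set c : ℂ := 2 + τ * Complex.I with hc
  have hcre : c.re = 2 := by simp [hc]
  have hcim : c.im = τ := by simp [hc]
  have hne1 : ∀ z ∈ Metric.ball c R, z ≠ 1 := by
    rintro z hz rfl
    rw [Metric.mem_ball, dist_eq_norm] at hz
    have := Complex.abs_im_le_norm (1 - c)
    simp only [Complex.sub_im, Complex.one_im, zero_sub, abs_neg, hcim] at this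
    linarith
  have hexact : Complex.IsExactOn (logDeriv riemannZeta) (Metric.ball c R) :=
    DifferentiableOn.isExactOn_ball fun z hz =>
      (differentiableAt_logDeriv_riemannZeta (hne1 z hz) (h0 z hz)).differentiableWithinAt
  -- A primitive on the whole disc, normalised at the centre. It agrees with the Dirichlet series on
  -- the part of the disc with Re > 1, and then with `logZeta` along horizontal segments, which stay
  -- in the disc.
  obtain ⟨F, hFc, hF⟩ := hexact.with_val_at c (logDirichlet c)
  set V : Set ℂ := Metric.ball c R ∩ {z | 1 < z.re} with hV
  have hVo : IsOpen V := Metric.isOpen_ball.inter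
    (isOpen_lt continuous_const Complex.continuous_re)
  have hVc : IsPreconnected V :=
    ((convex_ball c R).inter (convex_halfSpace_re_gt 1)).isPreconnected
  have hcV : c ∈ V := ⟨Metric.mem_ball_self (by linarith), by simp [hcre]⟩
  have hd : ∀ z ∈ V, HasDerivAt (fun z => F z - logDirichlet z) 0 z := fun z hz => by
    have := (hF z hz.1).sub (hasDerivAt_logDirichlet hz.2)
    rwa [sub_self] at this
  have hFV : ∀ z ∈ V, F z = logDirichlet z := by
    intro z hz
    have := hVo.is_const_of_deriv_eq_zero hVc
      (fun w hw => (hd w hw).differentiableAt.differentiableWithinAt)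
      (fun w hw => (hd w hw).deriv) hz hcV
    simp only [hFc, sub_self] at this
    exact sub_eq_zero.1 this
  have hEq : ∀ z ∈ Metric.ball c R, logZeta z = F z := by
    intro z hz
    rcases le_total z.re 2 with h | h
    · have hz' := hz
      rw [Metric.mem_ball, dist_eq_norm] at hz'
      have hseg : ∀ x ∈ Set.Icc z.re 2, (x + z.im * Complex.I : ℂ) ∈ Metric.ball c R := by
        intro x hx
        rw [Metric.mem_ball, dist_eq_norm]
        refine lt_of_le_of_lt ?_ hz'
        rw [Complex.norm_def, Complex.norm_def, Complex.normSq_apply, Complex.normSq_apply]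
        refine Real.sqrt_le_sqrt ?_
        simp only [Complex.sub_re, Complex.add_re, Complex.ofReal_re, Complex.mul_re, Complex.I_re,
          mul_zero, Complex.ofReal_im, Complex.I_im, mul_one, sub_self, add_zero, hcre,
          Complex.sub_im, Complex.add_im, Complex.mul_im, zero_add, hcim]
        nlinarith [hx.1, hx.2]
      refine logZeta_eq_of_primitive h (fun x hx => hF _ (hseg x hx))
        (fun x hx => ⟨h0 _ (hseg x hx), hne1 _ (hseg x hx)⟩) (hFV _ ⟨?_, by simp⟩)
      have := hseg 2 ⟨h, le_rfl⟩
      simpa using this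
    · rw [logZeta_eq_logDirichlet (by linarith)]
      exact (hFV z ⟨hz, by have : (1:ℝ) < z.re := by linarith
                           exact this⟩).symm
  intro z hz
  refine (hF z hz).congr_of_eventuallyEq ?_
  filter_upwards [Metric.isOpen_ball.mem_nhds hz] with w hw using hEq w hw

/-- Borel–Carathéodory on the disc with centre 2 + iτ, where τ = Im z, and radius 2 - σ₁ ≤ 3/2,
which the hypothesis frees of zeros. There Re log ζ is log |ζ| up to a constant, hence at most log
|τ| + O(1). The point z is at distance at least σ' - σ₁ from the boundary. Beyond Re z = 2 the
Dirichlet series is bounded. -/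
theorem exists_norm_logZeta_le {σ₁ σ' : ℝ} (h1 : 1 / 2 ≤ σ₁) (h2 : σ₁ < σ') (h3 : σ' < 1) :
    ∃ C : ℝ, 1 ≤ C ∧ ∀ z : ℂ, σ' ≤ z.re → 4 ≤ |z.im| →
      (∀ ρ : ℂ, riemannZeta ρ = 0 → σ₁ < ρ.re → 2 ≤ |ρ.im - z.im|) →
      DifferentiableAt ℂ logZeta z ∧ ‖logZeta z‖ ≤ C * Real.log |z.im| := by
  obtain ⟨K, hK, hexp⟩ := exists_riemannZeta_eq_mul_exp
  obtain ⟨A, hA, hLD⟩ := exists_norm_logDirichlet_le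
  have hLD' : ∀ s : ℂ, 2 ≤ s.re → ‖logDirichlet s‖ ≤ A := by
    intro s hs
    refine (hLD s hs).trans (mul_le_of_le_one_right hA (Real.exp_le_one_iff.2 ?_))
    have := Real.log_pos one_lt_two
    nlinarith
  set B : ℝ := |Real.log 5 - Real.log ‖K‖| with hB
  set C : ℝ := 2 * (1 + B) * (2 - σ') / (σ' - σ₁) + A * (4 - σ₁ - σ') / (σ' - σ₁) with hC
  have hd : 0 < σ' - σ₁ := by linarith
  refine ⟨max 1 (max A C), le_max_left _ _, ?_⟩
  intro z hz him hzero
  have hlog1 : 1 ≤ Real.log |z.im| := by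
    rw [Real.le_log_iff_exp_le (by linarith)]
    have := Real.exp_one_lt_d9; linarith
  rcases le_or_gt z.re 2 with hz2 | hz2
  · set τ := z.im with hτ
    set c : ℂ := 2 + τ * Complex.I with hc
    set R : ℝ := 2 - σ₁ with hR
    have hball : ∀ w ∈ Metric.ball c R, |w.im - τ| < R ∧ σ₁ < w.re := by
      intro w hw
      rw [Metric.mem_ball, dist_eq_norm] at hw
      have e1 := (Complex.abs_im_le_norm (w - c)).trans_lt hw
      have e2 := (Complex.abs_re_le_norm (w - c)).trans_lt hw
      simp [hc] at e1 e2
      rw [abs_lt] at e2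
      exact ⟨e1, by linarith [e2.1]⟩
    have h0 : ∀ w ∈ Metric.ball c R, riemannZeta w ≠ 0 := by
      intro w hw hw0
      obtain ⟨e1, e2⟩ := hball w hw
      have := hzero w hw0 e2
      linarith
    have hder := hasDerivAt_logZeta_of_mem_ball (by linarith) (by linarith) him h0
    have hne1 : ∀ w ∈ Metric.ball c R, w ≠ 1 := by
      rintro w hw rfl
      have := (hball 1 hw).1
      simp at this; linarith
    have hzc : z - c = ((z.re - 2 : ℝ) : ℂ) := by
      apply Complex.ext <;> simp [hc, hτ]
    have hznorm : ‖z - c‖ = 2 - z.re := by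
      rw [hzc, Complex.norm_real, Real.norm_eq_abs, abs_of_nonpos (by linarith)]; ring
    have hzb : z ∈ Metric.ball c R := by
      rw [Metric.mem_ball, dist_eq_norm, hznorm]; linarith
    have hlc : logZeta c = logDirichlet c := logZeta_eq_logDirichlet (by simp [hc])
    have hconst : ∀ w ∈ Metric.ball c R, riemannZeta w * Complex.exp (-logZeta w) = K := by
      have hdd : ∀ w ∈ Metric.ball c R,
          HasDerivAt (fun w => riemannZeta w * Complex.exp (-logZeta w)) 0 w := by
        intro w hw
        have e1 := ((differentiableAt_riemannZeta (hne1 w hw)).hasDerivAt).mul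
          ((hder w hw).neg.cexp)
        refine e1.congr_deriv ?_
        have := h0 w hw
        rw [logDeriv_apply]; field_simp; ring
      intro w hw
      have := Metric.isOpen_ball.is_const_of_deriv_eq_zero (convex_ball c R).isPreconnected
        (fun w hw => (hdd w hw).differentiableAt.differentiableWithinAt)
        (fun w hw => (hdd w hw).deriv) hw (Metric.mem_ball_self (by linarith))
      rw [this, hlc, hexp c (by simp [hc]), mul_assoc, ← Complex.exp_add, add_neg_cancel,
        Complex.exp_zero, mul_one]
    have hre : ∀ w ∈ Metric.ball c R, (logZeta w).re ≤ Real.log |τ| + B := by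
      intro w hw
      have e1 := congrArg norm (hconst w hw)
      rw [norm_mul, Complex.norm_exp, Complex.neg_re] at e1
      have hz0 : 0 < ‖riemannZeta w‖ := norm_pos_iff.2 (h0 w hw)
      have e2 : (logZeta w).re = Real.log ‖riemannZeta w‖ - Real.log ‖K‖ := by
        rw [← e1, Real.log_mul hz0.ne' (Real.exp_pos _).ne', Real.log_exp]; ring
      -- Here |w| ≤ 3/2 + 2 + |τ|, so the linear bound gives 9 + 2|τ|, and |τ| ≥ 4.
      have e3 : ‖riemannZeta w‖ ≤ 5 * |τ| := by
        obtain ⟨f1, f2⟩ := hball w hw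
        have f3 : 1 ≤ |w.im| := by
          have := abs_sub_abs_le_abs_sub τ w.im
          rw [abs_sub_comm] at this
          linarith
        have f4 := norm_riemannZeta_le (s := w) (by linarith) f3
        rw [Metric.mem_ball, dist_eq_norm] at hw
        have f5 : ‖w‖ ≤ ‖w - c‖ + ‖c‖ := by
          have := norm_add_le (w - c) c; simpa using this
        have f6 : ‖c‖ ≤ 2 + |τ| := by
          refine (norm_add_le _ _).trans ?_
          simp
        linarith
      have e4 : Real.log ‖riemannZeta w‖ ≤ Real.log 5 + Real.log |τ| := by
        rw [← Real.log_mul (by norm_num) (by linarith)]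
        exact Real.log_le_log hz0 e3
      have e5 : Real.log 5 - Real.log ‖K‖ ≤ B := le_abs_self _
      linarith
    refine ⟨(hder z hzb).differentiableAt, ?_⟩
    have hBC := Complex.borelCaratheodory (f := fun w => logZeta (c + w)) (R := R)
      (M := Real.log |τ| + B) (z := z - c) (by have := abs_nonneg (Real.log 5 - Real.log ‖K‖); linarith)
      (fun w hw => by
        have hcw : c + w ∈ Metric.ball c R := by
          simpa [Metric.mem_ball, dist_eq_norm] using hw
        have e1 := (hder _ hcw).differentiableAt
        exact (e1.comp w ((differentiableAt_id).const_add c)).differentiableWithinAt)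
      (fun w hw => by
        have hcw : c + w ∈ Metric.ball c R := by
          simpa [Metric.mem_ball, dist_eq_norm] using hw
        exact hre _ hcw) (by linarith)
      (by rw [mem_ball_zero_iff, hznorm]; linarith)
    simp only [add_sub_cancel, add_zero, hznorm] at hBC
    have hcA : ‖logZeta c‖ ≤ A := by rw [hlc]; exact hLD' c (by simp [hc])
    have hB0 : 0 ≤ B := abs_nonneg _
    have hden : σ' - σ₁ ≤ R - (2 - z.re) := by linarith
    calc ‖logZeta z‖ ≤ _ := hBC
      _ ≤ 2 * ((1 + B) * Real.log |τ|) * (2 - σ') / (σ' - σ₁)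
          + A * Real.log |τ| * (4 - σ₁ - σ') / (σ' - σ₁) := by
          have hL0 : (0 : ℝ) ≤ Real.log |τ| := by linarith
          have hA1 : ‖logZeta c‖ ≤ A * Real.log |τ| :=
            hcA.trans (le_mul_of_one_le_right hA hlog1)
          have hM : Real.log |τ| + B ≤ (1 + B) * Real.log |τ| := by nlinarith
          have hM0 : 0 ≤ (1 + B) * Real.log |τ| := by positivity
          refine add_le_add (div_le_div₀ ?_ ?_ hd hden) (div_le_div₀ ?_ ?_ hd hden)
          · exact mul_nonneg (by linarith) (by linarith)
          · exact mul_le_mul (by linarith) (by linarith) (by linarith) (by linarith)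
          · exact mul_nonneg (mul_nonneg hA hL0) (by linarith)
          · exact mul_le_mul hA1 (by linarith) (by linarith) (mul_nonneg hA hL0)
      _ = C * Real.log |τ| := by rw [hC]; ring
      _ ≤ _ := by gcongr; exact (le_max_right _ _).trans (le_max_right _ _)
  · have hev : logZeta =ᶠ[𝓝 z] logDirichlet := by
      filter_upwards [(isOpen_lt continuous_const Complex.continuous_re).mem_nhds
        (show (1 : ℝ) < z.re by linarith)] with w hw using logZeta_eq_logDirichlet hw
    refine ⟨((hasDerivAt_logDirichlet (by linarith)).differentiableAt).congr_of_eventuallyEq hev, ?_⟩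
    rw [logZeta_eq_logDirichlet (by linarith)]
    calc _ ≤ A := hLD' z hz2.le
      _ ≤ A * Real.log |z.im| := le_mul_of_one_le_right hA hlog1
      _ ≤ _ := by gcongr; exact (le_max_left _ _).trans (le_max_right _ _)


/-! ### Smoothing by a truncated contour integral -/

theorem hasDerivAt_vertical (x y : ℝ) :
    HasDerivAt (fun y : ℝ => (x : ℂ) + (y : ℂ) * Complex.I) Complex.I y := by
  simpa using ((Complex.ofRealCLM.hasDerivAt (x := y)).mul_const Complex.I).const_add (x : ℂ)

/-- The principal logarithm is a primitive of 1/w on the two horizontal edges and the right edge.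
The left edge crosses its cut, so log(-w) is used there; the mismatch of the arguments at the left
corners is 2π. -/
theorem integral_boundary_rect_inv {δ b H : ℝ} (hδ : 0 < δ) (hb : 0 < b) (hH : 0 < H) :
    (∫ x : ℝ in -δ..b, ((x : ℂ) + (-H : ℝ) * Complex.I)⁻¹)
      - (∫ x : ℝ in -δ..b, ((x : ℂ) + (H : ℝ) * Complex.I)⁻¹)
      + Complex.I * (∫ y : ℝ in -H..H, ((b : ℝ) + (y : ℂ) * Complex.I)⁻¹)
      - Complex.I * (∫ y : ℝ in -H..H, ((-δ : ℝ) + (y : ℂ) * Complex.I)⁻¹)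
      = 2 * Real.pi * Complex.I := by
  have hor : ∀ y : ℝ, y ≠ 0 → ∫ x : ℝ in -δ..b, ((x : ℂ) + (y : ℝ) * Complex.I)⁻¹
      = Complex.log (b + y * Complex.I) - Complex.log ((-δ : ℝ) + y * Complex.I) := by
    intro y hy
    have hd : ∀ x : ℝ, HasDerivAt (fun x : ℝ => Complex.log ((x : ℂ) + (y : ℝ) * Complex.I))
        ((x : ℂ) + (y : ℝ) * Complex.I)⁻¹ x := by
      intro x
      have h := (Complex.hasDerivAt_log (z := (x : ℂ) + (y : ℝ) * Complex.I)
        (Or.inr (by simpa using hy))).comp x (hasDerivAt_horizontal y x)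
      rw [mul_one] at h
      exact h
    refine intervalIntegral.integral_eq_sub_of_hasDerivAt (fun x _ => hd x) ?_
    refine Continuous.intervalIntegrable ?_ _ _
    refine Continuous.inv₀ (by fun_prop) fun x h => hy ?_
    simpa using congrArg Complex.im h
  have hver : ∫ y : ℝ in -H..H, ((b : ℝ) + (y : ℂ) * Complex.I)⁻¹
      = Complex.log (b + H * Complex.I) / Complex.I
        - Complex.log (b + (-H : ℝ) * Complex.I) / Complex.I := by
    have hd : ∀ y : ℝ, HasDerivAt
        (fun y : ℝ => Complex.log ((b : ℂ) + (y : ℝ) * Complex.I) / Complex.I)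
        ((b : ℂ) + (y : ℝ) * Complex.I)⁻¹ y := by
      intro y
      have h := ((Complex.hasDerivAt_log (z := (b : ℂ) + (y : ℝ) * Complex.I)
        (Or.inl (by simpa using hb))).comp y (hasDerivAt_vertical b y)).div_const Complex.I
      rw [mul_div_assoc, div_self Complex.I_ne_zero, mul_one] at h
      exact h
    refine intervalIntegral.integral_eq_sub_of_hasDerivAt (fun x _ => hd x) ?_
    refine Continuous.intervalIntegrable ?_ _ _
    refine Continuous.inv₀ (by fun_prop) fun x h => hb.ne' ?_
    simpa using congrArg Complex.re h
  have hver' : ∫ y : ℝ in -H..H, ((-δ : ℝ) + (y : ℂ) * Complex.I)⁻¹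
      = Complex.log (-((-δ : ℝ) + H * Complex.I)) / Complex.I
        - Complex.log (-((-δ : ℝ) + (-H : ℝ) * Complex.I)) / Complex.I := by
    have hd : ∀ y : ℝ, HasDerivAt
        (fun y : ℝ => Complex.log (-(((-δ : ℝ) : ℂ) + (y : ℝ) * Complex.I)) / Complex.I)
        (((-δ : ℝ) : ℂ) + (y : ℝ) * Complex.I)⁻¹ y := by
      intro y
      have h := ((Complex.hasDerivAt_log (z := -(((-δ : ℝ) : ℂ) + (y : ℝ) * Complex.I))
        (Or.inl (by simpa using hδ))).comp y (hasDerivAt_vertical (-δ) y).neg).div_const Complex.I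
      rw [mul_div_assoc, neg_div, div_self Complex.I_ne_zero, inv_neg, neg_mul_neg, mul_one] at h
      exact h
    refine intervalIntegral.integral_eq_sub_of_hasDerivAt (fun x _ => hd x) ?_
    refine Continuous.intervalIntegrable ?_ _ _
    refine Continuous.inv₀ (by fun_prop) fun x h => hδ.ne' ?_
    simpa using congrArg Complex.re h
  rw [hor _ (by linarith), hor _ hH.ne', hver, hver']
  set u : ℂ := (δ : ℂ) + H * Complex.I with hu
  have him : 0 < u.im := by simp [hu, hH]
  have hre : 0 < u.re := by simp [hu, hδ]
  have harg : (conj u).arg = -u.arg := by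
    rw [Complex.arg_conj, if_neg]
    intro h
    rw [Complex.arg_eq_pi_iff] at h
    linarith [h.1]
  have e1 : ((-δ : ℝ) : ℂ) + (H : ℝ) * Complex.I = -conj u := by
    simp [hu]; ring
  have e2 : ((-δ : ℝ) : ℂ) + (-H : ℝ) * Complex.I = -u := by
    simp [hu]; ring
  rw [e1, e2, neg_neg, neg_neg]
  have l1 : Complex.log u = Real.log ‖u‖ + u.arg * Complex.I := rfl
  have l2 : Complex.log (conj u) = Real.log ‖u‖ - u.arg * Complex.I := by
    rw [Complex.log, harg, Complex.norm_conj]; push_cast; ring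
  have l3 : Complex.log (-u) = Real.log ‖u‖ + (u.arg - Real.pi) * Complex.I := by
    rw [Complex.log, norm_neg, Complex.arg_neg_eq_arg_sub_pi_of_im_pos him]; push_cast; ring
  have l4 : Complex.log (-conj u) = Real.log ‖u‖ + (Real.pi - u.arg) * Complex.I := by
    rw [Complex.log, norm_neg, Complex.norm_conj,
      Complex.arg_neg_eq_arg_add_pi_of_im_neg (by simpa using him), harg]; push_cast; ring
  rw [l1, l2, l3, l4]
  field_simp
  ring

/-- The kernel `X ^ w * exp (w ^ 2) / w` used to smooth a Dirichlet series. -/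
noncomputable def smoothKernel (X : ℝ) (w : ℂ) : ℂ := (X : ℂ) ^ w * Complex.exp (w ^ 2) / w

/-- The truncated contour integral of `F` against the smoothing kernel on the line `Re w = 3`. -/
noncomputable def contourMean (X H : ℝ) (F : ℂ → ℂ) : ℂ :=
  (1 / (2 * Real.pi) : ℂ) *
    ∫ y : ℝ in -H..H, F ((3 : ℝ) + y * Complex.I) * smoothKernel X ((3 : ℝ) + y * Complex.I)

theorem norm_smoothKernel {X : ℝ} (hX : 0 < X) (x y : ℝ) :
    ‖smoothKernel X (x + y * Complex.I)‖
      = X ^ x * Real.exp (x ^ 2 - y ^ 2) / ‖(x + y * Complex.I : ℂ)‖ := by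
  rw [smoothKernel, norm_div, norm_mul, Complex.norm_cpow_eq_rpow_re_of_pos hX, Complex.norm_exp]
  congr 3
  · simp
  · rw [sq, Complex.mul_re]; simp; ring

theorem integral_exp_neg_sq_le (H : ℝ) (hH : 0 ≤ H) :
    ∫ y : ℝ in -H..H, Real.exp (-y ^ 2) ≤ 2 := by
  have hi : Integrable fun y : ℝ => Real.exp (-1 * y ^ 2) := integrable_exp_neg_mul_sq one_pos
  have h := integral_gaussian 1
  simp only [neg_mul, one_mul, div_one] at h hi
  rw [intervalIntegral.integral_of_le (by linarith)]
  refine (setIntegral_le_integral hi (ae_of_all _ fun y => (Real.exp_pos _).le)).trans ?_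
  rw [h, Real.sqrt_le_left (by norm_num)]
  linarith [Real.pi_lt_d2]

/-- The residue theorem at the single pole w = 0. The divided difference of g(w) = F(w) X^w exp(w²)
at 0 is holomorphic, so Cauchy's theorem on the rectangle applies; it equals F times the kernel
minus F(0)/w, and 1/w contributes 2πi. The left edge then gives X^(-δ)/δ and the horizontal edges
give X³ exp(-H²). -/
theorem norm_contourMean_sub_le {δ H X Q : ℝ} {F : ℂ → ℂ} (hδ : 0 < δ) (hδ1 : δ ≤ 1) (hH : 1 ≤ H)
    (hX : 1 ≤ X)
    (hF : ∀ w ∈ Set.Icc (-δ) 3 ×ℂ Set.Icc (-H) H, DifferentiableAt ℂ F w)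
    (hQ : ∀ w ∈ Set.Icc (-δ) 3 ×ℂ Set.Icc (-H) H, ‖F w‖ ≤ Q) :
    ‖contourMean X H F - F 0‖
      ≤ Q * (X ^ (-δ) / δ + 2 * Real.exp 9 * (X ^ (3 : ℝ) * Real.exp (-H ^ 2))) := by
  have hX0 : 0 < X := by linarith
  have hXc : (X : ℂ) ≠ 0 := by exact_mod_cast hX0.ne'
  set g : ℂ → ℂ := fun w => F w * ((X : ℂ) ^ w * Complex.exp (w ^ 2)) with hg
  set S : Set ℂ := Set.Icc (-δ) 3 ×ℂ Set.Icc (-H) H with hS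
  have hQ0 : 0 ≤ Q := (norm_nonneg _).trans (hQ 0 (by
    rw [hS, Complex.mem_reProdIm]
    simp only [Complex.zero_re, Complex.zero_im, Set.mem_Icc]
    refine ⟨⟨by linarith, by norm_num⟩, by linarith, by linarith⟩))
  have hgd : ∀ w ∈ S, DifferentiableAt ℂ g w := by
    intro w hw
    refine (hF w hw).mul (DifferentiableAt.mul ?_ ?_)
    · exact (differentiableAt_id).const_cpow (Or.inl hXc)
    · fun_prop
  have hSn : S ∈ 𝓝 (0 : ℂ) := by
    refine mem_of_superset ((IsOpen.reProdIm (isOpen_Ioo (a := -δ) (b := 3))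
      (isOpen_Ioo (a := -H) (b := H))).mem_nhds ?_) ?_
    · rw [Complex.mem_reProdIm]
      simp only [Complex.zero_re, Complex.zero_im, Set.mem_Ioo]
      exact ⟨⟨by linarith, by norm_num⟩, by linarith, by linarith⟩
    · rintro w ⟨h1, h2⟩
      exact ⟨Set.Ioo_subset_Icc_self h1, Set.Ioo_subset_Icc_self h2⟩
  have hds : DifferentiableOn ℂ (dslope g 0) S := by
    rw [Complex.differentiableOn_dslope hSn]
    exact fun w hw => (hgd w hw).differentiableWithinAt
  have hg0 : g 0 = F 0 := by simp [hg]
  have hcauchy := Complex.integral_boundary_rect_eq_zero_of_differentiableOn (dslope g 0)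
    ⟨-δ, -H⟩ ⟨3, H⟩ (by
      simp only
      rwa [Set.uIcc_of_le (by linarith), Set.uIcc_of_le (by linarith)])
  simp only [smul_eq_mul] at hcauchy
  have hslope : ∀ w : ℂ, w ≠ 0 → dslope g 0 w = F w * smoothKernel X w - F 0 * w⁻¹ := by
    intro w hw
    rw [dslope_of_ne _ hw, slope_def_field, hg0, sub_zero, smoothKernel]
    simp only [hg]; field_simp
  have hG : ∀ w ∈ S, w ≠ 0 → ContinuousAt (fun w => F w * smoothKernel X w) w := by
    intro w hw h0
    have : ContinuousAt (fun w => g w / w) w :=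
      (hgd w hw).continuousAt.div continuousAt_id h0
    refine this.congr (Eventually.of_forall fun w => ?_)
    simp only [hg, smoothKernel]; ring
  have hhor : ∀ y : ℝ, y ≠ 0 → y ∈ Set.Icc (-H) H →
      ∫ x : ℝ in -δ..3, dslope g 0 (x + y * Complex.I)
        = (∫ x : ℝ in -δ..3, F (x + y * Complex.I) * smoothKernel X (x + y * Complex.I))
          - F 0 * ∫ x : ℝ in -δ..3, ((x : ℂ) + y * Complex.I)⁻¹ := by
    intro y hy hyH
    have hne : ∀ x : ℝ, (x : ℂ) + y * Complex.I ≠ 0 := fun x h => hy (by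
      simpa using congrArg Complex.im h)
    rw [← intervalIntegral.integral_const_mul, ← intervalIntegral.integral_sub]
    · exact intervalIntegral.integral_congr fun x _ => hslope _ (hne x)
    · refine ContinuousOn.intervalIntegrable fun x hx => ?_
      rw [Set.uIcc_of_le (by linarith)] at hx
      refine ((hG _ ?_ (hne x)).comp (f := fun x : ℝ => (x : ℂ) + y * Complex.I)
        (hasDerivAt_horizontal y x).continuousAt).continuousWithinAt
      rw [hS, Complex.mem_reProdIm]; simpa using ⟨hx, hyH⟩
    · refine Continuous.intervalIntegrable ?_ _ _
      exact continuous_const.mul (Continuous.inv₀ (by fun_prop) hne)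
  have hver : ∀ x : ℝ, x ≠ 0 → x ∈ Set.Icc (-δ) 3 →
      ∫ y : ℝ in -H..H, dslope g 0 (x + y * Complex.I)
        = (∫ y : ℝ in -H..H, F (x + y * Complex.I) * smoothKernel X (x + y * Complex.I))
          - F 0 * ∫ y : ℝ in -H..H, ((x : ℂ) + y * Complex.I)⁻¹ := by
    intro x hx hxS
    have hne : ∀ y : ℝ, (x : ℂ) + y * Complex.I ≠ 0 := fun y h => hx (by
      simpa using congrArg Complex.re h)
    rw [← intervalIntegral.integral_const_mul, ← intervalIntegral.integral_sub]
    · exact intervalIntegral.integral_congr fun y _ => hslope _ (hne y)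
    · refine ContinuousOn.intervalIntegrable fun y hy => ?_
      rw [Set.uIcc_of_le (by linarith)] at hy
      refine ((hG _ ?_ (hne y)).comp (f := fun y : ℝ => (x : ℂ) + y * Complex.I)
        (hasDerivAt_vertical x y).continuousAt).continuousWithinAt
      rw [hS, Complex.mem_reProdIm]; simpa using ⟨hxS, hy⟩
    · refine Continuous.intervalIntegrable ?_ _ _
      exact continuous_const.mul (Continuous.inv₀ (by fun_prop) hne)
  have hrect := integral_boundary_rect_inv hδ (b := 3) (by norm_num) (show 0 < H by linarith)
  rw [hhor (-H) (by linarith) ⟨le_rfl, by linarith⟩, hhor H (by linarith) ⟨by linarith, le_rfl⟩,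
    hver 3 (by norm_num) ⟨by linarith, le_rfl⟩, hver (-δ) (by linarith) ⟨le_rfl, by linarith⟩]
    at hcauchy
  set Ib := ∫ x : ℝ in -δ..3, F (x + (-H : ℝ) * Complex.I) * smoothKernel X (x + (-H : ℝ) * Complex.I)
    with hIb
  set It := ∫ x : ℝ in -δ..3, F (x + H * Complex.I) * smoothKernel X (x + H * Complex.I) with hIt
  set Il := ∫ y : ℝ in -H..H, F ((-δ : ℝ) + y * Complex.I) * smoothKernel X ((-δ : ℝ) + y * Complex.I)
    with hIl
  have hpi : (Real.pi : ℂ) ≠ 0 := by exact_mod_cast Real.pi_ne_zero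
  have hmain : contourMean X H F - F 0
      = (1 / (2 * Real.pi) : ℂ) * (Il + Complex.I * (Ib - It)) := by
    rw [contourMean]
    set Ir := ∫ y : ℝ in -H..H, F ((3 : ℝ) + y * Complex.I) * smoothKernel X ((3 : ℝ) + y * Complex.I)
    have : Complex.I * Ir = F 0 * (2 * Real.pi * Complex.I) + Complex.I * Il - (Ib - It) := by
      rw [← hrect]; linear_combination hcauchy
    have h2 : Ir = F 0 * (2 * Real.pi) + Il + Complex.I * (Ib - It) := by
      have h3 : Ir = -(Complex.I * (Complex.I * Ir)) := by
        rw [← mul_assoc, Complex.I_mul_I]; ring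
      rw [h3, this]
      linear_combination (-F 0 * (2 * Real.pi) - Il) * Complex.I_mul_I
    rw [h2]; field_simp; ring
  have hhb : ∀ y : ℝ, |y| = H → ‖∫ x : ℝ in -δ..3, F (x + y * Complex.I) *
      smoothKernel X (x + y * Complex.I)‖ ≤ (Q * (X ^ (3 : ℝ) * (Real.exp 9 * Real.exp (-H ^ 2)))) * 4 := by
    intro y hy
    have hyH : y ∈ Set.Icc (-H) H := abs_le.1 hy.le
    refine (intervalIntegral.norm_integral_le_of_norm_le_const
      (C := Q * (X ^ (3 : ℝ) * (Real.exp 9 * Real.exp (-H ^ 2)))) fun x hx => ?_).trans ?_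
    · rw [Set.uIoc_of_le (by linarith)] at hx
      rw [norm_mul, norm_smoothKernel hX0]
      refine mul_le_mul (hQ _ ?_) ?_ (by positivity) hQ0
      · rw [hS, Complex.mem_reProdIm]; simpa using ⟨⟨hx.1.le, hx.2⟩, hyH⟩
      · have h1 : 1 ≤ ‖(x + y * Complex.I : ℂ)‖ := by
          refine hH.trans (hy ▸ ?_)
          simpa using Complex.abs_im_le_norm (x + y * Complex.I : ℂ)
        refine (div_le_self (by positivity) h1).trans ?_
        rw [← Real.exp_add, ← sq_abs y, hy]
        refine mul_le_mul (Real.rpow_le_rpow_of_exponent_le hX hx.2)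
          (Real.exp_le_exp.2 ?_) (Real.exp_pos _).le (by positivity)
        nlinarith [hx.1, hx.2]
    · refine mul_le_mul_of_nonneg_left ?_ (by positivity)
      rw [abs_of_nonneg] <;> linarith
  have hlb : ‖Il‖ ≤ Q * (X ^ (-δ) * (Real.exp 1 / δ)) * 2 := by
    refine (intervalIntegral.norm_integral_le_of_norm_le (by linarith)
      (g := fun y => Q * (X ^ (-δ) * (Real.exp 1 / δ)) * Real.exp (-y ^ 2))
      (ae_of_all _ fun y hy => ?_) ?_).trans ?_
    · rw [norm_mul, norm_smoothKernel hX0, mul_assoc]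
      refine mul_le_mul (hQ _ ?_) ?_ (by positivity) hQ0
      · rw [hS, Complex.mem_reProdIm]; simp; exact ⟨by linarith, hy.1.le, hy.2⟩
      · have h1 : δ ≤ ‖(((-δ : ℝ) : ℂ) + y * Complex.I : ℂ)‖ := by
          have := Complex.abs_re_le_norm (((-δ : ℝ) : ℂ) + y * Complex.I : ℂ)
          simpa [abs_of_pos hδ] using this
        calc X ^ (-δ) * Real.exp ((-δ) ^ 2 - y ^ 2) / ‖(((-δ : ℝ) : ℂ) + y * Complex.I : ℂ)‖
            ≤ X ^ (-δ) * (Real.exp 1 * Real.exp (-y ^ 2)) / δ := by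
              rw [← Real.exp_add]
              gcongr
              nlinarith
          _ = _ := by ring
    · exact Continuous.intervalIntegrable (by fun_prop) _ _
    · rw [intervalIntegral.integral_const_mul]
      exact mul_le_mul_of_nonneg_left (integral_exp_neg_sq_le H (by linarith)) (by positivity)
  rw [hmain, norm_mul]
  have hpin : ‖(1 / (2 * Real.pi) : ℂ)‖ = 1 / (2 * Real.pi) := by
    rw [norm_div, norm_mul, Complex.norm_real, Real.norm_eq_abs, abs_of_pos Real.pi_pos]; simp
  have hb1 : ‖Ib‖ ≤ _ := hhb (-H) (by rw [abs_neg, abs_of_nonneg (by linarith)])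
  have hb2 : ‖It‖ ≤ _ := hhb H (abs_of_nonneg (by linarith))
  have hn : ‖Il + Complex.I * (Ib - It)‖ ≤ ‖Il‖ + (‖Ib‖ + ‖It‖) := by
    refine (norm_add_le _ _).trans ?_
    rw [norm_mul, Complex.norm_I, one_mul]
    gcongr
    exact norm_sub_le _ _
  have he : Real.exp 1 ≤ 3 := by linarith [Real.exp_one_lt_d9]
  have hpi3 : 3 < Real.pi := Real.pi_gt_three
  set a := X ^ (-δ) / δ with ha
  set b := X ^ (3 : ℝ) * Real.exp (-H ^ 2) with hb
  have ha0 : 0 ≤ a := by positivity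
  have hb0 : 0 ≤ b := by positivity
  have hl2 : ‖Il‖ ≤ 6 * (Q * a) := by
    refine hlb.trans ?_
    have : Q * (X ^ (-δ) * (Real.exp 1 / δ)) * 2 = 2 * Real.exp 1 * (Q * a) := by
      rw [ha]; ring
    rw [this]
    exact mul_le_mul_of_nonneg_right (by linarith) (by positivity)
  have e3 : Q * (X ^ (3 : ℝ) * (Real.exp 9 * Real.exp (-H ^ 2))) * 4 = 4 * (Q * Real.exp 9 * b) := by
    rw [hb]; ring
  rw [e3] at hb1 hb2
  have hqa : 0 ≤ Q * a := by positivity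
  have hqb : 0 ≤ Q * Real.exp 9 * b := by positivity
  rw [hpin, one_div_mul_eq_div, div_le_iff₀ (by positivity)]
  refine hn.trans ?_
  nlinarith

/-- The weight that the smoothed contour integral attaches to `n ^ (-w)`. -/
noncomputable def smoothWeight (X H : ℝ) (n : ℕ) : ℂ := contourMean X H fun w => (n : ℂ) ^ (-w)

/-- The contour shift for F(w) = n^(-w), which has modulus at most n^δ on the rectangle. It is
useful for the diagonal, where the coefficients absorb n^δ. -/
theorem norm_smoothWeight_sub_one_le {δ H X : ℝ} (hδ : 0 < δ) (hδ1 : δ ≤ 1) (hH : 1 ≤ H)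
    (hX : 1 ≤ X) {n : ℕ} (hn : 1 ≤ n) :
    ‖smoothWeight X H n - 1‖
      ≤ (n : ℝ) ^ δ * (X ^ (-δ) / δ + 2 * Real.exp 9 * (X ^ (3 : ℝ) * Real.exp (-H ^ 2))) := by
  have hn0 : (n : ℂ) ≠ 0 := by exact_mod_cast (by omega : n ≠ 0)
  have h := norm_contourMean_sub_le hδ hδ1 hH hX (F := fun w => (n : ℂ) ^ (-w))
    (Q := (n : ℝ) ^ δ) (fun w _ => (differentiableAt_id.neg).const_cpow (Or.inl hn0))
    (fun w hw => by
      rw [Complex.norm_natCast_cpow_of_pos (by omega)]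
      refine Real.rpow_le_rpow_of_exponent_le (by exact_mod_cast hn) ?_
      have := hw.1.1
      simp only [Complex.neg_re]; linarith)
  simpa [smoothWeight] using h

theorem norm_smoothKernel_three_le {X : ℝ} (hX : 0 < X) (y : ℝ) :
    ‖smoothKernel X ((3 : ℝ) + y * Complex.I)‖
      ≤ Real.exp 9 * X ^ (3 : ℝ) * Real.exp (-y ^ 2) := by
  rw [norm_smoothKernel hX]
  have h1 : 1 ≤ ‖(((3 : ℝ) : ℂ) + y * Complex.I : ℂ)‖ := by
    have := Complex.re_le_norm (((3 : ℝ) : ℂ) + y * Complex.I : ℂ)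
    simp at this ⊢; linarith
  refine (div_le_self (by positivity) h1).trans (le_of_eq ?_)
  rw [sub_eq_add_neg, Real.exp_add]; norm_num; ring

theorem norm_contourMean_le {H X B : ℝ} {F : ℂ → ℂ} (hH : 0 ≤ H) (hX : 0 < X)
    (hF : ∀ y : ℝ, ‖F ((3 : ℝ) + y * Complex.I)‖ ≤ B) :
    ‖contourMean X H F‖ ≤ B * (Real.exp 9 * X ^ (3 : ℝ)) := by
  have hB : 0 ≤ B := (norm_nonneg _).trans (hF 0)
  have h : ‖∫ y : ℝ in -H..H, F ((3 : ℝ) + y * Complex.I) *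
      smoothKernel X ((3 : ℝ) + y * Complex.I)‖ ≤ B * (Real.exp 9 * X ^ (3 : ℝ)) * 2 := by
    refine (intervalIntegral.norm_integral_le_of_norm_le (by linarith)
      (g := fun y => B * (Real.exp 9 * X ^ (3 : ℝ)) * Real.exp (-y ^ 2))
      (ae_of_all _ fun y hy => ?_) ?_).trans ?_
    · rw [norm_mul, mul_assoc B]
      exact mul_le_mul (hF y) (norm_smoothKernel_three_le hX y) (norm_nonneg _) hB
    · exact Continuous.intervalIntegrable (by fun_prop) _ _
    · rw [intervalIntegral.integral_const_mul]
      exact mul_le_mul_of_nonneg_left (integral_exp_neg_sq_le H hH) (by positivity)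
  rw [contourMean, norm_mul]
  have hpin : ‖(1 / (2 * Real.pi) : ℂ)‖ = 1 / (2 * Real.pi) := by
    rw [norm_div, norm_mul, Complex.norm_real, Real.norm_eq_abs, abs_of_pos Real.pi_pos]; simp
  rw [hpin, one_div_mul_eq_div, div_le_iff₀ (by positivity)]
  refine h.trans (mul_le_mul_of_nonneg_left ?_ (by positivity))
  linarith [Real.pi_gt_three]

/-- The integral is estimated on Re w = 3 without any shift. This decay gives the smoothed series an
effective length of a power of X. -/
theorem norm_smoothWeight_le {H X : ℝ} (hH : 0 ≤ H) (hX : 0 < X) {n : ℕ} (hn : 1 ≤ n) :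
    ‖smoothWeight X H n‖ ≤ (n : ℝ) ^ (-3 : ℝ) * (Real.exp 9 * X ^ (3 : ℝ)) := by
  refine norm_contourMean_le hH hX fun y => ?_
  rw [Complex.norm_natCast_cpow_of_pos (by omega)]
  simp


/-! ### Dirichlet coefficients of products of logarithms and their mean values -/

/-- The coefficients of the Dirichlet series `w ↦ logDirichlet (z + w)`. -/
noncomputable def shiftedCoeff (z : ℂ) : ArithmeticFunction ℂ :=
  ⟨fun n => logCoeff n * (n : ℂ) ^ (-z), by simp [logCoeff_zero]⟩

theorem shiftedCoeff_apply (z : ℂ) (n : ℕ) :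
    shiftedCoeff z n = logCoeff n * (n : ℂ) ^ (-z) := rfl

/-- The coefficients of the Dirichlet series `w ↦ ∏ j, logDirichlet (s j + w)`. -/
noncomputable def prodCoeff {k : ℕ} (s : Fin k → ℂ) : ArithmeticFunction ℂ :=
  ∏ j, shiftedCoeff (s j)

theorem term_shiftedCoeff (z w : ℂ) (n : ℕ) :
    LSeries.term (shiftedCoeff z) w n = LSeries.term (fun n => (logCoeff n : ℂ)) (z + w) n := by
  rcases eq_or_ne n 0 with rfl | hn
  · simp
  · have hnc : (n : ℂ) ≠ 0 := by exact_mod_cast hn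
    rw [LSeries.term_of_ne_zero hn, LSeries.term_of_ne_zero hn, shiftedCoeff_apply,
      Complex.cpow_add _ _ hnc, Complex.cpow_neg]
    field_simp

theorem lseries_prod_shiftedCoeff {ι : Type*} (S : Finset ι) (s : ι → ℂ) (w : ℂ)
    (hs : ∀ j ∈ S, 1 < (s j + w).re) :
    LSeriesSummable ⇑(∏ j ∈ S, shiftedCoeff (s j)) w ∧
      LSeries ⇑(∏ j ∈ S, shiftedCoeff (s j)) w = ∏ j ∈ S, logDirichlet (s j + w) := by
  classical
  induction S using Finset.induction_on with
  | empty =>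
    simp only [Finset.prod_empty, ArithmeticFunction.one_eq_delta]
    refine ⟨?_, by rw [LSeries_delta]; rfl⟩
    refine (hasSum_single 1 fun n hn => ?_).summable
    rw [LSeries.term_delta]; simp [hn]
  | insert j S hj ih =>
    obtain ⟨h1, h2⟩ := ih fun i hi => hs i (Finset.mem_insert_of_mem hi)
    have h3 : LSeriesSummable (shiftedCoeff (s j)) w := by
      refine (lseriesSummable_logCoeff (hs j (Finset.mem_insert_self _ _))).congr fun n => ?_
      rw [term_shiftedCoeff]
    have h4 : LSeries (shiftedCoeff (s j)) w = logDirichlet (s j + w) :=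
      tsum_congr fun n => term_shiftedCoeff _ _ n
    rw [Finset.prod_insert hj, Finset.prod_insert hj]
    exact ⟨ArithmeticFunction.LSeriesSummable_mul h3 h1, by
      rw [ArithmeticFunction.LSeries_mul' h3 h1, h2, h4]⟩

theorem logCoeff_le_vonMangoldt_div (n : ℕ) :
    logCoeff n ≤ ArithmeticFunction.vonMangoldt n / Real.log 2 := by
  rcases Nat.lt_or_ge n 2 with h | h
  · have : n = 0 ∨ n = 1 := by omega
    rcases this with rfl | rfl <;> simp [logCoeff]
  · have h2 : Real.log 2 ≤ Real.log n := Real.log_le_log (by norm_num) (by exact_mod_cast h)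
    exact div_le_div_of_nonneg_left ArithmeticFunction.vonMangoldt_nonneg
      (Real.log_pos one_lt_two) h2

/-- Each further factor is a convolution with coefficients at most Λ/log 2, apart from n^(-σ). Since
the sum of Λ(d) over d dividing n is log n, it costs exactly one factor log n / log 2. -/
theorem norm_prod_shiftedCoeff_le {ι : Type*} (S : Finset ι) (s : ι → ℂ) {σ : ℝ}
    (hs : ∀ j ∈ S, σ ≤ (s j).re) (n : ℕ) (hn : 1 ≤ n) :
    ‖(∏ j ∈ S, shiftedCoeff (s j)) n‖ ≤ (Real.log n / Real.log 2) ^ S.card * (n : ℝ) ^ (-σ) := by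
  classical
  induction S using Finset.induction_on generalizing n with
  | empty =>
    rw [Finset.prod_empty, ArithmeticFunction.one_apply]
    split_ifs with h
    · simp [h]
    · simp only [norm_zero]; positivity
  | insert j S hj ih =>
    have ih' := fun m hm => ih (fun i hi => hs i (Finset.mem_insert_of_mem hi)) m hm
    have hl2 : 0 < Real.log 2 := Real.log_pos one_lt_two
    rw [Finset.prod_insert hj, ArithmeticFunction.mul_apply, Finset.card_insert_of_notMem hj]
    have hterm : ∀ x ∈ n.divisorsAntidiagonal,
        ‖shiftedCoeff (s j) x.1 * (∏ j ∈ S, shiftedCoeff (s j)) x.2‖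
          ≤ ArithmeticFunction.vonMangoldt x.1 *
            ((Real.log n / Real.log 2) ^ S.card * (n : ℝ) ^ (-σ) / Real.log 2) := by
      intro x hx
      obtain ⟨hx1, hx2⟩ := Nat.mem_divisorsAntidiagonal.1 hx
      have p1 : 1 ≤ x.1 := Nat.one_le_iff_ne_zero.2 fun h => hx2 (by rw [← hx1, h, zero_mul])
      have p2 : 1 ≤ x.2 := Nat.one_le_iff_ne_zero.2 fun h => hx2 (by rw [← hx1, h, mul_zero])
      have hle : x.2 ≤ n := hx1 ▸ Nat.le_mul_of_pos_left _ p1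
      have hΛ : 0 ≤ ArithmeticFunction.vonMangoldt x.1 := ArithmeticFunction.vonMangoldt_nonneg
      have b1 : ‖shiftedCoeff (s j) x.1‖
          ≤ ArithmeticFunction.vonMangoldt x.1 / Real.log 2 * (x.1 : ℝ) ^ (-σ) := by
        rw [shiftedCoeff_apply, norm_mul, Complex.norm_of_nonneg (logCoeff_nonneg _),
          Complex.norm_natCast_cpow_of_pos (by omega)]
        refine mul_le_mul (logCoeff_le_vonMangoldt_div _) ?_ (by positivity) (by positivity)
        refine Real.rpow_le_rpow_of_exponent_le (by exact_mod_cast p1) ?_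
        simpa using hs j (Finset.mem_insert_self _ _)
      have b2 : (Real.log x.2 / Real.log 2) ^ S.card ≤ (Real.log n / Real.log 2) ^ S.card := by
        have : 0 ≤ Real.log x.2 := Real.log_natCast_nonneg _
        have : Real.log x.2 ≤ Real.log n :=
          Real.log_le_log (by exact_mod_cast p2) (by exact_mod_cast hle)
        gcongr
      have e : (n : ℝ) ^ (-σ) = (x.1 : ℝ) ^ (-σ) * (x.2 : ℝ) ^ (-σ) := by
        rw [← hx1, Nat.cast_mul, Real.mul_rpow (by positivity) (by positivity)]
      calc _ = ‖shiftedCoeff (s j) x.1‖ * ‖(∏ j ∈ S, shiftedCoeff (s j)) x.2‖ := norm_mul _ _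
        _ ≤ (ArithmeticFunction.vonMangoldt x.1 / Real.log 2 * (x.1 : ℝ) ^ (-σ)) *
            ((Real.log n / Real.log 2) ^ S.card * (x.2 : ℝ) ^ (-σ)) := by
          refine mul_le_mul b1 ((ih' _ p2).trans ?_) (norm_nonneg _) (by positivity)
          gcongr
        _ = _ := by rw [e]; ring
    refine (norm_sum_le _ _).trans ((Finset.sum_le_sum hterm).trans (le_of_eq ?_))
    rw [← Finset.sum_mul, Nat.sum_divisorsAntidiagonal
      (f := fun i _ => ArithmeticFunction.vonMangoldt i), ArithmeticFunction.vonMangoldt_sum]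
    ring

/-- Apply log n ≤ (k/ε) n^(ε/k) before taking the k-th power: the power of n becomes independent of
k, and the price is of the shape k^k, a small power of T for the admissible k. -/
theorem norm_prodCoeff_le {k : ℕ} (s : Fin k → ℂ) {σ ε : ℝ} (hε : 0 < ε)
    (hs : ∀ j, σ ≤ (s j).re) (n : ℕ) (hn : 1 ≤ n) :
    ‖prodCoeff s n‖ ≤ (k / (ε * Real.log 2)) ^ k * (n : ℝ) ^ (ε - σ) := by
  have h := norm_prod_shiftedCoeff_le Finset.univ s (fun j _ => hs j) n hn
  rw [Finset.card_univ, Fintype.card_fin] at h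
  have hn0 : (0 : ℝ) < n := by exact_mod_cast hn
  refine h.trans ?_
  rw [sub_eq_add_neg, Real.rpow_add hn0, ← mul_assoc]
  refine mul_le_mul_of_nonneg_right ?_ (by positivity)
  rcases Nat.eq_zero_or_pos k with rfl | hk
  · simpa using Real.one_le_rpow (by exact_mod_cast hn) hε.le
  · have hk0 : (0 : ℝ) < k := by exact_mod_cast hk
    have h1 := Real.log_le_rpow_div hn0.le (show 0 < ε / k by positivity)
    have hl2 : 0 < Real.log 2 := Real.log_pos one_lt_two
    have hl : 0 ≤ Real.log n := Real.log_natCast_nonneg _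
    calc (Real.log n / Real.log 2) ^ k ≤ ((n : ℝ) ^ (ε / k) / (ε / k) / Real.log 2) ^ k := by
          gcongr
      _ = (k / (ε * Real.log 2) * (n : ℝ) ^ (ε / k)) ^ k := by congr 1; field_simp
      _ = (k / (ε * Real.log 2)) ^ k * (n : ℝ) ^ ε := by
          rw [mul_pow, ← Real.rpow_natCast ((n : ℝ) ^ (ε / k)), ← Real.rpow_mul hn0.le,
            div_mul_cancel₀ _ hk0.ne']

/-- The smoothed product of logarithms on a vertical line is an absolutely convergent
Dirichlet series. -/
theorem hasSum_contourMean_LSeries {a : ℕ → ℂ} (ha0 : a 0 = 0)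
    (ha : Summable fun n => ‖a n‖ * (n : ℝ) ^ (-3 : ℝ)) {X H : ℝ} (hX : 0 < X) (t : ℝ) :
    HasSum (fun n => a n * smoothWeight X H n * natPow n t)
      (contourMean X H fun w => LSeries a (w + t * Complex.I)) := by
  have hterm : ∀ (n : ℕ) (w : ℂ), LSeries.term a (w + t * Complex.I) n
      = a n * natPow n t * (n : ℂ) ^ (-w) := by
    intro n w
    rcases eq_or_ne n 0 with rfl | hn
    · simp [ha0]
    · rw [LSeries.term_of_ne_zero hn, div_eq_mul_inv, ← Complex.cpow_neg,
        natCast_cpow_add_mul_I hn]; ring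
  have hnorm : ∀ (n : ℕ) (y : ℝ), ‖a n * natPow n t * (n : ℂ) ^ (-((3 : ℝ) + y * Complex.I : ℂ))‖
      ≤ ‖a n‖ * (n : ℝ) ^ (-3 : ℝ) := by
    intro n y
    rcases eq_or_ne n 0 with rfl | hn
    · simp [ha0]
    · rw [norm_mul, norm_mul, norm_natPow, mul_one,
        Complex.norm_natCast_cpow_of_pos (Nat.pos_of_ne_zero hn)]
      simp
  have hcont : Continuous fun y : ℝ => smoothKernel X ((3 : ℝ) + y * Complex.I) := by
    unfold smoothKernel
    refine Continuous.div ?_ (by fun_prop) fun y h => ?_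
    · exact (Continuous.const_cpow (by fun_prop) (Or.inl (by exact_mod_cast hX.ne'))).mul
        (by fun_prop)
    · have := congrArg Complex.re h
      simp at this
  have hsum := intervalIntegral.hasSum_integral_of_dominated_convergence (μ := volume)
    (a := -H) (b := H)
    (F := fun n (y : ℝ) => a n * natPow n t * (n : ℂ) ^ (-((3 : ℝ) + y * Complex.I : ℂ)) *
      smoothKernel X ((3 : ℝ) + y * Complex.I))
    (f := fun y : ℝ => LSeries a ((3 : ℝ) + y * Complex.I + t * Complex.I) *
      smoothKernel X ((3 : ℝ) + y * Complex.I))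
    (fun n y => ‖a n‖ * (n : ℝ) ^ (-3 : ℝ) * ‖smoothKernel X ((3 : ℝ) + y * Complex.I)‖)
    (fun n => ?_) (fun n => ae_of_all _ fun y _ => ?_) (ae_of_all _ fun y _ => ha.mul_right _) ?_
    (ae_of_all _ fun y _ => ?_)
  · have h2 := hsum.mul_left (1 / (2 * Real.pi) : ℂ)
    have e : ∀ n : ℕ, (1 / (2 * Real.pi) : ℂ) * ∫ y : ℝ in -H..H,
        a n * natPow n t * (n : ℂ) ^ (-((3 : ℝ) + y * Complex.I : ℂ)) *
          smoothKernel X ((3 : ℝ) + y * Complex.I) = a n * smoothWeight X H n * natPow n t := by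
      intro n
      simp_rw [mul_assoc (a n * natPow n t)]
      rw [intervalIntegral.integral_const_mul, smoothWeight, contourMean]
      ring
    simp_rw [e] at h2
    exact h2
  · rcases eq_or_ne n 0 with rfl | hn
    · simp only [ha0, zero_mul]; exact aestronglyMeasurable_const
    · refine Continuous.aestronglyMeasurable (Continuous.mul ?_ hcont)
      exact continuous_const.mul (Continuous.const_cpow (by fun_prop)
        (Or.inl (by exact_mod_cast hn)))
  · rw [norm_mul]
    exact mul_le_mul_of_nonneg_right (hnorm n y) (norm_nonneg _)
  · simp_rw [tsum_mul_right]
    exact (continuous_const.mul hcont.norm).intervalIntegrable _ _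
  · refine HasSum.mul_right _ ?_
    have : Summable fun n => LSeries.term a ((3 : ℝ) + y * Complex.I + t * Complex.I) n := by
      refine Summable.of_norm_bounded ha fun n => ?_
      rw [hterm]; exact hnorm n y
    refine this.hasSum.congr_fun fun n => ?_
    rw [hterm]

/-- The mean value of a product of absolutely convergent Dirichlet series. -/
theorem norm_integral_dirichlet_mul_conj_sub_le {α β : ℕ → ℂ} (hα0 : α 0 = 0) (hβ0 : β 0 = 0)
    (hα : Summable fun n : ℕ => (n : ℝ) * ‖α n‖)
    (hβ : Summable fun n : ℕ => (n : ℝ) * ‖β n‖)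
    (a b : ℝ) :
    ‖(∫ t in a..b, (∑' n, α n * natPow n t) * conj (∑' n, β n * natPow n t))
        - ((b - a : ℝ) : ℂ) * ∑' n, α n * conj (β n)‖
      ≤ 4 * (∑' n : ℕ, (n : ℝ) * ‖α n‖) * ∑' n : ℕ, (n : ℝ) * ‖β n‖ := by
  have key : ∀ γ : ℕ → ℂ, γ 0 = 0 → ∀ n, ‖γ n‖ ≤ (n : ℝ) * ‖γ n‖ := by
    intro γ h0 n
    rcases Nat.eq_zero_or_pos n with rfl | h
    · simp [h0]
    · exact le_mul_of_one_le_left (norm_nonneg _) (by exact_mod_cast h)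
  have hα' : Summable fun n => ‖α n‖ := hα.of_nonneg_of_le (fun _ => norm_nonneg _) (key α hα0)
  have hβ' : Summable fun n => ‖β n‖ := hβ.of_nonneg_of_le (fun _ => norm_nonneg _) (key β hβ0)
  have hαβ : Summable fun p : ℕ × ℕ => ‖α p.1‖ * ‖β p.2‖ :=
    hα'.mul_of_nonneg hβ' (fun _ => norm_nonneg _) (fun _ => norm_nonneg _)
  have hnorm : ∀ (p : ℕ × ℕ) (t : ℝ),
      ‖(α p.1 * natPow p.1 t) * conj (β p.2 * natPow p.2 t)‖ = ‖α p.1‖ * ‖β p.2‖ := by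
    intro p t
    rw [norm_mul, norm_mul, Complex.norm_conj, norm_mul, norm_natPow, norm_natPow, mul_one, mul_one]
  have hsum := intervalIntegral.hasSum_integral_of_dominated_convergence (μ := volume)
    (a := a) (b := b)
    (F := fun (p : ℕ × ℕ) (t : ℝ) => (α p.1 * natPow p.1 t) * conj (β p.2 * natPow p.2 t))
    (f := fun t : ℝ => (∑' n, α n * natPow n t) * conj (∑' n, β n * natPow n t))
    (fun p _ => ‖α p.1‖ * ‖β p.2‖)
    (fun p => by
      refine Continuous.aestronglyMeasurable ?_
      exact (continuous_const.mul (continuous_natPow _)).mul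
        (Complex.continuous_conj.comp (continuous_const.mul (continuous_natPow _))))
    (fun p => ae_of_all _ fun t _ => (hnorm p t).le) (ae_of_all _ fun t _ => hαβ)
    (continuous_const.intervalIntegrable _ _)
    (ae_of_all _ fun t _ => by
      have h1 : Summable fun n => ‖α n * natPow n t‖ := by
        simpa [norm_mul, norm_natPow] using hα'
      have h2 : Summable fun n => ‖conj (β n * natPow n t)‖ := by
        simpa [norm_mul, norm_natPow] using hβ'
      rw [Complex.conj_tsum, tsum_mul_tsum_of_summable_norm h1 h2]
      exact (summable_mul_of_summable_norm h1 h2).hasSum)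
  have hdiag : HasSum (fun p : ℕ × ℕ => if p.1 = p.2 then
      ((b - a : ℝ) : ℂ) * (α p.1 * conj (β p.2)) else 0)
      (((b - a : ℝ) : ℂ) * ∑' n, α n * conj (β n)) := by
    have hinj : Function.Injective fun n : ℕ => (n, n) := fun m n h => (Prod.ext_iff.1 h).1
    rw [← hinj.hasSum_iff]
    · have hs : Summable fun n => α n * conj (β n) := by
        refine Summable.of_norm ?_
        have := hαβ.comp_injective hinj
        simpa [Function.comp_def] using this
      simpa [Function.comp_def] using hs.hasSum.mul_left ((b - a : ℝ) : ℂ)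
    · rintro ⟨m, n⟩ h
      rw [if_neg]
      rintro (rfl : m = n)
      exact h ⟨m, rfl⟩
  have hsub := hsum.sub hdiag
  rw [← hsub.tsum_eq]
  have hbd : HasSum (fun p : ℕ × ℕ => 4 * (((p.1 : ℝ) * ‖α p.1‖) * ((p.2 : ℝ) * ‖β p.2‖)))
      (4 * (∑' n : ℕ, (n : ℝ) * ‖α n‖) * ∑' n : ℕ, (n : ℝ) * ‖β n‖) := by
    rw [mul_assoc]
    exact (hα.hasSum.mul hβ.hasSum (hα.mul_of_nonneg hβ (fun _ => by positivity)
      (fun _ => by positivity))).mul_left 4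
  refine tsum_of_norm_bounded hbd ?_
  rintro ⟨n, m⟩
  simp only
  rcases Nat.eq_zero_or_pos n with rfl | hn
  · simp [hα0]
  rcases Nat.eq_zero_or_pos m with rfl | hm
  · simp [hβ0]
  have e : ∀ t : ℝ, (α n * natPow n t) * conj (β m * natPow m t)
      = (α n * conj (β m)) * (natPow n t * conj (natPow m t)) := by
    intro t; rw [map_mul]; ring
  simp_rw [e]
  rw [intervalIntegral.integral_const_mul]
  split_ifs with h
  · subst h
    simp_rw [natPow_mul_conj_self]
    rw [intervalIntegral.integral_const, Complex.real_smul, mul_one, mul_comm, sub_self, norm_zero]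
    positivity
  · rw [sub_zero, norm_mul, norm_mul, Complex.norm_conj]
    have h1 := norm_integral_natPow_mul_conj_le hn.ne' hm.ne' h a b
    have hn1 : (1 : ℝ) ≤ n := by exact_mod_cast hn
    have hm1 : (1 : ℝ) ≤ m := by exact_mod_cast hm
    have h2 : 1 ≤ |(n : ℝ) - m| := by
      have : (1 : ℤ) ≤ |(n : ℤ) - m| := Int.one_le_abs (by omega)
      exact_mod_cast this
    have h3 : ((min n m : ℕ) : ℝ) / |(n : ℝ) - m| ≤ n :=
      (div_le_self (Nat.cast_nonneg _) h2).trans (by exact_mod_cast min_le_left _ _)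
    -- A crude bound, using only |n - m| ≥ 1, suffices because the series are short; it decouples
    -- the double sum into a product.
    have h4 : ‖∫ t in a..b, natPow n t * conj (natPow m t)‖ ≤ 4 * (n * m) := by
      refine h1.trans ?_
      nlinarith
    calc _ ≤ ‖α n‖ * ‖β m‖ * (4 * (n * m)) := by gcongr
      _ = _ := by ring


/-! ### Truncated Euler products as twisted Dirichlet series -/

/-- The primes less than `N`. -/
def primesLT (N : ℕ) : Finset Nat.Primes := (Finset.range N).subtype Nat.Prime

theorem mem_primesLT {N : ℕ} {p : Nat.Primes} : p ∈ primesLT N ↔ (p : ℕ) < N := by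
  exact Finset.mem_subtype.trans Finset.mem_range

theorem logEulerPartial_eq (s : ℂ) (x : Nat.Primes → ℂ) (N : ℕ) :
    logEulerPartial s x N = ∑ p ∈ primesLT N, -Complex.log (1 - x p / ((p : ℕ) : ℂ) ^ s) := rfl

/-- The completely multiplicative extension of a function on the primes. -/
noncomputable def eulerChar (x : Nat.Primes → ℂ) (n : ℕ) : ℂ :=
  ∏ p ∈ primesLT (n + 1), x p ^ n.factorization p

theorem eulerChar_eq_prod (x : Nat.Primes → ℂ) {n N : ℕ} (h : n < N) :
    eulerChar x n = ∏ p ∈ primesLT N, x p ^ n.factorization p := by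
  refine Finset.prod_subset ?_ fun p _ hp => ?_
  · intro p hp
    rw [mem_primesLT] at hp ⊢
    omega
  · rw [mem_primesLT] at hp
    rw [Nat.factorization_eq_zero_of_lt (by omega), pow_zero]

theorem eulerChar_mul (x : Nat.Primes → ℂ) {m n : ℕ} (hm : m ≠ 0) (hn : n ≠ 0) :
    eulerChar x (m * n) = eulerChar x m * eulerChar x n := by
  have h1 : m ≤ m * n := Nat.le_mul_of_pos_right _ (Nat.pos_of_ne_zero hn)
  have h2 : n ≤ m * n := Nat.le_mul_of_pos_left _ (Nat.pos_of_ne_zero hm)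
  rw [eulerChar_eq_prod x (Nat.lt_succ_self (m * n)), eulerChar_eq_prod x (Nat.lt_succ_of_le h1),
    eulerChar_eq_prod x (Nat.lt_succ_of_le h2), ← Finset.prod_mul_distrib]
  refine Finset.prod_congr rfl fun p _ => ?_
  rw [Nat.factorization_mul hm hn, Finsupp.add_apply, pow_add]

theorem eulerChar_one (x : Nat.Primes → ℂ) : eulerChar x 1 = 1 := by
  simp [eulerChar]

theorem eulerChar_mul_apply (x y : Nat.Primes → ℂ) (n : ℕ) :
    eulerChar (fun p => x p * y p) n = eulerChar x n * eulerChar y n := by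
  simp only [eulerChar, mul_pow, Finset.prod_mul_distrib]

theorem eulerChar_prime_pow (x : Nat.Primes → ℂ) (p : Nat.Primes) (k : ℕ) :
    eulerChar x ((p : ℕ) ^ (k + 1)) = x p ^ (k + 1) := by
  rw [eulerChar, Finset.prod_eq_single p]
  · simp [p.2.factorization_pow]
  · intro q _ hq
    have : (p : ℕ) ≠ q := fun h => hq (Subtype.ext h.symm)
    rw [p.2.factorization_pow, Finsupp.single_apply, if_neg this, pow_zero]
  · intro h
    exact absurd (by
      rw [mem_primesLT]
      have : (p : ℕ) ≤ (p : ℕ) ^ (k + 1) := Nat.le_self_pow (Nat.succ_ne_zero k) _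
      omega) h

theorem norm_eulerChar_le {x : Nat.Primes → ℂ} (hx : ∀ p, ‖x p‖ ≤ 1) (n : ℕ) :
    ‖eulerChar x n‖ ≤ 1 := by
  rw [eulerChar, norm_prod]
  refine Finset.prod_le_one (fun _ _ => norm_nonneg _) fun p _ => ?_
  rw [norm_pow]
  exact pow_le_one₀ (norm_nonneg _) (hx p)

/-- The restriction of a function on the primes to the primes below `N`. -/
noncomputable def truncPrimes (N : ℕ) (x : Nat.Primes → ℂ) (p : Nat.Primes) : ℂ :=
  if (p : ℕ) < N then x p else 0

/-- The indicator function of the integers all of whose prime factors are less than `N`. -/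
noncomputable def smoothInd (N n : ℕ) : ℂ := eulerChar (truncPrimes N fun _ => 1) n

theorem eulerChar_truncPrimes (N : ℕ) (x : Nat.Primes → ℂ) (n : ℕ) :
    eulerChar (truncPrimes N x) n = smoothInd N n * eulerChar x n := by
  rw [smoothInd, ← eulerChar_mul_apply]
  congr 1; ext p
  simp only [truncPrimes]; split_ifs <;> simp

open scoped Classical in
theorem smoothInd_eq (N n : ℕ) :
    smoothInd N n = if ∀ p : Nat.Primes, n.factorization p ≠ 0 → (p : ℕ) < N then 1 else 0 := by
  rw [smoothInd, eulerChar]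
  split_ifs with h
  · refine Finset.prod_eq_one fun p _ => ?_
    by_cases h0 : n.factorization p = 0
    · rw [h0, pow_zero]
    · simp [truncPrimes, h p h0]
  · push Not at h
    obtain ⟨p, hp, hpN⟩ := h
    refine Finset.prod_eq_zero (i := p) ?_ ?_
    · rw [mem_primesLT]
      by_contra hc
      exact hp (Nat.factorization_eq_zero_of_lt (by omega))
    · rw [truncPrimes, if_neg (by omega), zero_pow hp]

theorem smoothInd_eq_one_of_lt {N n : ℕ} (h : n < N) : smoothInd N n = 1 := by
  rw [smoothInd_eq, if_pos]
  intro p hp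
  by_contra hc
  exact hp (Nat.factorization_eq_zero_of_lt (by omega))

theorem smoothInd_eq_zero_or_one (N n : ℕ) : smoothInd N n = 0 ∨ smoothInd N n = 1 := by
  rw [smoothInd_eq]; split_ifs <;> simp

theorem smoothInd_mono {N M n : ℕ} (h : N ≤ M) (h1 : smoothInd N n = 1) : smoothInd M n = 1 := by
  rw [smoothInd_eq] at h1 ⊢
  split_ifs at h1 with h2
  · rw [if_pos fun p hp => (h2 p hp).trans_le h]
  · simp at h1

theorem norm_smoothInd_le (N n : ℕ) : ‖smoothInd N n‖ ≤ 1 := by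
  rcases smoothInd_eq_zero_or_one N n with h | h <;> simp [h]

theorem logCoeff_prime_pow {p : ℕ} (hp : p.Prime) (k : ℕ) :
    logCoeff (p ^ (k + 1)) = 1 / (k + 1) := by
  have h : Real.log p ≠ 0 := (Real.log_pos (by exact_mod_cast hp.one_lt)).ne'
  rw [logCoeff, ArithmeticFunction.vonMangoldt_apply_pow (Nat.succ_ne_zero k),
    ArithmeticFunction.vonMangoldt_apply_prime hp]
  push_cast
  rw [Real.log_pow]
  push_cast
  field_simp

theorem norm_div_prime_cpow_lt_one {s : ℂ} (hs : 0 < s.re) {z : ℂ} (hz : ‖z‖ ≤ 1)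
    (p : Nat.Primes) : ‖z / ((p : ℕ) : ℂ) ^ s‖ < 1 := by
  have h1 : 1 < ‖((p : ℕ) : ℂ) ^ s‖ := by
    rw [Complex.norm_natCast_cpow_of_pos p.2.pos]
    exact Real.one_lt_rpow (by exact_mod_cast p.2.one_lt) hs
  rw [norm_div, div_lt_one (by linarith)]
  linarith

/-- The truncated random Euler product has an absolutely convergent Dirichlet expansion. -/
theorem hasSum_shiftedCoeff_mul_eulerChar {s : ℂ} (hs : 0 < s.re) {x : Nat.Primes → ℂ}
    (hx : ∀ p, ‖x p‖ ≤ 1) (N : ℕ) :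
    HasSum (fun n => shiftedCoeff s n * eulerChar (truncPrimes N x) n)
      (logEulerPartial s x N) := by
  set f : ℕ → ℂ := fun n => shiftedCoeff s n * eulerChar (truncPrimes N x) n with hf
  -- Only powers of primes below N contribute: Λ removes the other integers and the truncated
  -- character removes the larger primes.
  have hsupp : ∀ n, f n ≠ 0 → ∃ (p : Nat.Primes) (k : ℕ), (p : ℕ) < N ∧ (p : ℕ) ^ (k + 1) = n := by
    intro n hn
    have h1 : ArithmeticFunction.vonMangoldt n ≠ 0 := by
      intro h
      apply hn
      simp [hf, shiftedCoeff_apply, logCoeff, h]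
    rw [ArithmeticFunction.vonMangoldt_ne_zero_iff, isPrimePow_nat_iff] at h1
    obtain ⟨p, k, hp, hk, rfl⟩ := h1
    obtain ⟨k, rfl⟩ := Nat.exists_eq_add_of_lt hk
    rw [zero_add] at hn ⊢
    refine ⟨⟨p, hp⟩, k, ?_, rfl⟩
    by_contra hc
    apply hn
    have := eulerChar_prime_pow (truncPrimes N x) ⟨p, hp⟩ k
    simp only [hf]
    have h0 : truncPrimes N x ⟨p, hp⟩ = 0 := if_neg hc
    rw [this, h0, zero_pow (Nat.succ_ne_zero k), mul_zero]
  -- The prime powers are grouped by their base, recovered as `minFac`; each group is the Taylor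
  -- series of -log(1 - x p / p^s).
  have hp : ∀ p ∈ primesLT N,
      HasSum (fun n : ℕ => if n.minFac = (p : ℕ) then f n else 0)
        (-Complex.log (1 - x p / ((p : ℕ) : ℂ) ^ s)) := by
    intro p hpN
    rw [mem_primesLT] at hpN
    have hinj : Function.Injective fun k : ℕ => (p : ℕ) ^ (k + 1) := fun a b h => by
      have := Nat.pow_right_injective p.2.two_le h
      omega
    rw [← hinj.hasSum_iff]
    · convert Complex.hasSum_taylorSeries_neg_log' (norm_div_prime_cpow_lt_one hs (hx p) p) using 1
      ext k
      simp only [Function.comp]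
      rw [if_pos (p.2.pow_minFac (Nat.succ_ne_zero k))]
      simp only [hf]
      rw [eulerChar_prime_pow, shiftedCoeff_apply, logCoeff_prime_pow p.2, truncPrimes, if_pos hpN,
        Complex.cpow_neg, Nat.cast_pow, ← Complex.natCast_cpow_natCast_mul, Complex.cpow_nat_mul,
        div_pow]
      push_cast
      ring
    · intro n hn
      by_cases h1 : n.minFac = p
      · rw [if_pos h1]
        by_contra h0
        obtain ⟨q, k, _, rfl⟩ := hsupp n h0
        rw [q.2.pow_minFac (Nat.succ_ne_zero k)] at h1
        exact hn ⟨k, by rw [← h1]⟩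
      · rw [if_neg h1]
  rw [logEulerPartial_eq]
  have h := hasSum_sum hp
  refine h.congr_fun fun n => ?_
  by_cases h0 : f n = 0
  · rw [h0]; simp
  · obtain ⟨q, k, hqN, rfl⟩ := hsupp n h0
    rw [Finset.sum_eq_single q]
    · rw [if_pos (q.2.pow_minFac (Nat.succ_ne_zero k))]
    · intro p _ hpq
      rw [if_neg]
      rw [q.2.pow_minFac (Nat.succ_ne_zero k)]
      exact fun h => hpq (Subtype.ext h.symm)
    · intro h
      exact absurd (mem_primesLT.2 hqN) h

/-- Twisting by a completely multiplicative function commutes with Dirichlet convolution, so the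
product follows by multiplying L-series at w = 0, which are absolutely convergent because only
finitely many primes occur. -/
theorem hasSum_prod_shiftedCoeff_mul_eulerChar {ι : Type*} (S : Finset ι) (s : ι → ℂ)
    (hs : ∀ j ∈ S, 0 < (s j).re) {x : Nat.Primes → ℂ} (hx : ∀ p, ‖x p‖ ≤ 1) (N : ℕ) :
    HasSum (fun n => (∏ j ∈ S, shiftedCoeff (s j)) n * eulerChar (truncPrimes N x) n)
      (∏ j ∈ S, logEulerPartial (s j) x N) := by
  classical
  set χ := eulerChar (truncPrimes N x) with hχ
  induction S using Finset.induction_on with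
  | empty =>
    simp only [Finset.prod_empty]
    convert hasSum_single (f := fun n => (1 : ArithmeticFunction ℂ) n * χ n) 1 fun n hn => ?_ using 1
    · simp [hχ, eulerChar_one]
    · simp [ArithmeticFunction.one_apply_ne hn]
  | insert j S hj ih =>
    have h2 := ih fun i hi => hs i (Finset.mem_insert_of_mem hi)
    have h1 := hasSum_shiftedCoeff_mul_eulerChar (hs j (Finset.mem_insert_self _ _)) hx N
    rw [Finset.prod_insert hj, Finset.prod_insert hj]
    set f := shiftedCoeff (s j)
    set g := ∏ j ∈ S, shiftedCoeff (s j)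
    let F : ArithmeticFunction ℂ := ⟨fun n => f n * χ n, by simp⟩
    let G : ArithmeticFunction ℂ := ⟨fun n => g n * χ n, by simp⟩
    have hterm : ∀ (A : ArithmeticFunction ℂ) (n : ℕ), LSeries.term A 0 n = A n := by
      intro A n
      rcases eq_or_ne n 0 with rfl | hn
      · simp
      · rw [LSeries.term_of_ne_zero hn, Complex.cpow_zero, div_one]
    have hF : LSeriesHasSum F 0 (logEulerPartial (s j) x N) :=
      h1.congr_fun fun n => hterm F n
    have hG : LSeriesHasSum G 0 (∏ i ∈ S, logEulerPartial (s i) x N) :=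
      h2.congr_fun fun n => hterm G n
    refine (ArithmeticFunction.LSeriesHasSum_mul hF hG).congr_fun fun n => ?_
    rw [hterm, ArithmeticFunction.mul_apply, ArithmeticFunction.mul_apply, Finset.sum_mul]
    refine Finset.sum_congr rfl fun y hy => ?_
    obtain ⟨hy1, hy2⟩ := Nat.mem_divisorsAntidiagonal.1 hy
    change f y.1 * g y.2 * χ n = f y.1 * χ y.1 * (g y.2 * χ y.2)
    rw [← hy1, hχ, eulerChar_mul _ (fun h => hy2 (by rw [← hy1, h, zero_mul]))
      (fun h => hy2 (by rw [← hy1, h, mul_zero]))]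
    ring

theorem hasSum_prodCoeff_mul_eulerChar {k : ℕ} {s : Fin k → ℂ} (hs : ∀ j, 0 < (s j).re)
    {x : Nat.Primes → ℂ} (hx : ∀ p, ‖x p‖ ≤ 1) (N : ℕ) :
    HasSum (fun n => prodCoeff s n * smoothInd N n * eulerChar x n)
      (∏ j, logEulerPartial (s j) x N) := by
  refine (hasSum_prod_shiftedCoeff_mul_eulerChar Finset.univ s (fun j _ => hs j) hx N).congr_fun
    fun n => ?_
  rw [eulerChar_truncPrimes, mul_assoc]; rfl

theorem summable_norm_prodCoeff_mul_smoothInd {k : ℕ} {s : Fin k → ℂ} (hs : ∀ j, 0 < (s j).re)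
    (N : ℕ) : Summable fun n => ‖prodCoeff s n * smoothInd N n‖ := by
  have h := (hasSum_prodCoeff_mul_eulerChar hs (x := fun _ => 1) (by simp) N).summable.norm
  refine h.congr fun n => ?_
  simp [eulerChar]

theorem conj_natCast_cpow_conj (n : ℕ) (s : ℂ) : conj ((n : ℂ) ^ conj s) = (n : ℂ) ^ s := by
  rw [← Complex.conj_cpow _ _ (by rw [Complex.natCast_arg]; exact Real.pi_ne_zero.symm),
    Complex.conj_natCast]

/-- The arguments of the logarithms have positive real part, away from the cut, so conjugation
passes through. -/
theorem logEulerPartial_conj {s : ℂ} (hs : 0 < s.re) {x : Nat.Primes → ℂ} (hx : ∀ p, ‖x p‖ ≤ 1)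
    (N : ℕ) :
    logEulerPartial s (fun p => conj (x p)) N = conj (logEulerPartial (conj s) x N) := by
  simp only [logEulerPartial_eq, map_sum, map_neg]
  refine Finset.sum_congr rfl fun p _ => ?_
  have h := norm_div_prime_cpow_lt_one (s := conj s) (by simpa using hs) (hx p) p
  rw [← Complex.log_conj]
  · congr 3
    rw [map_sub, map_one, map_div₀, conj_natCast_cpow_conj]
  · intro h1
    rw [Complex.arg_eq_pi_iff] at h1
    have := (Complex.re_le_norm (x p / ((p : ℕ) : ℂ) ^ conj s)).trans_lt h
    have h2 := h1.1
    simp only [Complex.sub_re, Complex.one_re] at h2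
    linarith


/-! ### Orthogonality of Steinhaus characters and second moments -/

theorem measurable_circleMap_zero_one : Measurable (circleMap 0 1) :=
  (continuous_circleMap 0 1).measurable

theorem ae_uniformCircle_norm_eq_one : ∀ᵐ z ∂uniformCircle, ‖z‖ = 1 := by
  rw [uniformCircle, ae_map_iff measurable_circleMap_zero_one.aemeasurable
    (measurableSet_eq_fun measurable_norm measurable_const)]
  exact ae_of_all _ fun θ => by simp

theorem integral_uniformCircle_pow_mul_conj_pow (a b : ℕ) :
    ∫ z, z ^ a * conj (z ^ b) ∂uniformCircle = if a = b then 1 else 0 := by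
  have hpi : (0 : ℝ) < 2 * Real.pi := by positivity
  have e : ∀ θ : ℝ, circleMap 0 1 θ ^ a * conj (circleMap 0 1 θ ^ b)
      = Complex.exp ((((a : ℂ) - b) * Complex.I) * θ) := by
    intro θ
    simp only [circleMap, zero_add, Complex.ofReal_one, one_mul]
    rw [← Complex.exp_nat_mul, ← Complex.exp_nat_mul, ← Complex.exp_conj, ← Complex.exp_add]
    congr 1
    simp; ring
  rw [uniformCircle, integral_map measurable_circleMap_zero_one.aemeasurable
    (by fun_prop), integral_smul_measure, ← intervalIntegral.integral_of_le hpi.le]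
  simp_rw [e]
  rw [ENNReal.toReal_inv, ENNReal.toReal_ofReal hpi.le]
  split_ifs with h
  · subst h
    simp only [sub_self, zero_mul, Complex.exp_zero, intervalIntegral.integral_const, sub_zero]
    rw [smul_smul, inv_mul_cancel₀ hpi.ne', one_smul]
  · have hne : ((a : ℂ) - b) * Complex.I ≠ 0 :=
      mul_ne_zero (sub_ne_zero.2 (by exact_mod_cast h)) Complex.I_ne_zero
    rw [integral_exp_mul_complex hne]
    have h1 : Complex.exp (((a : ℂ) - b) * Complex.I * ((2 * Real.pi : ℝ) : ℂ)) = 1 := by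
      rw [Complex.exp_eq_one_iff]
      exact ⟨(a : ℤ) - b, by push_cast; ring⟩
    rw [h1]; simp

namespace IsSteinhausFamily

variable {Ω : Type*} [MeasurableSpace Ω] {P : Measure Ω}
  {X : Nat.Primes → Ω → ℂ}

theorem ae_norm_eq_one (hX : IsSteinhausFamily P X) : ∀ᵐ ω ∂P, ∀ p, ‖X p ω‖ = 1 := by
  rw [ae_all_iff]
  intro p
  have h := ae_uniformCircle_norm_eq_one
  rw [← hX.map_eq p, ae_map_iff (hX.measurable p).aemeasurable
    (measurableSet_eq_fun measurable_norm measurable_const)] at h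
  exact h

theorem measurable_eulerChar (hX : IsSteinhausFamily P X) (n : ℕ) :
    Measurable fun ω => eulerChar (fun p => X p ω) n :=
  Finset.measurable_prod _ fun p _ => (hX.measurable p).pow_const _

theorem measurable_logEulerPartial (hX : IsSteinhausFamily P X) (s : ℂ) (N : ℕ) :
    Measurable fun ω => logEulerPartial s (fun p => X p ω) N := by
  simp only [logEulerPartial_eq]
  refine Finset.measurable_fun_sum _ fun p _ => ?_
  have := hX.measurable p
  fun_prop

theorem measurable_prod_logEulerPartial (hX : IsSteinhausFamily P X) {k : ℕ} (s : Fin k → ℂ)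
    (N : ℕ) : Measurable fun ω => ∏ j, logEulerPartial (s j) (fun p => X p ω) N :=
  Finset.measurable_fun_prod _ fun _ _ => hX.measurable_logEulerPartial _ N

theorem eLpNorm_two_of_integral {f : Ω → ℂ} (hf : MemLp f 2 P) {c : ℝ}
    (h : ∫ ω, f ω * conj (f ω) ∂P = c) : eLpNorm f 2 P = ENNReal.ofReal (Real.sqrt c) := by
  rw [hf.eLpNorm_eq_integral_rpow_norm (by norm_num) (by norm_num)]
  have e : ∫ ω, ‖f ω‖ ^ (2 : ENNReal).toReal ∂P = c := by
    have h1 : ∀ ω, f ω * conj (f ω) = ((‖f ω‖ ^ (2 : ENNReal).toReal : ℝ) : ℂ) := by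
      intro ω
      rw [Complex.mul_conj, Complex.normSq_eq_norm_sq]
      norm_num
    simp_rw [h1] at h
    rw [integral_complex_ofReal] at h
    exact_mod_cast h
  rw [e, Real.sqrt_eq_rpow]
  norm_num

theorem ae_hasSum_prod_logEulerPartial (hX : IsSteinhausFamily P X) {k : ℕ} {s : Fin k → ℂ}
    (hs : ∀ j, 0 < (s j).re) (N : ℕ) :
    ∀ᵐ ω ∂P, HasSum (fun n => prodCoeff s n * smoothInd N n * eulerChar (fun p => X p ω) n)
      (∏ j, logEulerPartial (s j) (fun p => X p ω) N) := by
  filter_upwards [hX.ae_norm_eq_one] with ω hω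
  exact hasSum_prodCoeff_mul_eulerChar hs (fun p => (hω p).le) N

/-- Independence splits the expectation over the primes below m + n + 1, which include all prime
factors of both integers. Each factor tests equality of two exponents, and unique factorisation
concludes. -/
theorem integral_eulerChar_mul_conj (hX : IsSteinhausFamily P X) {m n : ℕ} (hm : m ≠ 0)
    (hn : n ≠ 0) :
    ∫ ω, eulerChar (fun p => X p ω) m * conj (eulerChar (fun p => X p ω) n) ∂P
      = if m = n then 1 else 0 := by
  let φ : primesLT (m + n + 1) → ℂ → ℂ := fun q z =>
    z ^ m.factorization (q : Nat.Primes) * conj (z ^ n.factorization (q : Nat.Primes))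
  have hφ : ∀ q, Continuous (φ q) := fun q =>
    (continuous_pow _).mul (Complex.continuous_conj.comp (continuous_pow _))
  have e : ∀ ω, eulerChar (fun p => X p ω) m * conj (eulerChar (fun p => X p ω) n)
      = ∏ p : primesLT (m + n + 1), φ p (X p ω) := by
    intro ω
    rw [eulerChar_eq_prod _ (show m < m + n + 1 by omega),
      eulerChar_eq_prod _ (show n < m + n + 1 by omega), map_prod, ← Finset.prod_mul_distrib,
      ← Finset.prod_coe_sort]
  have hind : iIndepFun (fun p : primesLT (m + n + 1) => X p) P :=
    hX.indep.precomp Subtype.val_injective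
  refine (integral_congr_ae (ae_of_all _ e)).trans ((hind.integral_fun_prod_comp (f := φ)
    (fun p => (hX.measurable p).aemeasurable)
    (fun p => (hφ p).aestronglyMeasurable)).trans ?_)
  have h1 : ∀ p : primesLT (m + n + 1), ∫ ω, X p ω ^ m.factorization (p : Nat.Primes) *
      conj (X p ω ^ n.factorization (p : Nat.Primes)) ∂P
        = if m.factorization (p : Nat.Primes) = n.factorization (p : Nat.Primes)
          then 1 else 0 := by
    intro p
    rw [← integral_uniformCircle_pow_mul_conj_pow, ← hX.map_eq p,
      integral_map (hX.measurable p).aemeasurable (by fun_prop)]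
  refine (Finset.prod_congr rfl fun p _ => h1 p).trans ?_
  split_ifs with h
  · subst h; simp
  · by_contra hc
    have hall := Finset.prod_ne_zero_iff.1 hc
    apply h
    refine Nat.eq_of_factorization_eq hm hn fun q => ?_
    by_cases hq : q.Prime
    · by_cases hq2 : q < m + n + 1
      · have := hall ⟨⟨q, hq⟩, mem_primesLT.2 hq2⟩ (Finset.mem_univ _)
        by_contra hne
        exact this (if_neg hne)
      · rw [Nat.factorization_eq_zero_of_lt (by omega), Nat.factorization_eq_zero_of_lt (by omega)]
    · rw [Nat.factorization_eq_zero_of_not_prime _ hq, Nat.factorization_eq_zero_of_not_prime _ hq]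

variable [IsProbabilityMeasure P]

/-- The second moment of absolutely convergent random Dirichlet series. -/
theorem integral_mul_conj_of_hasSum (hX : IsSteinhausFamily P X) {c d : ℕ → ℂ} (hc0 : c 0 = 0)
    (hd0 : d 0 = 0) (hc : Summable fun n => ‖c n‖) (hd : Summable fun n => ‖d n‖) {A B : Ω → ℂ}
    (hA : ∀ᵐ ω ∂P, HasSum (fun n => c n * eulerChar (fun p => X p ω) n) (A ω))
    (hB : ∀ᵐ ω ∂P, HasSum (fun n => d n * eulerChar (fun p => X p ω) n) (B ω)) :
    ∫ ω, A ω * conj (B ω) ∂P = ∑' n, c n * conj (d n) := by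
  have hcd : Summable fun p : ℕ × ℕ => ‖c p.1‖ * ‖d p.2‖ :=
    hc.mul_of_nonneg hd (fun _ => norm_nonneg _) (fun _ => norm_nonneg _)
  have hle : ∀ (e : ℂ) {ω : Ω} (_ : ∀ p, ‖X p ω‖ = 1) (n : ℕ),
      ‖e * eulerChar (fun p => X p ω) n‖ ≤ ‖e‖ := by
    intro e ω hω n
    rw [norm_mul]
    exact mul_le_of_le_one_right (norm_nonneg _) (norm_eulerChar_le (fun p => (hω p).le) n)
  have hsum := hasSum_integral_of_dominated_convergence (μ := P)
    (F := fun (p : ℕ × ℕ) ω => (c p.1 * eulerChar (fun q => X q ω) p.1) *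
      conj (d p.2 * eulerChar (fun q => X q ω) p.2))
    (f := fun ω => A ω * conj (B ω)) (fun p _ => ‖c p.1‖ * ‖d p.2‖)
    (fun p => by
      have h1 := hX.measurable_eulerChar p.1
      have h2 := hX.measurable_eulerChar p.2
      exact ((h1.const_mul _).mul (Complex.continuous_conj.measurable.comp
        (h2.const_mul _))).aestronglyMeasurable)
    (fun p => by
      filter_upwards [hX.ae_norm_eq_one] with ω hω
      rw [norm_mul, Complex.norm_conj]
      exact mul_le_mul (hle _ hω _) (hle _ hω _) (norm_nonneg _) (norm_nonneg _))
    (ae_of_all _ fun ω => hcd) (integrable_const _)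
    (by
      filter_upwards [hX.ae_norm_eq_one, hA, hB] with ω hω hAω hBω
      have h1 : Summable fun n => ‖c n * eulerChar (fun q => X q ω) n‖ :=
        hc.of_nonneg_of_le (fun _ => norm_nonneg _) (fun n => hle _ hω n)
      have h2 : Summable fun n => ‖conj (d n * eulerChar (fun q => X q ω) n)‖ := by
        simp_rw [Complex.norm_conj]
        exact hd.of_nonneg_of_le (fun _ => norm_nonneg _) (fun n => hle _ hω n)
      rw [← hAω.tsum_eq, ← hBω.tsum_eq, Complex.conj_tsum, tsum_mul_tsum_of_summable_norm h1 h2]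
      exact (summable_mul_of_summable_norm h1 h2).hasSum)
  rw [← hsum.tsum_eq]
  have e : ∀ p : ℕ × ℕ, ∫ ω, (c p.1 * eulerChar (fun q => X q ω) p.1) *
      conj (d p.2 * eulerChar (fun q => X q ω) p.2) ∂P
        = if p.1 = p.2 then c p.1 * conj (d p.2) else 0 := by
    rintro ⟨m, n⟩
    simp only
    rcases eq_or_ne m 0 with rfl | hm
    · simp [hc0]
    rcases eq_or_ne n 0 with rfl | hn
    · simp [hd0]
    have e1 : ∀ ω, (c m * eulerChar (fun q => X q ω) m) * conj (d n * eulerChar (fun q => X q ω) n)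
        = (c m * conj (d n)) *
          (eulerChar (fun q => X q ω) m * conj (eulerChar (fun q => X q ω) n)) := by
      intro ω; rw [map_mul]; ring
    simp_rw [e1]
    rw [integral_const_mul, hX.integral_eulerChar_mul_conj hm hn]
    split_ifs <;> simp
  simp_rw [e]
  have hinj : Function.Injective fun n : ℕ => (n, n) := fun m n h => (Prod.ext_iff.1 h).1
  rw [← hinj.tsum_eq]
  · simp
  · rintro ⟨m, n⟩ h
    by_cases hmn : m = n
    · subst hmn; exact ⟨m, rfl⟩
    · simp [hmn] at h

theorem integral_prod_logEulerPartial (hX : IsSteinhausFamily P X) {k l : ℕ} {s : Fin k → ℂ}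
    {r : Fin l → ℂ} (hs : ∀ j, 0 < (s j).re) (hr : ∀ j, 0 < (r j).re) (N : ℕ) :
    ∫ ω, (∏ j, logEulerPartial (s j) (fun p => X p ω) N) *
        conj (∏ j, logEulerPartial (r j) (fun p => X p ω) N) ∂P
      = ∑' n, (prodCoeff s n * smoothInd N n) * conj (prodCoeff r n * smoothInd N n) :=
  hX.integral_mul_conj_of_hasSum (by simp) (by simp) (summable_norm_prodCoeff_mul_smoothInd hs N)
    (summable_norm_prodCoeff_mul_smoothInd hr N) (hX.ae_hasSum_prod_logEulerPartial hs N)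
    (hX.ae_hasSum_prod_logEulerPartial hr N)

theorem memLp_prod_logEulerPartial (hX : IsSteinhausFamily P X) {k : ℕ} {s : Fin k → ℂ}
    (hs : ∀ j, 0 < (s j).re) (N : ℕ) :
    MemLp (fun ω => ∏ j, logEulerPartial (s j) (fun p => X p ω) N) 2 P := by
  refine MemLp.of_bound (hX.measurable_prod_logEulerPartial s N).aestronglyMeasurable
    (∑' n, ‖prodCoeff s n * smoothInd N n‖) ?_
  filter_upwards [hX.ae_norm_eq_one, hX.ae_hasSum_prod_logEulerPartial hs N] with ω hω h
  rw [← h.tsum_eq]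
  refine tsum_of_norm_bounded (summable_norm_prodCoeff_mul_smoothInd hs N).hasSum fun n => ?_
  rw [norm_mul _ (eulerChar _ _)]
  exact mul_le_of_le_one_right (norm_nonneg _) (norm_eulerChar_le (fun p => (hω p).le) n)

/-- The tail of the coefficients that controls the convergence of the truncated products. -/
noncomputable def _root_.smoothTail {k : ℕ} (s : Fin k → ℂ) (N : ℕ) : ℝ :=
  ∑' n, ‖prodCoeff s n‖ ^ 2 * ‖1 - smoothInd N n‖ ^ 2

/-- The difference has coefficients supported on integers with all prime factors below M but not all
below N. The bound does not depend on M, so that Fatou's lemma can send M to infinity. -/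
theorem eLpNorm_sub_logEulerPartial_le (hX : IsSteinhausFamily P X) {k : ℕ} {s : Fin k → ℂ}
    (hs : ∀ j, 0 < (s j).re) (ha : Summable fun n => ‖prodCoeff s n‖ ^ 2) {N M : ℕ} (h : N ≤ M) :
    eLpNorm (fun ω => (∏ j, logEulerPartial (s j) (fun p => X p ω) M) -
        ∏ j, logEulerPartial (s j) (fun p => X p ω) N) 2 P
      ≤ ENNReal.ofReal (Real.sqrt (smoothTail s N)) := by
  have hint := hX.integral_mul_conj_of_hasSum
    (c := fun n => prodCoeff s n * smoothInd M n - prodCoeff s n * smoothInd N n)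
    (d := fun n => prodCoeff s n * smoothInd M n - prodCoeff s n * smoothInd N n)
    (A := fun ω => (∏ j, logEulerPartial (s j) (fun p => X p ω) M) -
        ∏ j, logEulerPartial (s j) (fun p => X p ω) N)
    (B := fun ω => (∏ j, logEulerPartial (s j) (fun p => X p ω) M) -
        ∏ j, logEulerPartial (s j) (fun p => X p ω) N) (by simp) (by simp)
    (((summable_norm_prodCoeff_mul_smoothInd hs M).of_norm.sub
      (summable_norm_prodCoeff_mul_smoothInd hs N).of_norm).norm)
    (((summable_norm_prodCoeff_mul_smoothInd hs M).of_norm.sub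
      (summable_norm_prodCoeff_mul_smoothInd hs N).of_norm).norm)
    (by
      filter_upwards [hX.ae_hasSum_prod_logEulerPartial hs M,
        hX.ae_hasSum_prod_logEulerPartial hs N] with ω h1 h2
      simpa only [sub_mul] using h1.sub h2)
    (by
      filter_upwards [hX.ae_hasSum_prod_logEulerPartial hs M,
        hX.ae_hasSum_prod_logEulerPartial hs N] with ω h1 h2
      simpa only [sub_mul] using h1.sub h2)
  have e : ∀ n, (prodCoeff s n * smoothInd M n - prodCoeff s n * smoothInd N n) *
      conj (prodCoeff s n * smoothInd M n - prodCoeff s n * smoothInd N n)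
        = ((‖prodCoeff s n‖ ^ 2 * ‖smoothInd M n - smoothInd N n‖ ^ 2 : ℝ) : ℂ) := by
    intro n
    rw [← mul_sub, Complex.mul_conj, Complex.normSq_eq_norm_sq, norm_mul, mul_pow]
  simp_rw [e] at hint
  rw [← Complex.ofReal_tsum] at hint
  have hmem : MemLp (fun ω => (∏ j, logEulerPartial (s j) (fun p => X p ω) M) -
      ∏ j, logEulerPartial (s j) (fun p => X p ω) N) 2 P :=
    (hX.memLp_prod_logEulerPartial hs M).sub (hX.memLp_prod_logEulerPartial hs N)
  refine (eLpNorm_two_of_integral hmem hint).le.trans ?_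
  refine ENNReal.ofReal_le_ofReal (Real.sqrt_le_sqrt ?_)
  have hle : ∀ n, ‖smoothInd M n - smoothInd N n‖ ^ 2 ≤ ‖1 - smoothInd N n‖ ^ 2 ∧
      ‖1 - smoothInd N n‖ ^ 2 ≤ 1 := by
    intro n
    rcases smoothInd_eq_zero_or_one N n with h0 | h1
    · rcases smoothInd_eq_zero_or_one M n with h2 | h2 <;> simp [h0, h2]
    · simp [h1, smoothInd_mono h h1]
  have hs2 : Summable fun n => ‖prodCoeff s n‖ ^ 2 * ‖1 - smoothInd N n‖ ^ 2 :=
    ha.of_nonneg_of_le (fun _ => by positivity) fun n =>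
      mul_le_of_le_one_right (by positivity) (hle n).2
  refine Summable.tsum_le_tsum (fun n => mul_le_mul_of_nonneg_left (hle n).1 (by positivity)) ?_ hs2
  exact hs2.of_nonneg_of_le (fun _ => by positivity)
    fun n => mul_le_mul_of_nonneg_left (hle n).1 (by positivity)

/-- Dominated convergence: every prime factor of n is below N as soon as N > n. -/
theorem _root_.tendsto_smoothTail {k : ℕ} {s : Fin k → ℂ}
    (ha : Summable fun n => ‖prodCoeff s n‖ ^ 2) :
    Tendsto (smoothTail s) atTop (𝓝 0) := by
  have h := tendsto_tsum_of_dominated_convergence (𝓕 := atTop)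
    (f := fun (N : ℕ) n => ‖prodCoeff s n‖ ^ 2 * ‖1 - smoothInd N n‖ ^ 2) (g := fun _ => 0) ha
    (fun n => by
      refine tendsto_const_nhds.congr' ?_
      filter_upwards [eventually_gt_atTop n] with N hN
      simp [smoothInd_eq_one_of_lt hN])
    (Eventually.of_forall fun N n => by
      rcases smoothInd_eq_zero_or_one N n with h | h <;> simp [h])
  rw [tsum_zero] at h
  exact h

end IsSteinhausFamily


/-! ### Almost sure and L² convergence of the random logarithms; mixed moments -/

theorem summable_norm_prodCoeff_sq {k : ℕ} {s : Fin k → ℂ} {σ : ℝ} (hσ : 1 / 2 < σ)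
    (hs : ∀ j, σ ≤ (s j).re) : Summable fun n => ‖prodCoeff s n‖ ^ 2 := by
  set ε : ℝ := (σ - 1 / 2) / 2 with hε
  have hε0 : 0 < ε := by rw [hε]; linarith
  have h1 : Summable fun n : ℕ => ((k / (ε * Real.log 2)) ^ k) ^ 2 * (n : ℝ) ^ (2 * (ε - σ)) :=
    (Real.summable_nat_rpow.2 (by rw [hε]; linarith)).mul_left _
  refine h1.of_nonneg_of_le (fun _ => sq_nonneg _) fun n => ?_
  rcases Nat.eq_zero_or_pos n with rfl | hn
  · rw [ArithmeticFunction.map_zero, norm_zero, zero_pow two_ne_zero]; positivity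
  · have h := norm_prodCoeff_le s hε0 hs n hn
    calc ‖prodCoeff s n‖ ^ 2 ≤ ((k / (ε * Real.log 2)) ^ k * (n : ℝ) ^ (ε - σ)) ^ 2 := by gcongr
      _ = _ := by rw [mul_pow, rpow_sq (by positivity)]

theorem prodCoeff_fin_one (z : ℂ) : prodCoeff (fun _ : Fin 1 => z) = shiftedCoeff z := by
  simp [prodCoeff]

/-- Continuity of the inner product of L². -/
theorem tendsto_integral_mul_conj {Ω : Type*} [MeasurableSpace Ω] {P : Measure Ω}
    {F G : ℕ → Ω → ℂ} {f g : Ω → ℂ} (hF : ∀ n, MemLp (F n) 2 P) (hG : ∀ n, MemLp (G n) 2 P)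
    (hf : MemLp f 2 P) (hg : MemLp g 2 P)
    (hFf : Tendsto (fun n => eLpNorm (F n - f) 2 P) atTop (𝓝 0))
    (hGg : Tendsto (fun n => eLpNorm (G n - g) 2 P) atTop (𝓝 0)) :
    Tendsto (fun n => ∫ ω, F n ω * conj (G n ω) ∂P) atTop (𝓝 (∫ ω, f ω * conj (g ω) ∂P)) := by
  have h1 := (Lp.tendsto_Lp_iff_tendsto_eLpNorm'' F hF f hf).2 hFf
  have h2 := (Lp.tendsto_Lp_iff_tendsto_eLpNorm'' G hG g hg).2 hGg
  have e : ∀ {u v : Ω → ℂ} (hu : MemLp u 2 P) (hv : MemLp v 2 P),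
      inner ℂ (hv.toLp v) (hu.toLp u) = ∫ ω, u ω * conj (v ω) ∂P := by
    intro u v hu hv
    rw [L2.inner_def]
    refine integral_congr_ae ?_
    filter_upwards [hu.coeFn_toLp, hv.coeFn_toLp] with ω h3 h4
    rw [h3, h4, RCLike.inner_apply]
  have h3 := h2.inner (𝕜 := ℂ) h1
  simpa only [e] using h3

namespace IsSteinhausFamily

variable {Ω : Type*} [MeasurableSpace Ω] {P : Measure Ω}
  {X : Nat.Primes → Ω → ℂ}

/-- The filtration generated by the variables at the primes less than `N`. -/
noncomputable def filtration (hX : IsSteinhausFamily P X) : Filtration ℕ ‹MeasurableSpace Ω› where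
  seq N := ⨆ p ∈ {p : Nat.Primes | (p : ℕ) < N}, MeasurableSpace.comap (X p) inferInstance
  mono' _ M h := iSup₂_le fun p hp =>
    le_iSup₂_of_le (f := fun (p : Nat.Primes) (_ : p ∈ {p : Nat.Primes | (p : ℕ) < M}) =>
      MeasurableSpace.comap (X p) inferInstance) p (lt_of_lt_of_le hp h) le_rfl
  le' _ := iSup₂_le fun p _ => (hX.measurable p).comap_le

theorem logEulerPartial_succ_of_prime (s : ℂ) (x : Nat.Primes → ℂ) (p : Nat.Primes) :
    logEulerPartial s x (p + 1)
      = logEulerPartial s x p + -Complex.log (1 - x p / ((p : ℕ) : ℂ) ^ s) := by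
  classical
  have h : primesLT (p + 1) = insert p (primesLT p) := by
    ext q
    rw [Finset.mem_insert, mem_primesLT, mem_primesLT, Nat.lt_succ_iff_lt_or_eq, or_comm]
    exact or_congr_left ⟨fun h => Subtype.ext h, fun h => by rw [h]⟩
  rw [logEulerPartial_eq, logEulerPartial_eq, h, Finset.sum_insert (by rw [mem_primesLT]; omega),
    add_comm]

theorem logEulerPartial_succ_of_not_prime (s : ℂ) (x : Nat.Primes → ℂ) {N : ℕ} (hN : ¬N.Prime) :
    logEulerPartial s x (N + 1) = logEulerPartial s x N := by
  have h : primesLT (N + 1) = primesLT N := by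
    ext q
    rw [mem_primesLT, mem_primesLT, Nat.lt_succ_iff_lt_or_eq]
    exact or_iff_left fun h => hN (h ▸ q.2)
  rw [logEulerPartial_eq, logEulerPartial_eq, h]

variable [IsProbabilityMeasure P]

theorem integrable_logEulerPartial (hX : IsSteinhausFamily P X) {s : ℂ} (hs : 0 < s.re) (N : ℕ) :
    Integrable (fun ω => logEulerPartial s (fun p => X p ω) N) P := by
  have h := hX.memLp_prod_logEulerPartial (s := fun _ : Fin 1 => s) (fun _ => hs) N
  simp only [Finset.univ_unique, Finset.prod_singleton] at h
  exact h.integrable (by norm_num)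

/-- The mean is the moment against the empty product, whose only coefficient sits at n = 1, where
Λ(n)/log n vanishes. -/
theorem integral_logEulerPartial (hX : IsSteinhausFamily P X) {s : ℂ} (hs : 0 < s.re) (N : ℕ) :
    ∫ ω, logEulerPartial s (fun p => X p ω) N ∂P = 0 := by
  have h := hX.integral_prod_logEulerPartial (s := fun _ : Fin 1 => s) (r := Fin.elim0)
    (fun _ => hs) (fun j => j.elim0) N
  rw [prodCoeff_fin_one] at h
  simp only [Finset.univ_unique, Finset.prod_singleton, Finset.univ_eq_empty, Finset.prod_empty,
    map_one, mul_one] at h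
  rw [h, tsum_eq_single 1]
  · simp [shiftedCoeff_apply, logCoeff_one]
  · intro n hn
    simp [prodCoeff, ArithmeticFunction.one_apply_ne hn]

theorem eLpNorm_logEulerPartial_le (hX : IsSteinhausFamily P X) {s : ℂ} (hs : 1 / 2 < s.re)
    (N : ℕ) : eLpNorm (fun ω => logEulerPartial s (fun p => X p ω) N) 2 P
      ≤ ENNReal.ofReal (Real.sqrt (smoothTail (fun _ : Fin 1 => s) 0)) := by
  have h := hX.eLpNorm_sub_logEulerPartial_le (s := fun _ : Fin 1 => s) (fun _ => by linarith)
    (summable_norm_prodCoeff_sq hs fun _ => le_rfl) (Nat.zero_le N)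
  simp only [Finset.univ_unique, Finset.prod_singleton] at h
  have e : ∀ x, logEulerPartial s x 0 = 0 := fun x => by
    rw [logEulerPartial_eq]
    exact Finset.sum_eq_zero fun p hp => absurd (mem_primesLT.1 hp) (Nat.not_lt_zero _)
  simpa only [e, sub_zero] using h

/-- The increment at a prime is a function of the variable at that prime alone, hence independent of
the past, and it has mean zero; at other integers there is no increment. The functional g stands for
the real or the imaginary part. -/
theorem martingale_logEulerPartial (hX : IsSteinhausFamily P X) {s : ℂ} (hs : 0 < s.re)
    (g : ℂ →L[ℝ] ℝ) :
    Martingale (fun N ω => g (logEulerPartial s (fun p => X p ω) N)) hX.filtration P := by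
  have hint : ∀ N, Integrable (fun ω => g (logEulerPartial s (fun p => X p ω) N)) P := fun N =>
    g.integrable_comp (hX.integrable_logEulerPartial hs N)
  refine martingale_of_condExp_sub_eq_zero_nat (fun N => ?_) hint fun N => ?_
  · refine Measurable.stronglyMeasurable ?_
    refine g.continuous.measurable.comp ?_
    simp only [logEulerPartial_eq]
    refine Finset.measurable_fun_sum _ fun p hp => ?_
    have h1 : Measurable[hX.filtration N] (X p) :=
      (comap_measurable (X p)).mono (le_iSup₂_of_le
        (f := fun (p : Nat.Primes) (_ : p ∈ {p : Nat.Primes | (p : ℕ) < N}) =>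
          MeasurableSpace.comap (X p) inferInstance) p (mem_primesLT.1 hp) le_rfl) le_rfl
    exact ((measurable_const.sub (h1.div_const _)).clog).neg
  · by_cases hN : N.Prime
    · set p : Nat.Primes := ⟨N, hN⟩ with hp
      set h : ℂ → ℝ := fun z => g (-Complex.log (1 - z / ((p : ℕ) : ℂ) ^ s)) with hh
      have hm : Measurable h := by
        refine g.continuous.measurable.comp ?_
        exact ((measurable_const.sub (measurable_id.div_const _)).clog).neg
      have e : ((fun ω => g (logEulerPartial s (fun p => X p ω) (N + 1))) -
          fun ω => g (logEulerPartial s (fun p => X p ω) N)) = fun ω => h (X p ω) := by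
        ext ω
        have := logEulerPartial_succ_of_prime s (fun p => X p ω) p
        simp only [Pi.sub_apply]
        rw [show N + 1 = (p : ℕ) + 1 from rfl, this, map_add]
        simp [hh, hp]
      have hzero : ∫ ω, h (X p ω) ∂P = 0 := by
        rw [← e]
        change ∫ ω, (g (logEulerPartial s (fun p => X p ω) (N + 1)) -
          g (logEulerPartial s (fun p => X p ω) N)) ∂P = 0
        rw [integral_sub (hint _) (hint _),
          g.integral_comp_comm (hX.integrable_logEulerPartial hs _),
          g.integral_comp_comm (hX.integrable_logEulerPartial hs _),
          hX.integral_logEulerPartial hs, hX.integral_logEulerPartial hs, sub_self]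
      have hind := indep_iSup_of_disjoint (fun q => (hX.measurable q).comap_le) hX.indep.iIndep
        (S := {p}) (T := {q : Nat.Primes | (q : ℕ) < N})
        (Set.disjoint_singleton_left.2 fun h => lt_irrefl N h)
      rw [iSup_singleton] at hind
      have hc := condExp_indep_eq (μ := P) (f := fun ω => h (X p ω)) (hX.measurable p).comap_le
        (hX.filtration.le N) (hm.comp (comap_measurable (X p))).stronglyMeasurable hind
      rw [e]
      refine hc.trans ?_
      rw [hzero]; rfl
    · have e : ((fun ω => g (logEulerPartial s (fun p => X p ω) (N + 1))) -
          fun ω => g (logEulerPartial s (fun p => X p ω) N)) = 0 := by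
        ext ω
        simp [logEulerPartial_succ_of_not_prime s _ hN]
      rw [e, condExp_zero]

/-- The real and imaginary parts are martingales bounded in L², hence in L¹, and converge almost
surely. The limit so exhibited makes the `limUnder` in `logEuler` meaningful. -/
theorem ae_tendsto_logEulerPartial (hX : IsSteinhausFamily P X) {s : ℂ} (hs : 1 / 2 < s.re) :
    ∀ᵐ ω ∂P, Tendsto (logEulerPartial s (fun p => X p ω)) atTop
      (𝓝 (logEuler s (fun p => X p ω))) := by
  have hs0 : 0 < s.re := by linarith
  have key : ∀ g : ℂ →L[ℝ] ℝ, (∀ z, |g z| ≤ ‖z‖) →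
      ∀ᵐ ω ∂P, ∃ c, Tendsto (fun N => g (logEulerPartial s (fun p => X p ω) N)) atTop (𝓝 c) := by
    intro g hg
    refine (hX.martingale_logEulerPartial hs0 g).submartingale.exists_ae_tendsto_of_bdd
      (R := Real.toNNReal (Real.sqrt (smoothTail (fun _ : Fin 1 => s) 0))) fun N => ?_
    refine le_trans ?_ (hX.eLpNorm_logEulerPartial_le hs N)
    refine le_trans (eLpNorm_mono fun ω => hg _) ?_
    exact eLpNorm_le_eLpNorm_of_exponent_le (by norm_num)
      (hX.measurable_logEulerPartial s N).aestronglyMeasurable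
  filter_upwards [key Complex.reCLM Complex.abs_re_le_norm,
    key Complex.imCLM Complex.abs_im_le_norm] with ω ⟨a, ha⟩ ⟨b, hb⟩
  refine tendsto_nhds_limUnder ⟨a + b * Complex.I, ?_⟩
  have h := ((Complex.continuous_ofReal.tendsto a).comp ha).add
    (((Complex.continuous_ofReal.tendsto b).comp hb).mul_const Complex.I)
  refine h.congr fun N => ?_
  simp [Complex.re_add_im]

theorem ae_logEuler_conj (hX : IsSteinhausFamily P X) {s : ℂ} (hs : 1 / 2 < s.re) :
    ∀ᵐ ω ∂P, Tendsto (logEulerPartial s (fun p => conj (X p ω))) atTop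
        (𝓝 (logEuler s (fun p => conj (X p ω)))) ∧
      logEuler s (fun p => conj (X p ω)) = conj (logEuler (conj s) (fun p => X p ω)) := by
  filter_upwards [hX.ae_norm_eq_one,
    hX.ae_tendsto_logEulerPartial (s := conj s) (by simpa using hs)] with ω hω h
  have h1 : Tendsto (logEulerPartial s (fun p => conj (X p ω))) atTop
      (𝓝 (conj (logEuler (conj s) (fun p => X p ω)))) := by
    refine ((Complex.continuous_conj.tendsto _).comp h).congr fun N => ?_
    exact (logEulerPartial_conj (by linarith) (fun p => (hω p).le) N).symm
  have h2 : logEuler s (fun p => conj (X p ω)) = conj (logEuler (conj s) (fun p => X p ω)) :=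
    h1.limUnder_eq
  exact ⟨h2 ▸ h1, h2⟩

theorem ae_tendsto_prod_logEulerPartial (hX : IsSteinhausFamily P X) {k : ℕ} {s : Fin k → ℂ}
    (hs : ∀ j, 1 / 2 < (s j).re) :
    ∀ᵐ ω ∂P, Tendsto (fun N => ∏ j, logEulerPartial (s j) (fun p => X p ω) N) atTop
      (𝓝 (∏ j, logEuler (s j) (fun p => X p ω))) := by
  filter_upwards [ae_all_iff.2 fun j => hX.ae_tendsto_logEulerPartial (hs j)] with ω h
  exact tendsto_finsetProd _ fun j _ => h j

/-- The limit is known pointwise almost everywhere. Fatou's lemma applied to the differences with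
the N-th product transfers the uniform L² bound by the tail, which tends to 0. -/
theorem memLp_prod_logEuler (hX : IsSteinhausFamily P X) {k : ℕ} {s : Fin k → ℂ} {σ : ℝ}
    (hσ : 1 / 2 < σ) (hs : ∀ j, σ ≤ (s j).re) :
    MemLp (fun ω => ∏ j, logEuler (s j) (fun p => X p ω)) 2 P ∧
      Tendsto (fun N => eLpNorm ((fun ω => ∏ j, logEulerPartial (s j) (fun p => X p ω) N) -
        fun ω => ∏ j, logEuler (s j) (fun p => X p ω)) 2 P) atTop (𝓝 0) := by
  have hs0 : ∀ j, 0 < (s j).re := fun j => by linarith [hs j]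
  have hsum := summable_norm_prodCoeff_sq hσ hs
  have hlim := hX.ae_tendsto_prod_logEulerPartial fun j => hσ.trans_le (hs j)
  have hmeas : AEStronglyMeasurable (fun ω => ∏ j, logEuler (s j) (fun p => X p ω)) P :=
    aestronglyMeasurable_of_tendsto_ae atTop
      (fun N => (hX.measurable_prod_logEulerPartial s N).aestronglyMeasurable) hlim
  have hle : ∀ N, eLpNorm ((fun ω => ∏ j, logEuler (s j) (fun p => X p ω)) -
      fun ω => ∏ j, logEulerPartial (s j) (fun p => X p ω) N) 2 P
        ≤ ENNReal.ofReal (Real.sqrt (smoothTail s N)) := by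
    intro N
    refine (Lp.eLpNorm_lim_le_liminf_eLpNorm
      (f := fun M ω => (∏ j, logEulerPartial (s j) (fun p => X p ω) M) -
        ∏ j, logEulerPartial (s j) (fun p => X p ω) N)
      (fun M => ((hX.measurable_prod_logEulerPartial s M).sub
        (hX.measurable_prod_logEulerPartial s N)).aestronglyMeasurable) _ ?_).trans ?_
    · filter_upwards [hlim] with ω h using h.sub_const _
    · refine liminf_le_of_frequently_le' (Eventually.frequently ?_)
      filter_upwards [eventually_ge_atTop N] with M hM
      exact hX.eLpNorm_sub_logEulerPartial_le hs0 hsum hM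
  have hmem : MemLp (fun ω => ∏ j, logEuler (s j) (fun p => X p ω)) 2 P := by
    have h0 : MemLp ((fun ω => ∏ j, logEuler (s j) (fun p => X p ω)) -
        fun ω => ∏ j, logEulerPartial (s j) (fun p => X p ω) 0) 2 P :=
      ⟨hmeas.sub (hX.measurable_prod_logEulerPartial s 0).aestronglyMeasurable,
        (hle 0).trans_lt ENNReal.ofReal_lt_top⟩
    have := h0.add (hX.memLp_prod_logEulerPartial hs0 0)
    rwa [sub_add_cancel] at this
  refine ⟨hmem, ?_⟩
  have ht : Tendsto (fun N => ENNReal.ofReal (Real.sqrt (smoothTail s N))) atTop (𝓝 0) := by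
    have h1 := (Real.continuous_sqrt.tendsto 0).comp (tendsto_smoothTail hsum)
    rw [Real.sqrt_zero] at h1
    have h2 := (ENNReal.continuous_ofReal.tendsto 0).comp h1
    rwa [ENNReal.ofReal_zero] at h2
  refine tendsto_of_tendsto_of_tendsto_of_le_of_le tendsto_const_nhds ht (fun _ => bot_le) fun N => ?_
  rw [eLpNorm_sub_comm]
  exact hle N

theorem _root_.tendsto_tsum_prodCoeff_smoothInd {k l : ℕ} {s : Fin k → ℂ} {r : Fin l → ℂ}
    (hs : Summable fun n => ‖prodCoeff s n‖ ^ 2) (hr : Summable fun n => ‖prodCoeff r n‖ ^ 2) :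
    Tendsto (fun N => ∑' n, (prodCoeff s n * smoothInd N n) * conj (prodCoeff r n * smoothInd N n))
      atTop (𝓝 (∑' n, prodCoeff s n * conj (prodCoeff r n))) := by
  refine tendsto_tsum_of_dominated_convergence (𝓕 := atTop) (hs.add hr) (fun n => ?_)
    (Eventually.of_forall fun N n => ?_)
  · refine tendsto_const_nhds.congr' ?_
    filter_upwards [eventually_gt_atTop n] with N hN
    simp [smoothInd_eq_one_of_lt hN]
  · rw [norm_mul, Complex.norm_conj, norm_mul, norm_mul]
    have h1 := mul_le_of_le_one_right (norm_nonneg (prodCoeff s n)) (norm_smoothInd_le N n)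
    have h2 := mul_le_of_le_one_right (norm_nonneg (prodCoeff r n)) (norm_smoothInd_le N n)
    refine (mul_le_mul h1 h2 (by positivity) (norm_nonneg _)).trans ?_
    nlinarith [sq_nonneg (‖prodCoeff s n‖ - ‖prodCoeff r n‖), sq_nonneg ‖prodCoeff s n‖,
      sq_nonneg ‖prodCoeff r n‖]

/-- The mixed moments of the random logarithms. -/
theorem integral_prod_logEuler (hX : IsSteinhausFamily P X) {k l : ℕ} {s : Fin k → ℂ}
    {r : Fin l → ℂ} {σ : ℝ} (hσ : 1 / 2 < σ) (hs : ∀ j, σ ≤ (s j).re) (hr : ∀ j, σ ≤ (r j).re) :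
    Integrable (fun ω => (∏ j, logEuler (s j) (fun p => X p ω)) *
        ∏ j, logEuler (r j) (fun p => conj (X p ω))) P ∧
      ∫ ω, (∏ j, logEuler (s j) (fun p => X p ω)) *
          ∏ j, logEuler (r j) (fun p => conj (X p ω)) ∂P
        = ∑' n, prodCoeff s n * conj (prodCoeff (fun j => conj (r j)) n) := by
  have hr' : ∀ j, σ ≤ (conj (r j)).re := fun j => by simpa using hr j
  obtain ⟨hA, hA'⟩ := hX.memLp_prod_logEuler hσ hs
  obtain ⟨hB, hB'⟩ := hX.memLp_prod_logEuler hσ hr'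
  have hs0 : ∀ j, 0 < (s j).re := fun j => by linarith [hs j]
  have hr0 : ∀ j, 0 < (conj (r j)).re := fun j => by linarith [hr' j]
  have hae : (fun ω => (∏ j, logEuler (s j) (fun p => X p ω)) *
      conj (∏ j, logEuler (conj (r j)) (fun p => X p ω))) =ᵐ[P]
      fun ω => (∏ j, logEuler (s j) (fun p => X p ω)) *
        ∏ j, logEuler (r j) (fun p => conj (X p ω)) := by
    filter_upwards [ae_all_iff.2 fun j => hX.ae_logEuler_conj (hσ.trans_le (hr j))] with ω h
    rw [map_prod]
    congr 1
    exact Finset.prod_congr rfl fun j _ => (h j).2.symm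
  constructor
  · refine Integrable.congr ?_ hae
    have hB2 : MemLp (fun ω => conj (∏ j, logEuler (conj (r j)) (fun p => X p ω))) 2 P := hB.star
    exact hA.integrable_mul hB2
  · rw [← integral_congr_ae hae]
    -- The truncated moments converge to the expectation by L² convergence, and to the full diagonal
    -- sum by dominated convergence.
    refine tendsto_nhds_unique (tendsto_integral_mul_conj
      (fun N => hX.memLp_prod_logEulerPartial hs0 N) (fun N => hX.memLp_prod_logEulerPartial hr0 N)
      hA hB hA' hB') ?_
    simp_rw [hX.integral_prod_logEulerPartial hs0 hr0]
    exact tendsto_tsum_prodCoeff_smoothInd (summable_norm_prodCoeff_sq hσ hs)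
      (summable_norm_prodCoeff_sq hσ hr')

end IsSteinhausFamily


/-! ### Approximation of the product of logarithms by the smoothed series -/

theorem contourMean_congr {X H : ℝ} {F G : ℂ → ℂ}
    (h : ∀ y : ℝ, F ((3 : ℝ) + y * Complex.I) = G ((3 : ℝ) + y * Complex.I)) :
    contourMean X H F = contourMean X H G := by
  simp only [contourMean, h]

/-- The smoothed Dirichlet series of a product of logarithms of `ζ` on a vertical line. -/
noncomputable def smoothedProd {k : ℕ} (s : Fin k → ℂ) (X H t : ℝ) : ℂ :=
  ∑' n, prodCoeff s n * smoothWeight X H n * natPow n t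

/-- The size of the error made by the smoothing. -/
noncomputable def smoothError (δ X H : ℝ) : ℝ :=
  X ^ (-δ) / δ + 2 * Real.exp 9 * (X ^ (3 : ℝ) * Real.exp (-H ^ 2))

theorem smoothError_nonneg {δ X H : ℝ} (hδ : 0 < δ) (hX : 0 ≤ X) : 0 ≤ smoothError δ X H := by
  unfold smoothError; positivity

section

variable {k : ℕ} {s : Fin k → ℂ} {σ ε q : ℝ}

theorem norm_prodCoeff_le_of_le (hε : 0 < ε) (hs : ∀ j, σ ≤ (s j).re)
    (hq : (k / (ε * Real.log 2)) ^ k ≤ q) (n : ℕ) (hn : 1 ≤ n) :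
    ‖prodCoeff s n‖ ≤ q * (n : ℝ) ^ (ε - σ) :=
  (norm_prodCoeff_le s hε hs n hn).trans (mul_le_mul_of_nonneg_right hq (by positivity))

theorem summable_natCast_rpow_neg_two : Summable fun n : ℕ => (n : ℝ) ^ (-2 : ℝ) :=
  Real.summable_nat_rpow.2 (by norm_num)

theorem mul_norm_prodCoeff_mul_smoothWeight_le (hε : 0 < ε) (hεσ : ε ≤ σ)
    (hs : ∀ j, σ ≤ (s j).re) (hq0 : 0 ≤ q) (hq : (k / (ε * Real.log 2)) ^ k ≤ q) {X H : ℝ}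
    (hX : 0 < X) (hH : 0 ≤ H) (n : ℕ) :
    (n : ℝ) * ‖prodCoeff s n * smoothWeight X H n‖
      ≤ q * (Real.exp 9 * X ^ (3 : ℝ)) * (n : ℝ) ^ (-2 : ℝ) := by
  rcases Nat.eq_zero_or_pos n with rfl | hn
  · rw [ArithmeticFunction.map_zero, zero_mul, norm_zero, mul_zero]; positivity
  have hn1 : (1 : ℝ) ≤ n := by exact_mod_cast hn
  have h1 := norm_prodCoeff_le_of_le hε hs hq n hn
  have h2 : (n : ℝ) ^ (ε - σ) ≤ 1 := Real.rpow_le_one_of_one_le_of_nonpos hn1 (by linarith)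
  have h3 : ‖prodCoeff s n‖ ≤ q := h1.trans (mul_le_of_le_one_right hq0 h2)
  have h4 := norm_smoothWeight_le hH hX hn
  have h5 : (n : ℝ) * (n : ℝ) ^ (-3 : ℝ) = (n : ℝ) ^ (-2 : ℝ) := by
    rw [← Real.rpow_one_add' (by positivity) (by norm_num)]; norm_num
  calc (n : ℝ) * ‖prodCoeff s n * smoothWeight X H n‖
      ≤ n * (q * ((n : ℝ) ^ (-3 : ℝ) * (Real.exp 9 * X ^ (3 : ℝ)))) := by
        rw [norm_mul]; gcongr
    _ = _ := by rw [← h5]; ring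

theorem summable_mul_norm_prodCoeff_mul_smoothWeight (hε : 0 < ε) (hεσ : ε ≤ σ)
    (hs : ∀ j, σ ≤ (s j).re) {X H : ℝ} (hX : 0 < X) (hH : 0 ≤ H) :
    Summable fun n : ℕ => (n : ℝ) * ‖prodCoeff s n * smoothWeight X H n‖ :=
  (summable_natCast_rpow_neg_two.mul_left _).of_nonneg_of_le (fun _ => by positivity)
    (mul_norm_prodCoeff_mul_smoothWeight_le hε hεσ hs
      (pow_nonneg (div_nonneg (Nat.cast_nonneg k)
        (mul_nonneg hε.le (Real.log_pos one_lt_two).le)) k) le_rfl hX hH)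

theorem tsum_mul_norm_prodCoeff_mul_smoothWeight_le (hε : 0 < ε) (hεσ : ε ≤ σ)
    (hs : ∀ j, σ ≤ (s j).re) (hq0 : 0 ≤ q) (hq : (k / (ε * Real.log 2)) ^ k ≤ q) {X H : ℝ}
    (hX : 0 < X) (hH : 0 ≤ H) :
    ∑' n : ℕ, (n : ℝ) * ‖prodCoeff s n * smoothWeight X H n‖
      ≤ q * (Real.exp 9 * X ^ (3 : ℝ)) * ∑' n : ℕ, (n : ℝ) ^ (-2 : ℝ) := by
  rw [← tsum_mul_left]
  exact Summable.tsum_le_tsum (mul_norm_prodCoeff_mul_smoothWeight_le hε hεσ hs hq0 hq hX hH)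
    (summable_mul_norm_prodCoeff_mul_smoothWeight hε hεσ hs hX hH)
    (summable_natCast_rpow_neg_two.mul_left _)

theorem norm_prodCoeff_mul_smoothWeight_le (X H : ℝ) (n : ℕ) :
    ‖prodCoeff s n * smoothWeight X H n‖ ≤ (n : ℝ) * ‖prodCoeff s n * smoothWeight X H n‖ := by
  rcases Nat.eq_zero_or_pos n with rfl | hn
  · simp
  · exact le_mul_of_one_le_left (norm_nonneg _) (by exact_mod_cast hn)

theorem continuous_smoothedProd (hε : 0 < ε) (hεσ : ε ≤ σ) (hs : ∀ j, σ ≤ (s j).re) {X H : ℝ}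
    (hX : 0 < X) (hH : 0 ≤ H) : Continuous (smoothedProd s X H) := by
  refine continuous_tsum (fun n => continuous_const.mul (continuous_natPow n))
    (summable_mul_norm_prodCoeff_mul_smoothWeight hε hεσ hs hX hH) fun n t => ?_
  rw [norm_mul _ (natPow n t), norm_natPow, mul_one]
  exact norm_prodCoeff_mul_smoothWeight_le X H n

theorem norm_smoothedProd_le (hε : 0 < ε) (hεσ : ε ≤ σ) (hs : ∀ j, σ ≤ (s j).re) (hq0 : 0 ≤ q)
    (hq : (k / (ε * Real.log 2)) ^ k ≤ q) {X H : ℝ} (hX : 0 < X) (hH : 0 ≤ H) (t : ℝ) :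
    ‖smoothedProd s X H t‖
      ≤ q * (Real.exp 9 * X ^ (3 : ℝ)) * ∑' n : ℕ, (n : ℝ) ^ (-2 : ℝ) := by
  refine (tsum_of_norm_bounded
    (summable_mul_norm_prodCoeff_mul_smoothWeight hε hεσ hs hX hH).hasSum fun n => ?_).trans
    (tsum_mul_norm_prodCoeff_mul_smoothWeight_le hε hεσ hs hq0 hq hX hH)
  rw [norm_mul _ (natPow n t), norm_natPow, mul_one]
  exact norm_prodCoeff_mul_smoothWeight_le X H n

/-- The smoothed series approximates the product of the logarithms of `ζ` wherever the latter are
holomorphic and bounded on a rectangle. -/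
theorem norm_smoothedProd_sub_le (hε : 0 < ε) (hεσ : ε ≤ σ) (hs : ∀ j, σ ≤ (s j).re)
    {δ X H L t : ℝ} (hδ : 0 < δ) (hδ1 : δ ≤ 1) (hX : 1 ≤ X) (hH : 1 ≤ H)
    (hd : ∀ w ∈ Set.Icc (-δ) 3 ×ℂ Set.Icc (-H) H, ∀ j,
      DifferentiableAt ℂ logZeta (s j + Complex.I * t + w) ∧
        ‖logZeta (s j + Complex.I * t + w)‖ ≤ L) :
    ‖smoothedProd s X H t - ∏ j, logZeta (s j + Complex.I * t)‖ ≤ L ^ k * smoothError δ X H := by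
  have hX0 : 0 < X := by linarith
  have hs3 : Summable fun n => ‖prodCoeff s n‖ * (n : ℝ) ^ (-3 : ℝ) := by
    have h0 : (0 : ℝ) ≤ (k / (ε * Real.log 2)) ^ k := pow_nonneg (div_nonneg (Nat.cast_nonneg k)
        (mul_nonneg hε.le (Real.log_pos one_lt_two).le)) k
    refine ((Real.summable_nat_rpow.2 (show (-3 : ℝ) < -1 by norm_num)).mul_left
      ((k / (ε * Real.log 2)) ^ k)).of_nonneg_of_le (fun _ => by positivity) fun n => ?_
    rcases Nat.eq_zero_or_pos n with rfl | hn
    · rw [ArithmeticFunction.map_zero, norm_zero, zero_mul]; positivity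
    · refine mul_le_mul_of_nonneg_right ?_ (by positivity)
      refine (norm_prodCoeff_le s hε hs n hn).trans (mul_le_of_le_one_right h0 ?_)
      exact Real.rpow_le_one_of_one_le_of_nonpos (by exact_mod_cast hn) (by linarith)
  have h1 := (hasSum_contourMean_LSeries (a := prodCoeff s) ArithmeticFunction.map_zero hs3 hX0
    (H := H) t).tsum_eq
  -- On Re w = 3 every argument has real part above 1, where `logZeta` is its Dirichlet series; the
  -- shift to the left then takes place on the `logZeta` side only.
  have h2 : contourMean X H (fun w => LSeries (prodCoeff s) (w + t * Complex.I))
      = contourMean X H fun w => ∏ j, logZeta (s j + Complex.I * t + w) := by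
    refine contourMean_congr fun y => ?_
    have hre : ∀ j, 1 < (s j + ((3 : ℝ) + y * Complex.I + t * Complex.I)).re := by
      intro j
      have := hs j
      simp; linarith
    have h3 := (lseries_prod_shiftedCoeff Finset.univ s
      ((3 : ℝ) + y * Complex.I + t * Complex.I) fun j _ => hre j).2
    refine h3.trans (Finset.prod_congr rfl fun j _ => ?_)
    rw [← logZeta_eq_logDirichlet (hre j)]
    congr 1; ring
  rw [smoothedProd, h1, h2]
  have h4 := norm_contourMean_sub_le (Q := L ^ k) hδ hδ1 hH hX
    (F := fun w => ∏ j, logZeta (s j + Complex.I * t + w))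
    (fun w hw => by
      refine DifferentiableAt.fun_finsetProd fun j _ => ?_
      exact ((hd w hw j).1).comp w (differentiableAt_id.const_add _))
    (fun w hw => by
      rw [norm_prod]
      refine (Finset.prod_le_prod (fun _ _ => norm_nonneg _)
        fun j _ => (hd w hw j).2).trans (le_of_eq ?_)
      rw [Finset.prod_const, Finset.card_univ, Fintype.card_fin])
  simpa only [add_zero, smoothError] using h4

end

/-- Writing v for the weight, |v|² - 1 = |v - 1|² + 2 Re(v - 1), so closeness of v to 1 is enough.
-/
theorem norm_smoothWeight_mul_conj_sub_one_le {δ X H : ℝ} (hδ : 0 < δ) (hδ1 : δ ≤ 1) (hX : 1 ≤ X)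
    (hH : 1 ≤ H) {n : ℕ} (hn : 1 ≤ n) :
    ‖smoothWeight X H n * conj (smoothWeight X H n) - 1‖
      ≤ (n : ℝ) ^ (2 * δ) * (smoothError δ X H * (2 + smoothError δ X H)) := by
  set v := smoothWeight X H n with hv
  set θ := smoothError δ X H with hθ
  have hθ0 : 0 ≤ θ := smoothError_nonneg hδ (by linarith)
  have h1 : ‖v - 1‖ ≤ (n : ℝ) ^ δ * θ := norm_smoothWeight_sub_one_le hδ hδ1 hH hX hn
  have hn1 : 1 ≤ (n : ℝ) ^ δ := Real.one_le_rpow (by exact_mod_cast hn) hδ.le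
  have e : v * conj v - 1 = (v - 1) * conj (v - 1) + (v - 1) + conj (v - 1) := by
    rw [map_sub, map_one]; ring
  have h2 : ‖v * conj v - 1‖ ≤ ‖v - 1‖ * ‖v - 1‖ + ‖v - 1‖ + ‖v - 1‖ := by
    rw [e]
    refine (norm_add₃_le).trans ?_
    rw [norm_mul, Complex.norm_conj]
  have h3 : (n : ℝ) ^ (2 * δ) = (n : ℝ) ^ δ * (n : ℝ) ^ δ := by
    rw [← rpow_sq (by positivity), sq]
  rw [h3]
  have h0 := norm_nonneg (v - 1)
  set x := (n : ℝ) ^ δ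
  have h4 : ‖v - 1‖ * ‖v - 1‖ ≤ (x * θ) * (x * θ) := mul_le_mul h1 h1 h0 (by positivity)
  have h5 : x * θ ≤ x * x * θ := by
    have : 0 ≤ x * θ * (x - 1) := mul_nonneg (by positivity) (by linarith)
    nlinarith
  nlinarith

/-- The diagonal terms of the smoothed mean value are close to the random moments. -/
theorem norm_tsum_smoothed_sub_le {k l : ℕ} {s : Fin k → ℂ} {r : Fin l → ℂ} {η q : ℝ}
    (hη : 0 < η) (hη1 : η ≤ 1) (hs : ∀ j, 1 / 2 + η ≤ (s j).re) (hr : ∀ j, 1 / 2 + η ≤ (r j).re)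
    (hqs : (k / (η / 4 * Real.log 2)) ^ k ≤ q) (hqr : (l / (η / 4 * Real.log 2)) ^ l ≤ q)
    (hq0 : 0 ≤ q) {X H : ℝ} (hX : 1 ≤ X) (hH : 1 ≤ H) :
    ‖(∑' n, (prodCoeff s n * smoothWeight X H n) * conj (prodCoeff r n * smoothWeight X H n))
        - ∑' n, prodCoeff s n * conj (prodCoeff r n)‖
      ≤ q ^ 2 * (smoothError (η / 4) X H * (2 + smoothError (η / 4) X H)) *
        ∑' n : ℕ, (n : ℝ) ^ (-1 - η) := by
  set θ := smoothError (η / 4) X H with hθ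
  have hθ0 : 0 ≤ θ := smoothError_nonneg (by positivity) (by linarith)
  have hS : Summable fun n : ℕ => (n : ℝ) ^ (-1 - η) := Real.summable_nat_rpow.2 (by linarith)
  -- The coefficients have room to spare: besides n^(-1-η), which is summable, a factor n^(-2δ) with
  -- δ = η/4 remains to cancel the growth of the weight error.
  have hab : ∀ n : ℕ, 1 ≤ n → ‖prodCoeff s n * conj (prodCoeff r n)‖
      ≤ q ^ 2 * (n : ℝ) ^ (-1 - η - 2 * (η / 4)) := by
    intro n hn
    have h1 := norm_prodCoeff_le_of_le (by positivity) hs hqs n hn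
    have h2 := norm_prodCoeff_le_of_le (by positivity) hr hqr n hn
    have hn0 : (0 : ℝ) < n := by exact_mod_cast hn
    rw [norm_mul, Complex.norm_conj]
    calc _ ≤ (q * (n : ℝ) ^ (η / 4 - (1 / 2 + η))) * (q * (n : ℝ) ^ (η / 4 - (1 / 2 + η))) :=
          mul_le_mul h1 h2 (norm_nonneg _) (by positivity)
      _ = q ^ 2 * ((n : ℝ) ^ (η / 4 - (1 / 2 + η))) ^ 2 := by ring
      _ = q ^ 2 * (n : ℝ) ^ (-1 - η - 2 * (η / 4)) := by
          rw [rpow_sq hn0.le]; congr 2; ring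
  have hterm : ∀ n : ℕ, ‖prodCoeff s n * conj (prodCoeff r n) *
      (smoothWeight X H n * conj (smoothWeight X H n) - 1)‖
        ≤ q ^ 2 * (θ * (2 + θ)) * (n : ℝ) ^ (-1 - η) := by
    intro n
    rcases Nat.eq_zero_or_pos n with rfl | hn
    · rw [ArithmeticFunction.map_zero, zero_mul, zero_mul, norm_zero]; positivity
    · have hn0 : (0 : ℝ) < n := by exact_mod_cast hn
      have h3 := norm_smoothWeight_mul_conj_sub_one_le (δ := η / 4) (by positivity) (by linarith)
        hX hH hn
      rw [norm_mul]
      calc _ ≤ (q ^ 2 * (n : ℝ) ^ (-1 - η - 2 * (η / 4))) *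
            ((n : ℝ) ^ (2 * (η / 4)) * (θ * (2 + θ))) :=
            mul_le_mul (hab n hn) h3 (norm_nonneg _) (by positivity)
        _ = q ^ 2 * (θ * (2 + θ)) *
            ((n : ℝ) ^ (-1 - η - 2 * (η / 4)) * (n : ℝ) ^ (2 * (η / 4))) := by ring
        _ = _ := by rw [← Real.rpow_add hn0, sub_add_cancel]
  have hs2 : Summable fun n => prodCoeff s n * conj (prodCoeff r n) := by
    refine Summable.of_norm_bounded (hS.mul_left (q ^ 2)) fun n => ?_
    rcases Nat.eq_zero_or_pos n with rfl | hn
    · rw [ArithmeticFunction.map_zero, zero_mul, norm_zero]; positivity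
    · refine (hab n hn).trans (mul_le_mul_of_nonneg_left ?_ (by positivity))
      exact Real.rpow_le_rpow_of_exponent_le (by exact_mod_cast hn) (by linarith)
  have hs1 : Summable fun n => prodCoeff s n * conj (prodCoeff r n) *
      (smoothWeight X H n * conj (smoothWeight X H n) - 1) :=
    Summable.of_norm_bounded (hS.mul_left _) hterm
  have e : ∀ n, (prodCoeff s n * smoothWeight X H n) * conj (prodCoeff r n * smoothWeight X H n)
      = prodCoeff s n * conj (prodCoeff r n) *
        (smoothWeight X H n * conj (smoothWeight X H n) - 1)
          + prodCoeff s n * conj (prodCoeff r n) := by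
    intro n; rw [map_mul]; ring
  simp_rw [e]
  rw [hs1.tsum_add hs2, add_sub_cancel_right, ← tsum_mul_left]
  exact tsum_of_norm_bounded (hS.mul_left _).hasSum hterm

/-- Replacing two functions by approximations valid off an exceptional set. -/
theorem norm_setIntegral_mul_conj_sub_le {A A' D D' : ℝ → ℂ} {T q θ B : ℝ} {E : Set ℝ}
    (hT : 0 ≤ T) (hE : MeasurableSet E) (hET : E ⊆ Set.Icc T (2 * T)) (hq : 0 ≤ q) (hθ : 0 ≤ θ)
    (hAc : ContinuousOn A (Set.Icc T (2 * T) \ E)) (hAc' : ContinuousOn A' (Set.Icc T (2 * T) \ E))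
    (hA : ∀ t ∈ Set.Icc T (2 * T) \ E, ‖A t‖ ≤ q) (hA' : ∀ t ∈ Set.Icc T (2 * T) \ E, ‖A' t‖ ≤ q)
    (hDc : Continuous D) (hDc' : Continuous D') (hD : ∀ t, ‖D t‖ ≤ B) (hD' : ∀ t, ‖D' t‖ ≤ B)
    (hDA : ∀ t ∈ Set.Icc T (2 * T) \ E, ‖D t - A t‖ ≤ q * θ)
    (hDA' : ∀ t ∈ Set.Icc T (2 * T) \ E, ‖D' t - A' t‖ ≤ q * θ) :
    IntegrableOn (fun t => A t * conj (A' t)) (Set.Icc T (2 * T) \ E) ∧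
      ‖(∫ t in Set.Icc T (2 * T) \ E, A t * conj (A' t)) - ∫ t in T..2 * T, D t * conj (D' t)‖
        ≤ T * (q ^ 2 * (θ * (2 + θ))) + volume.real E * B ^ 2 := by
  set G := Set.Icc T (2 * T) \ E with hG
  have hGm : MeasurableSet G := measurableSet_Icc.diff hE
  have hIfin : volume (Set.Icc T (2 * T)) ≠ ⊤ := by simp
  have hGfin : volume G < ⊤ := (measure_mono Set.sdiff_subset).trans_lt hIfin.lt_top
  have hEfin : volume E < ⊤ := (measure_mono hET).trans_lt hIfin.lt_top
  have hint : IntegrableOn (fun t => A t * conj (A' t)) G := by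
    refine IntegrableOn.of_bound hGfin ?_ (q * q) ?_
    · exact (hAc.mul (Complex.continuous_conj.comp_continuousOn hAc')).aestronglyMeasurable hGm
    · filter_upwards [ae_restrict_mem hGm] with t ht
      rw [norm_mul, Complex.norm_conj]
      exact mul_le_mul (hA t ht) (hA' t ht) (norm_nonneg _) hq
  refine ⟨hint, ?_⟩
  have hDD : Continuous fun t => D t * conj (D' t) :=
    hDc.mul (Complex.continuous_conj.comp hDc')
  have hDI : IntegrableOn (fun t => D t * conj (D' t)) (Set.Icc T (2 * T)) :=
    hDD.continuousOn.integrableOn_compact isCompact_Icc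
  have hsplit : ∫ t in T..2 * T, D t * conj (D' t)
      = (∫ t in G, D t * conj (D' t)) + ∫ t in E, D t * conj (D' t) := by
    rw [intervalIntegral.integral_of_le (by linarith), ← integral_Icc_eq_integral_Ioc,
      ← setIntegral_union Set.disjoint_sdiff_left hE (hDI.mono_set Set.sdiff_subset)
        (hDI.mono_set hET), Set.sdiff_union_of_subset hET]
  rw [hsplit, ← sub_sub, ← integral_sub hint (hDI.mono_set Set.sdiff_subset)]
  have h1 : ‖∫ t in G, (A t * conj (A' t) - D t * conj (D' t))‖
      ≤ (q ^ 2 * (θ * (2 + θ))) * volume.real G := by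
    refine norm_setIntegral_le_of_norm_le_const hGfin fun t ht => ?_
    -- The expansion is around A and A', for which bounds by q are available; D and D' enter only
    -- through differences. On E itself only the trivial bound B is used.
    have e : A t * conj (A' t) - D t * conj (D' t)
        = -((D t - A t) * conj (D' t - A' t)) - A t * conj (D' t - A' t)
          - (D t - A t) * conj (A' t) := by
      rw [map_sub]; ring
    rw [e]
    have n1 : ‖(D t - A t) * conj (D' t - A' t)‖ ≤ (q * θ) * (q * θ) := by
      rw [norm_mul, Complex.norm_conj]
      exact mul_le_mul (hDA t ht) (hDA' t ht) (norm_nonneg _) (by positivity)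
    have n2 : ‖A t * conj (D' t - A' t)‖ ≤ q * (q * θ) := by
      rw [norm_mul, Complex.norm_conj]
      exact mul_le_mul (hA t ht) (hDA' t ht) (norm_nonneg _) hq
    have n3 : ‖(D t - A t) * conj (A' t)‖ ≤ (q * θ) * q := by
      rw [norm_mul, Complex.norm_conj]
      exact mul_le_mul (hDA t ht) (hA' t ht) (norm_nonneg _) (by positivity)
    refine (norm_sub_le _ _).trans ((add_le_add (norm_sub_le _ _) le_rfl).trans ?_)
    rw [norm_neg]
    nlinarith
  have h2 : ‖∫ t in E, D t * conj (D' t)‖ ≤ B ^ 2 * volume.real E := by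
    refine norm_setIntegral_le_of_norm_le_const hEfin fun t _ => ?_
    rw [norm_mul, Complex.norm_conj, sq]
    exact mul_le_mul (hD t) (hD' t) (norm_nonneg _) ((norm_nonneg _).trans (hD t))
  have h3 : volume.real G ≤ T := by
    refine (measureReal_mono Set.sdiff_subset hIfin).trans ?_
    rw [Real.volume_real_Icc_of_le (by linarith)]; linarith
  refine (norm_sub_le _ _).trans (add_le_add (h1.trans ?_) (h2.trans (le_of_eq (mul_comm _ _))))
  rw [mul_comm]
  exact mul_le_mul_of_nonneg_right h3 (by positivity)


/-! ### The exceptional set -/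

/-- It keeps the ordinates t + u, and anything within log T of them, well inside [T/2, 3T], where
the zero count is available. -/
theorem rpow_add_log_le {T : ℝ} (hT : 1024 ≤ T) :
    T ^ ((1 : ℝ) / 8) + Real.log T ≤ 3 * T / 32 := by
  have hT0 : 0 < T := by linarith
  set x := Real.sqrt T with hx
  have hxx : x * x = T := Real.mul_self_sqrt hT0.le
  have hx32 : 32 ≤ x := Real.le_sqrt_of_sq_le (by linarith)
  have h1 : T ^ ((1 : ℝ) / 8) ≤ x := by
    rw [hx, Real.sqrt_eq_rpow]
    exact Real.rpow_le_rpow_of_exponent_le (by linarith) (by norm_num)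
  have h2 : Real.log T = 2 * Real.log x := by
    rw [← hxx, Real.log_mul (by linarith) (by linarith)]; ring
  have h3 : Real.log x ≤ x - 1 := Real.log_le_sub_one_of_pos (by linarith)
  nlinarith

/-- Off a small exceptional set, the logarithm of `ζ` is holomorphic and small on long vertical
segments to the right of the critical line. -/
theorem exists_exceptional_set {η : ℝ} (hη : 0 < η) (hη1 : η < 1 / 2) :
    ∃ C c : ℝ, 1 ≤ C ∧ 0 < c ∧ c ≤ 1 ∧ ∀ T : ℝ, 1024 ≤ T → ∀ (ι : Type) [Fintype ι] (u : ι → ℝ),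
      (∀ i, |u i| ≤ T ^ ((1 : ℝ) / 8)) →
      ∃ E : Set ℝ, MeasurableSet E ∧ E ⊆ Set.Icc T (2 * T) ∧
        volume E ≤ ENNReal.ofReal (Fintype.card ι * (C * Real.log T * T ^ (1 - c))) ∧
        ∀ t ∈ Set.Icc T (2 * T) \ E, ∀ i, ∀ z : ℂ, |z.im - (t + u i)| ≤ Real.log T →
          1 / 2 + 3 * η / 4 ≤ z.re →
          riemannZeta z ≠ 0 ∧ DifferentiableAt ℂ logZeta z ∧
            ‖logZeta z‖ ≤ C * Real.log T := by
  classical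
  obtain ⟨A, hA, hcard⟩ := exists_card_zero_intervals_le (κ := η / 4) (by positivity) (by linarith)
  obtain ⟨B, hB, hlog⟩ := exists_norm_logZeta_le (σ₁ := 1 / 2 + η / 2) (σ' := 1 / 2 + 3 * η / 4)
    (by linarith) (by linarith) (by linarith)
  -- The term 10A comes from the measure, as each removed interval has length 2 log T + 8 ≤ 10 log
  -- T; the term 2B comes from log |Im z| ≤ 2 log T. The exponent is that of the zero count with κ =
  -- η/4.
  refine ⟨10 * A + 2 * B, (η / 4) ^ 2 / 4, by linarith, by positivity, by nlinarith, ?_⟩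
  intro T hT ι _ u hu
  have hT0 : 0 < T := by linarith
  have hrl := rpow_add_log_le hT
  have hlogT : 1 ≤ Real.log T := by
    rw [Real.le_log_iff_exp_le hT0]
    linarith [Real.exp_one_lt_d9]
  set bad : Finset ℤ := (Finset.Icc ⌈T / 2 + 1⌉ ⌊3 * T - 2⌋).filter fun m =>
    ∃ ρ : ℂ, riemannZeta ρ = 0 ∧ 1 / 2 + 2 * (η / 4) ≤ ρ.re ∧ ρ.re ≤ 1 ∧ (m : ℝ) ≤ ρ.im ∧
      ρ.im ≤ m + 1 with hbad
  have hbadcard : (bad.card : ℝ) ≤ A * T ^ (1 - (η / 4) ^ 2 / 4) := by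
    refine hcard T (by linarith) bad fun m hm => ?_
    rw [hbad, Finset.mem_filter, Finset.mem_Icc, Int.ceil_le, Int.le_floor] at hm
    exact ⟨hm.1.1, by linarith [hm.1.2], hm.2⟩
  -- An offending zero has ordinate within log T + 2 of t + u i, and m is its integer part, at most
  -- 1 further; the radius leaves slack.
  set h : ℝ := Real.log T + 4 with hh
  set E : Set ℝ := Set.Icc T (2 * T) ∩
    ⋃ i, ⋃ m ∈ bad, Set.Icc ((m : ℝ) - u i - h) ((m : ℝ) - u i + h) with hE
  refine ⟨E, ?_, Set.inter_subset_left, ?_, ?_⟩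
  · exact measurableSet_Icc.inter (MeasurableSet.iUnion fun i =>
      Finset.measurableSet_biUnion _ fun m _ => measurableSet_Icc)
  · calc volume E ≤ volume (⋃ i, ⋃ m ∈ bad, Set.Icc ((m : ℝ) - u i - h) ((m : ℝ) - u i + h)) :=
          measure_mono Set.inter_subset_right
      _ ≤ ∑ i : ι, ∑ m ∈ bad, ENNReal.ofReal (2 * h) := by
          refine (measure_iUnion_fintype_le _ _).trans (Finset.sum_le_sum fun i _ => ?_)
          refine (measure_biUnion_finset_le _ _).trans (Finset.sum_le_sum fun m _ => ?_)
          rw [Real.volume_Icc]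
          exact ENNReal.ofReal_le_ofReal (by linarith)
      _ = ENNReal.ofReal (Fintype.card ι * (bad.card * (2 * h))) := by
          rw [Finset.sum_const, Finset.sum_const, Finset.card_univ, nsmul_eq_mul, nsmul_eq_mul,
            ENNReal.ofReal_mul (p := (Fintype.card ι : ℝ)) (by positivity),
            ENNReal.ofReal_mul (p := (bad.card : ℝ)) (by positivity), ENNReal.ofReal_natCast, ENNReal.ofReal_natCast]
      _ ≤ _ := by
          refine ENNReal.ofReal_le_ofReal (mul_le_mul_of_nonneg_left ?_ (Nat.cast_nonneg _))
          have hp : 0 ≤ T ^ (1 - (η / 4) ^ 2 / 4) := by positivity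
          calc (bad.card : ℝ) * (2 * h)
              ≤ (A * T ^ (1 - (η / 4) ^ 2 / 4)) * (10 * Real.log T) :=
                mul_le_mul hbadcard (by rw [hh]; linarith) (by rw [hh]; linarith) (by positivity)
            _ ≤ (A * T ^ (1 - (η / 4) ^ 2 / 4)) * (10 * Real.log T) +
                2 * B * Real.log T * T ^ (1 - (η / 4) ^ 2 / 4) :=
                le_add_of_nonneg_right (by positivity)
            _ = _ := by ring
  · intro t ht i z hz hre
    obtain ⟨⟨ht1, ht2⟩, htE⟩ := ht
    have hui := hu i
    rw [abs_le] at hui hz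
    have hzfree : ∀ ρ : ℂ, riemannZeta ρ = 0 → 1 / 2 + η / 2 < ρ.re → 2 ≤ |ρ.im - z.im| := by
      intro ρ hρ hρre
      by_contra hlt
      rw [not_le, abs_lt] at hlt
      have hρ1 : ρ.re ≤ 1 := by
        by_contra hc
        exact riemannZeta_ne_zero_of_one_le_re (not_le.1 hc).le hρ
      have hm1 := Int.floor_le ρ.im
      have hm2 := Int.lt_floor_add_one ρ.im
      apply htE
      refine ⟨⟨ht1, ht2⟩, ?_⟩
      rw [Set.mem_iUnion]
      refine ⟨i, Set.mem_biUnion (x := ⌊ρ.im⌋) ?_ ?_⟩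
      · rw [hbad, Finset.mem_coe, Finset.mem_filter, Finset.mem_Icc, Int.ceil_le, Int.le_floor]
        exact ⟨⟨by linarith, by linarith⟩, ρ, hρ, by linarith, hρ1, hm1, hm2.le⟩
      · constructor <;> rw [hh] <;> linarith
    have hzim : 4 ≤ |z.im| := le_trans (by linarith) (le_abs_self _)
    have hzabs : |z.im| = z.im := abs_of_nonneg (by linarith)
    obtain ⟨hd, hn⟩ := hlog z hre hzim hzfree
    refine ⟨fun h0 => ?_, hd, hn.trans ?_⟩
    · have := hzfree z h0 (by linarith)
      simp at this; linarith
    · have h1 : Real.log |z.im| ≤ 2 * Real.log T := by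
        have : 2 * Real.log T = Real.log (T * T) := by
          rw [Real.log_mul hT0.ne' hT0.ne']; ring
        rw [this]
        refine Real.log_le_log (by linarith) ?_
        rw [hzabs]; nlinarith
      have h2 : B * Real.log |z.im| ≤ B * (2 * Real.log T) :=
        mul_le_mul_of_nonneg_left h1 (by linarith)
      have h3 : 0 ≤ A * Real.log T := by positivity
      linarith


/-! ### Assembly and choice of parameters -/

theorem continuousOn_prod_logZeta {k : ℕ} {s : Fin k → ℂ} {S : Set ℝ}
    (h : ∀ t ∈ S, ∀ j, DifferentiableAt ℂ logZeta (s j + Complex.I * t)) :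
    ContinuousOn (fun t : ℝ => ∏ j, logZeta (s j + Complex.I * t)) S := by
  refine continuousOn_finsetProd _ fun j _ t ht => ContinuousAt.continuousWithinAt ?_
  have hc : ContinuousAt (fun t : ℝ => s j + Complex.I * (t : ℂ)) t := by fun_prop
  exact ContinuousAt.comp (f := fun t : ℝ => s j + Complex.I * (t : ℂ)) (h t ht j).continuousAt hc

/-- Three replacements are added up: the logarithms by the smoothed series, at the cost of the
smoothing error and the trivial bound on E; the mean value of the smoothed series by T times its
diagonal; the weights on the diagonal by 1. -/
theorem norm_moment_sub_le {k l : ℕ} {s : Fin k → ℂ} {r : Fin l → ℂ} {η q L T X H : ℝ} {E : Set ℝ}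
    (hη : 0 < η) (hη1 : η ≤ 1) (hs : ∀ j, 1 / 2 + η ≤ (s j).re) (hr : ∀ j, 1 / 2 + η ≤ (r j).re)
    (hqs : (k / (η / 4 * Real.log 2)) ^ k ≤ q) (hqr : (l / (η / 4 * Real.log 2)) ^ l ≤ q)
    (hLk : L ^ k ≤ q) (hLl : L ^ l ≤ q) (hL : 0 ≤ L) (hT : 0 ≤ T) (hX : 1 ≤ X) (hH : 1 ≤ H)
    (hE : MeasurableSet E) (hET : E ⊆ Set.Icc T (2 * T))
    (hds : ∀ t ∈ Set.Icc T (2 * T) \ E, ∀ w ∈ Set.Icc (-(η / 4)) 3 ×ℂ Set.Icc (-H) H, ∀ j,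
      DifferentiableAt ℂ logZeta (s j + Complex.I * t + w) ∧
        ‖logZeta (s j + Complex.I * t + w)‖ ≤ L)
    (hdr : ∀ t ∈ Set.Icc T (2 * T) \ E, ∀ w ∈ Set.Icc (-(η / 4)) 3 ×ℂ Set.Icc (-H) H, ∀ j,
      DifferentiableAt ℂ logZeta (r j + Complex.I * t + w) ∧
        ‖logZeta (r j + Complex.I * t + w)‖ ≤ L) :
    IntegrableOn (fun t : ℝ => (∏ j, logZeta (s j + Complex.I * t)) *
        conj (∏ j, logZeta (r j + Complex.I * t))) (Set.Icc T (2 * T) \ E) ∧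
      ‖(∫ t in Set.Icc T (2 * T) \ E, (∏ j, logZeta (s j + Complex.I * t)) *
          conj (∏ j, logZeta (r j + Complex.I * t)))
          - T * ∑' n, prodCoeff s n * conj (prodCoeff r n)‖
        ≤ T * (q ^ 2 * (smoothError (η / 4) X H * (2 + smoothError (η / 4) X H)) *
            (1 + ∑' n : ℕ, (n : ℝ) ^ (-1 - η))) +
          (volume.real E + 4) *
            (q * (Real.exp 9 * X ^ (3 : ℝ)) * ∑' n : ℕ, (n : ℝ) ^ (-2 : ℝ)) ^ 2 := by
  have hX0 : 0 < X := by linarith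
  have hH0 : 0 ≤ H := by linarith
  have hη4 : 0 < η / 4 := by positivity
  have hησ : η / 4 ≤ 1 / 2 + η := by linarith
  have hη41 : η / 4 ≤ 1 := by linarith
  have hq : 0 ≤ q := (pow_nonneg hL k).trans hLk
  set θ := smoothError (η / 4) X H with hθ
  have hθ0 : 0 ≤ θ := smoothError_nonneg hη4 hX0.le
  set B := q * (Real.exp 9 * X ^ (3 : ℝ)) * ∑' n : ℕ, (n : ℝ) ^ (-2 : ℝ) with hB
  have h0 : (0 : ℂ) ∈ Set.Icc (-(η / 4)) 3 ×ℂ Set.Icc (-H) H := by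
    rw [Complex.mem_reProdIm]
    simp only [Complex.zero_re, Complex.zero_im, Set.mem_Icc]
    exact ⟨⟨by linarith, by norm_num⟩, by linarith, by linarith⟩
  have hds0 := fun t ht j => hds t ht 0 h0 j
  have hdr0 := fun t ht j => hdr t ht 0 h0 j
  simp only [add_zero] at hds0 hdr0
  have hprod : ∀ {m : ℕ} (z : Fin m → ℂ), (∀ j, ‖logZeta (z j)‖ ≤ L) → L ^ m ≤ q →
      ‖∏ j, logZeta (z j)‖ ≤ q := by
    intro m z hz hm
    rw [norm_prod]
    refine (Finset.prod_le_prod (fun _ _ => norm_nonneg _) fun j _ => hz j).trans ?_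
    rwa [Finset.prod_const, Finset.card_univ, Fintype.card_fin]
  obtain ⟨hint, hmain⟩ := norm_setIntegral_mul_conj_sub_le
    (A := fun t => ∏ j, logZeta (s j + Complex.I * t))
    (A' := fun t => ∏ j, logZeta (r j + Complex.I * t)) (D := smoothedProd s X H)
    (D' := smoothedProd r X H) (B := B) hT hE hET hq hθ0
    (continuousOn_prod_logZeta fun t ht j => (hds0 t ht j).1)
    (continuousOn_prod_logZeta fun t ht j => (hdr0 t ht j).1)
    (fun t ht => hprod _ (fun j => (hds0 t ht j).2) hLk)
    (fun t ht => hprod _ (fun j => (hdr0 t ht j).2) hLl)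
    (continuous_smoothedProd hη4 hησ hs hX0 hH0) (continuous_smoothedProd hη4 hησ hr hX0 hH0)
    (norm_smoothedProd_le hη4 hησ hs hq hqs hX0 hH0)
    (norm_smoothedProd_le hη4 hησ hr hq hqr hX0 hH0)
    (fun t ht => (norm_smoothedProd_sub_le hη4 hησ hs hη4 hη41 hX hH (hds t ht)).trans
      (mul_le_mul_of_nonneg_right hLk hθ0))
    (fun t ht => (norm_smoothedProd_sub_le hη4 hησ hr hη4 hη41 hX hH (hdr t ht)).trans
      (mul_le_mul_of_nonneg_right hLl hθ0))
  refine ⟨hint, ?_⟩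
  have hmv := norm_integral_dirichlet_mul_conj_sub_le
    (α := fun n => prodCoeff s n * smoothWeight X H n)
    (β := fun n => prodCoeff r n * smoothWeight X H n) (by simp) (by simp)
    (summable_mul_norm_prodCoeff_mul_smoothWeight hη4 hησ hs hX0 hH0)
    (summable_mul_norm_prodCoeff_mul_smoothWeight hη4 hησ hr hX0 hH0) T (2 * T)
  have hdiag := norm_tsum_smoothed_sub_le hη hη1 hs hr hqs hqr hq hX hH
  have hb1 := tsum_mul_norm_prodCoeff_mul_smoothWeight_le hη4 hησ hs hq hqs hX0 hH0
  have hb2 := tsum_mul_norm_prodCoeff_mul_smoothWeight_le hη4 hησ hr hq hqr hX0 hH0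
  rw [show (2 * T - T : ℝ) = T by ring] at hmv
  change ‖(∫ t in T..2 * T, smoothedProd s X H t * conj (smoothedProd r X H t)) - _‖ ≤ _ at hmv
  set I := ∫ t in Set.Icc T (2 * T) \ E, (∏ j, logZeta (s j + Complex.I * t)) *
    conj (∏ j, logZeta (r j + Complex.I * t))
  set J := ∫ t in T..2 * T, smoothedProd s X H t * conj (smoothedProd r X H t)
  set D₁ := ∑' n, (prodCoeff s n * smoothWeight X H n) * conj (prodCoeff r n * smoothWeight X H n)
  set D₂ := ∑' n, prodCoeff s n * conj (prodCoeff r n)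
  set b₁ := ∑' n : ℕ, (n : ℝ) * ‖prodCoeff s n * smoothWeight X H n‖
  set b₂ := ∑' n : ℕ, (n : ℝ) * ‖prodCoeff r n * smoothWeight X H n‖
  have hb10 : 0 ≤ b₁ := tsum_nonneg fun _ => by positivity
  have hb20 : 0 ≤ b₂ := tsum_nonneg fun _ => by positivity
  have e : I - T * D₂ = (I - J) + (J - T * D₁) + T * (D₁ - D₂) := by ring
  rw [e]
  have hbb : 4 * b₁ * b₂ ≤ 4 * B ^ 2 := by
    rw [mul_assoc, sq]
    exact mul_le_mul_of_nonneg_left (mul_le_mul hb1 hb2 hb20 (hb10.trans hb1)) (by norm_num)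
  have hT2 : ‖(T : ℂ) * (D₁ - D₂)‖ ≤ T * (q ^ 2 * (θ * (2 + θ)) * ∑' n : ℕ, (n : ℝ) ^ (-1 - η)) := by
    rw [norm_mul, Complex.norm_of_nonneg hT]
    exact mul_le_mul_of_nonneg_left hdiag hT
  refine norm_add₃_le.trans ?_
  calc _ ≤ (T * (q ^ 2 * (θ * (2 + θ))) + volume.real E * B ^ 2) + 4 * B ^ 2 +
        T * (q ^ 2 * (θ * (2 + θ)) * ∑' n : ℕ, (n : ℝ) ^ (-1 - η)) :=
        add_le_add (add_le_add hmain (hmv.trans hbb)) hT2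
    _ = _ := by ring

/-- Powers of `log T` with exponent at most `c * log T / log (log T)` are small powers of `T`. -/
theorem mul_log_pow_le {M c T : ℝ} {k : ℕ} (hM : 1 ≤ M) (hT : 0 < T)
    (hMT : M ≤ Real.log T) (hlog : Real.exp 1 ≤ Real.log T)
    (hk : (k : ℝ) ≤ c * Real.log T / Real.log (Real.log T)) :
    (M * Real.log T) ^ k ≤ T ^ (2 * c) := by
  have hL0 : 0 < Real.log T := (Real.exp_pos 1).trans_le hlog
  have hLL : 1 ≤ Real.log (Real.log T) := by rwa [Real.le_log_iff_exp_le hL0]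
  have h1 : M * Real.log T ≤ Real.exp (2 * Real.log (Real.log T)) := by
    rw [two_mul, Real.exp_add, Real.exp_log hL0]
    exact mul_le_mul_of_nonneg_right hMT hL0.le
  calc (M * Real.log T) ^ k ≤ Real.exp (2 * Real.log (Real.log T)) ^ k := by
        gcongr
    _ = Real.exp (2 * (k * Real.log (Real.log T))) := by
        rw [← Real.exp_nat_mul]; congr 1; ring
    _ ≤ Real.exp (2 * (c * Real.log T)) := by
        refine Real.exp_le_exp.2 (mul_le_mul_of_nonneg_left ?_ (by norm_num))
        rwa [le_div_iff₀ (by linarith)] at hk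
    _ = T ^ (2 * c) := by
        rw [Real.rpow_def_of_pos hT]; congr 1; ring

/-- Truncation at height log T costs exp(-(log T)²), which beats every fixed power of T; only the
left edge of the contour matters. -/
theorem smoothError_rpow_le {δ ξ T : ℝ} (hδ : 0 < δ) (hδ1 : δ ≤ 1) (hξ : 0 < ξ) (hξ1 : ξ ≤ 1 / 4)
    (hT : 0 < T) (hlog : 1 ≤ Real.log T) :
    smoothError δ (T ^ ξ) (Real.log T) ≤ (1 / δ + 2 * Real.exp 9) * T ^ (-(ξ * δ)) := by
  have h1 : (T ^ ξ) ^ (-δ) = T ^ (-(ξ * δ)) := by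
    rw [← Real.rpow_mul hT.le]; congr 1; ring
  have h2 : (T ^ ξ) ^ (3 : ℝ) * Real.exp (-Real.log T ^ 2) ≤ T ^ (-(ξ * δ)) := by
    rw [← Real.rpow_mul hT.le, Real.rpow_def_of_pos hT, Real.rpow_def_of_pos hT, ← Real.exp_add]
    refine Real.exp_le_exp.2 ?_
    have : ξ * 3 + ξ * δ ≤ Real.log T := by nlinarith
    nlinarith
  rw [smoothError, h1, add_mul]
  refine add_le_add (le_of_eq (by ring)) ?_
  gcongr

/-- One logarithm comes from the number of shifts, the other from the length of the removed
intervals; half of the exponent pays for both. -/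
theorem log_sq_mul_rpow_le {c T : ℝ} (hc : 0 < c) (hT : 1 ≤ T) :
    Real.log T ^ 2 * T ^ (1 - c) ≤ 16 / c ^ 2 * T ^ (1 - c / 2) := by
  have hT0 : 0 < T := by linarith
  have h1 := Real.log_le_rpow_div hT0.le (show 0 < c / 4 by positivity)
  have h2 : Real.log T ^ 2 ≤ (T ^ (c / 4) / (c / 4)) ^ 2 :=
    pow_le_pow_left₀ (Real.log_nonneg hT) h1 2
  calc Real.log T ^ 2 * T ^ (1 - c) ≤ (T ^ (c / 4) / (c / 4)) ^ 2 * T ^ (1 - c) := by gcongr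
    _ = 16 / c ^ 2 * ((T ^ (c / 4)) ^ 2 * T ^ (1 - c)) := by ring
    _ = 16 / c ^ 2 * T ^ (1 - c / 2) := by
        rw [rpow_sq hT0.le, ← Real.rpow_add hT0]; congr 2; ring

theorem prod_logZeta_sub_eq_conj {l : ℕ} (r : Fin l → ℂ) (t : ℝ) :
    ∏ j, logZeta (r j - Complex.I * t) = conj (∏ j, logZeta (conj (r j) + Complex.I * t)) := by
  rw [map_prod]
  refine Finset.prod_congr rfl fun j _ => ?_
  rw [← logZeta_conj]
  congr 1
  rw [map_add, Complex.conj_conj, map_mul, Complex.conj_I, Complex.conj_ofReal]; ring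

theorem theorem2p2 (σ₀ : ℝ) (hσ₀ : 1 / 2 < σ₀) (hσ₀' : σ₀ < 1) :
    ∃ c₃ c₄ c₅ C T₀ : ℝ, 0 < c₃ ∧ 0 < c₄ ∧ 0 < c₅ ∧ 0 < C ∧ 3 ≤ T₀ ∧
      ∀ T : ℝ, T₀ ≤ T → ∀ k l : ℕ,
        (k : ℝ) ≤ c₄ * Real.log T / Real.log (Real.log T) →
        (l : ℝ) ≤ c₄ * Real.log T / Real.log (Real.log T) →
        ∀ (s : Fin k → ℂ) (r : Fin l → ℂ),
          (∀ j, σ₀ < (s j).re ∧ (s j).re < 1 ∧ |(s j).im| ≤ T ^ ((σ₀ - 1 / 2) / 4)) →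
          (∀ j, σ₀ < (r j).re ∧ (r j).re < 1 ∧ |(r j).im| ≤ T ^ ((σ₀ - 1 / 2) / 4)) →
          ∃ E : Set ℝ, MeasurableSet E ∧ E ⊆ Set.Icc T (2 * T) ∧
            volume E ≤ ENNReal.ofReal (C * T ^ (1 - c₃)) ∧
            -- the logarithms of zeta are defined off the exceptional set
            (∀ t ∈ Set.Icc T (2 * T) \ E,
              (∀ j, ZetaFreeRight (s j + Complex.I * t)) ∧
              (∀ j, ZetaFreeRight (r j - Complex.I * t))) ∧
            IntegrableOn (fun t : ℝ => (∏ j, logZeta (s j + Complex.I * t)) *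
              ∏ j, logZeta (r j - Complex.I * t)) (Set.Icc T (2 * T) \ E) ∧
            ∀ (Ω : Type*) [MeasurableSpace Ω] (P : Measure Ω) [IsProbabilityMeasure P]
              (X : Nat.Primes → Ω → ℂ), IsSteinhausFamily P X →
              -- the random series converge almost surely
              (∀ j, ∀ᵐ ω ∂P, Tendsto (logEulerPartial (s j) (fun p => X p ω)) atTop
                (𝓝 (logEuler (s j) (fun p => X p ω)))) ∧
              (∀ j, ∀ᵐ ω ∂P, Tendsto (logEulerPartial (r j) (fun p => conj (X p ω))) atTop
                (𝓝 (logEuler (r j) (fun p => conj (X p ω))))) ∧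
              Integrable (fun ω => (∏ j, logEuler (s j) (fun p => X p ω)) *
                ∏ j, logEuler (r j) (fun p => conj (X p ω))) P ∧
              ‖(1 / T : ℂ) * (∫ t in Set.Icc T (2 * T) \ E,
                    (∏ j, logZeta (s j + Complex.I * t)) *
                      ∏ j, logZeta (r j - Complex.I * t)) -
                  ∫ ω, (∏ j, logEuler (s j) (fun p => X p ω)) *
                    ∏ j, logEuler (r j) (fun p => conj (X p ω)) ∂P‖
                ≤ C * T ^ (-c₅) := by
  set η : ℝ := σ₀ - 1 / 2 with hη
  have hη0 : 0 < η := by linarith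
  have hη1 : η < 1 / 2 := by linarith
  obtain ⟨C₀, c, hC₀, hc0, hc1, hexc⟩ := exists_exceptional_set hη0 hη1
  have hl2 : 0 < Real.log 2 := Real.log_pos one_lt_two
  -- M log T dominates both bases raised to the power k or l: the bound C₀ log T for log ζ, and
  -- k/((η/4) log 2), as k ≤ log T.
  set M : ℝ := C₀ + 1 / (η / 4 * Real.log 2) with hM
  have hM0 : 0 < 1 / (η / 4 * Real.log 2) := by positivity
  -- With X = T^ξ the trivial bound for the mean value contains X⁶ = T^(c/4), which the exceptional
  -- measure T^(1-c/2) can afford.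
  set ξ : ℝ := c / 24 with hξ
  -- The smoothing error is T^(-ξη/4) = T^(-2c₅); the factor q² = T^(c₅) uses up half of this
  -- saving.
  set c₅ : ℝ := ξ * (η / 4) / 2 with hc₅
  have hξ0 : 0 < ξ := by positivity
  have hc₅0 : 0 < c₅ := by positivity
  have hc₅c : 8 * c₅ ≤ c := by rw [hc₅, hξ]; nlinarith
  set K : ℝ := 1 / (η / 4) + 2 * Real.exp 9 with hK
  set S₁ : ℝ := ∑' n : ℕ, (n : ℝ) ^ (-1 - η) with hS₁
  set S₂ : ℝ := ∑' n : ℕ, (n : ℝ) ^ (-2 : ℝ) with hS₂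
  have hS₁0 : 0 ≤ S₁ := tsum_nonneg fun _ => by positivity
  have hK0 : 0 < K := by positivity
  set V : ℝ := 2 * C₀ * (16 / c ^ 2) with hV
  have hV0 : 0 < V := by positivity
  set C : ℝ := K * (2 + K) * (1 + S₁) + (V + 4) * (Real.exp 9 * S₂) ^ 2 + V with hC
  have hVC : V ≤ C := by
    have : 0 ≤ K * (2 + K) * (1 + S₁) + (V + 4) * (Real.exp 9 * S₂) ^ 2 := by positivity
    linarith
  -- The exponential in T₀ gives log T ≥ M + 3, hence also log T ≥ e; the 1024 is required by
  -- `exists_exceptional_set`.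
  refine ⟨c / 2, c₅ / 4, c₅, C, 1024 + Real.exp (M + 3), by positivity, by positivity, hc₅0,
    hV0.trans_le hVC, by linarith [Real.exp_pos (M + 3)], ?_⟩
  intro T hT k l hk hl s r hs hr
  have hT1024 : 1024 ≤ T := by linarith [Real.exp_pos (M + 3)]
  have hT0 : 0 < T := by linarith
  have hlogM : M + 3 ≤ Real.log T := by
    rw [Real.le_log_iff_exp_le hT0]; linarith
  have hM1 : 1 ≤ M := by linarith
  have hloge : Real.exp 1 ≤ Real.log T := by linarith [Real.exp_one_lt_d9]
  have hlog1 : 1 ≤ Real.log T := by linarith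
  have hLL : 1 ≤ Real.log (Real.log T) := by rwa [Real.le_log_iff_exp_le (by linarith)]
  have hcard : ∀ {m : ℕ}, (m : ℝ) ≤ c₅ / 4 * Real.log T / Real.log (Real.log T) →
      (m : ℝ) ≤ Real.log T := by
    intro m hm
    refine hm.trans ((div_le_self (by positivity) hLL).trans ?_)
    exact mul_le_of_le_one_left (by linarith) (by linarith)
  set q : ℝ := T ^ (2 * (c₅ / 4)) with hq
  have hqM : ∀ {m : ℕ}, (m : ℝ) ≤ c₅ / 4 * Real.log T / Real.log (Real.log T) →
      (C₀ * Real.log T) ^ m ≤ q ∧ (m / (η / 4 * Real.log 2)) ^ m ≤ q := by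
    intro m hm
    have h1 := mul_log_pow_le hM1 hT0 (by linarith) hloge hm
    constructor
    · refine le_trans (pow_le_pow_left₀ (by positivity) ?_ m) h1
      exact mul_le_mul_of_nonneg_right (by linarith) (by linarith)
    · refine le_trans (pow_le_pow_left₀ (by positivity) ?_ m) h1
      rw [div_eq_mul_one_div, mul_comm]
      exact mul_le_mul (by linarith) (hcard hm) (Nat.cast_nonneg _) (by linarith)
  have hu : ∀ z : ℂ, |z.im| ≤ T ^ (η / 4) → |z.im| ≤ T ^ ((1 : ℝ) / 8) := fun z hz =>
    hz.trans (Real.rpow_le_rpow_of_exponent_le (by linarith) (by linarith))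
  -- One exceptional set serves both families, with the conjugates of the r j so that all ordinates
  -- move upwards with t.
  obtain ⟨E, hEm, hET, hEvol, hgood⟩ := hexc T hT1024 (Fin k ⊕ Fin l)
    (Sum.elim (fun j => (s j).im) fun j => (conj (r j)).im) (by
      rintro (j | j)
      · exact hu _ (hs j).2.2
      · refine hu _ ?_
        simpa using (hr j).2.2)
  have hvolb : Fintype.card (Fin k ⊕ Fin l) * (C₀ * Real.log T * T ^ (1 - c))
      ≤ V * T ^ (1 - c / 2) := by
    rw [Fintype.card_sum, Fintype.card_fin, Fintype.card_fin]
    push_cast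
    calc ((k : ℝ) + l) * (C₀ * Real.log T * T ^ (1 - c))
        ≤ (2 * Real.log T) * (C₀ * Real.log T * T ^ (1 - c)) :=
          mul_le_mul_of_nonneg_right (by linarith [hcard hk, hcard hl]) (by positivity)
      _ = 2 * C₀ * (Real.log T ^ 2 * T ^ (1 - c)) := by ring
      _ ≤ 2 * C₀ * (16 / c ^ 2 * T ^ (1 - c / 2)) :=
          mul_le_mul_of_nonneg_left (log_sq_mul_rpow_le hc0 (by linarith)) (by positivity)
      _ = _ := by rw [hV]; ring
  have hEreal : volume.real E ≤ V * T ^ (1 - c / 2) :=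
    ENNReal.toReal_le_of_le_ofReal (by positivity) (hEvol.trans (ENNReal.ofReal_le_ofReal hvolb))
  have hgs : ∀ t ∈ Set.Icc T (2 * T) \ E, ∀ j, ∀ z : ℂ, |z.im - (t + (s j).im)| ≤ Real.log T →
      1 / 2 + 3 * η / 4 ≤ z.re → riemannZeta z ≠ 0 ∧ DifferentiableAt ℂ logZeta z ∧
        ‖logZeta z‖ ≤ C₀ * Real.log T := fun t ht j => hgood t ht (Sum.inl j)
  have hgr : ∀ t ∈ Set.Icc T (2 * T) \ E, ∀ j, ∀ z : ℂ,
      |z.im - (t + (conj (r j)).im)| ≤ Real.log T →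
      1 / 2 + 3 * η / 4 ≤ z.re → riemannZeta z ≠ 0 ∧ DifferentiableAt ℂ logZeta z ∧
        ‖logZeta z‖ ≤ C₀ * Real.log T := fun t ht j => hgood t ht (Sum.inr j)
  have hrect : ∀ (a : ℂ) (t : ℝ) (w : ℂ), σ₀ < a.re →
      w ∈ Set.Icc (-(η / 4)) 3 ×ℂ Set.Icc (-Real.log T) (Real.log T) →
      |(a + Complex.I * t + w).im - (t + a.im)| ≤ Real.log T ∧
        1 / 2 + 3 * η / 4 ≤ (a + Complex.I * t + w).re := by
    rintro a t w ha ⟨hw1, hw2⟩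
    constructor
    · have e : (a + Complex.I * t + w).im - (t + a.im) = w.im := by simp; ring
      rw [e, abs_le]; exact hw2
    · have := hw1.1
      simp; linarith
  have hfree : ∀ (a : ℂ) (t : ℝ), σ₀ < a.re → (∀ z : ℂ, |z.im - (t + a.im)| ≤ Real.log T →
      1 / 2 + 3 * η / 4 ≤ z.re → riemannZeta z ≠ 0 ∧ DifferentiableAt ℂ logZeta z ∧
        ‖logZeta z‖ ≤ C₀ * Real.log T) → ZetaFreeRight (a + Complex.I * t) := by
    intro a t ha h x hx
    refine (h _ ?_ ?_).1
    · have e : ((x : ℂ) + ((a + Complex.I * t).im : ℂ) * Complex.I).im - (t + a.im) = 0 := by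
        simp; ring
      rw [e, abs_zero]; linarith
    · simp at hx ⊢; linarith
  have hr' : ∀ j, σ₀ < (conj (r j)).re := fun j => by simpa using (hr j).1
  have hXT : 1 ≤ T ^ ξ := Real.one_le_rpow (by linarith) hξ0.le
  obtain ⟨hint, hbound⟩ := norm_moment_sub_le (s := s) (r := fun j => conj (r j)) (η := η) (q := q)
    (L := C₀ * Real.log T) (T := T) (X := T ^ ξ) (H := Real.log T) (E := E) hη0 (by linarith)
    (fun j => by linarith [(hs j).1]) (fun j => by linarith [hr' j]) (hqM hk).2 (hqM hl).2
    (hqM hk).1 (hqM hl).1 (by positivity) hT0.le hXT hlog1 hEm hET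
    (fun t ht w hw j => by
      obtain ⟨h1, h2⟩ := hrect (s j) t w (hs j).1 hw
      exact (hgs t ht j _ h1 h2).2)
    (fun t ht w hw j => by
      obtain ⟨h1, h2⟩ := hrect (conj (r j)) t w (hr' j) hw
      exact (hgr t ht j _ h1 h2).2)
  have hfun : (fun t : ℝ => (∏ j, logZeta (s j + Complex.I * t)) *
      ∏ j, logZeta (r j - Complex.I * t)) = fun t : ℝ => (∏ j, logZeta (s j + Complex.I * t)) *
        conj (∏ j, logZeta (conj (r j) + Complex.I * t)) := by
    ext t; rw [prod_logZeta_sub_eq_conj]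
  refine ⟨E, hEm, hET, ?_, ?_, ?_, ?_⟩
  · refine hEvol.trans (ENNReal.ofReal_le_ofReal (hvolb.trans ?_))
    exact mul_le_mul_of_nonneg_right hVC (by positivity)
  · intro t ht
    refine ⟨fun j => hfree _ t (hs j).1 (hgs t ht j), fun j => ?_⟩
    have h := zetaFreeRight_conj (hfree _ t (hr' j) (hgr t ht j))
    rw [map_add, Complex.conj_conj, map_mul, Complex.conj_I, Complex.conj_ofReal, neg_mul,
      ← sub_eq_add_neg] at h
    exact h
  · rw [hfun]; exact hint
  intro Ω _ P _ X hX
  refine ⟨fun j => hX.ae_tendsto_logEulerPartial (by linarith [(hs j).1]), fun j => ?_, ?_, ?_⟩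
  · filter_upwards [hX.ae_logEuler_conj (show 1 / 2 < (r j).re by linarith [(hr j).1])] with ω h
    exact h.1
  · exact (hX.integral_prod_logEuler hσ₀ (fun j => (hs j).1.le) fun j => (hr j).1.le).1
  rw [(hX.integral_prod_logEuler hσ₀ (fun j => (hs j).1.le) fun j => (hr j).1.le).2, hfun]
  set I := ∫ t in Set.Icc T (2 * T) \ E, (∏ j, logZeta (s j + Complex.I * t)) *
    conj (∏ j, logZeta (conj (r j) + Complex.I * t))
  set Z := ∑' n, prodCoeff s n * conj (prodCoeff (fun j => conj (r j)) n)
  set θ := smoothError (η / 4) (T ^ ξ) (Real.log T) with hθ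
  have hTc : (T : ℂ) ≠ 0 := by exact_mod_cast hT0.ne'
  have e1 : (1 / T : ℂ) * I - Z = (1 / T : ℂ) * (I - T * Z) := by field_simp
  rw [e1, norm_mul, norm_div, norm_one, Complex.norm_of_nonneg hT0.le, one_div_mul_eq_div,
    div_le_iff₀ hT0]
  refine hbound.trans ?_
  have hθ0 : 0 ≤ θ := smoothError_nonneg (by positivity) (by positivity)
  have hθK : θ ≤ K * T ^ (-(ξ * (η / 4))) :=
    smoothError_rpow_le (by positivity) (by linarith) hξ0 (by rw [hξ]; linarith) hT0 hlog1
  have hθ1 : θ ≤ K := hθK.trans (mul_le_of_le_one_right hK0.le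
    (Real.rpow_le_one_of_one_le_of_nonpos (by linarith) (neg_nonpos.2 (by positivity))))
  have hq2 : q ^ 2 = T ^ c₅ := by rw [hq, rpow_sq hT0.le]; congr 1; ring
  have t1 : T * (q ^ 2 * (θ * (2 + θ)) * (1 + S₁)) ≤ K * (2 + K) * (1 + S₁) * T ^ (-c₅) * T := by
    have e2 : T ^ c₅ * T ^ (-(ξ * (η / 4))) = T ^ (-c₅) := by
      rw [← Real.rpow_add hT0]; congr 1; rw [hc₅]; ring
    calc T * (q ^ 2 * (θ * (2 + θ)) * (1 + S₁))
        ≤ T * (T ^ c₅ * ((K * T ^ (-(ξ * (η / 4)))) * (2 + K)) * (1 + S₁)) := by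
          rw [hq2]; gcongr
      _ = K * (2 + K) * (1 + S₁) * (T ^ c₅ * T ^ (-(ξ * (η / 4)))) * T := by ring
      _ = _ := by rw [e2]
  have t2 : (volume.real E + 4) * (q * (Real.exp 9 * (T ^ ξ) ^ (3 : ℝ)) * S₂) ^ 2
      ≤ (V + 4) * (Real.exp 9 * S₂) ^ 2 * T ^ (-c₅) * T := by
    have e3 : volume.real E + 4 ≤ (V + 4) * T ^ (1 - c / 2) := by
      have : 1 ≤ T ^ (1 - c / 2) := Real.one_le_rpow (by linarith) (by linarith)
      linarith
    have e4 : ((T ^ ξ) ^ (3 : ℝ)) ^ 2 = T ^ (c / 4) := by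
      rw [← Real.rpow_mul hT0.le, rpow_sq hT0.le]; congr 1; rw [hξ]; ring
    -- This is where 8c₅ ≤ c enters: 1 - c/2 + c₅ + c/4 ≤ 1 - c₅.
    have e5 : T ^ (1 - c / 2) * (T ^ c₅ * T ^ (c / 4)) ≤ T ^ (-c₅) * T := by
      nth_rewrite 5 [← Real.rpow_one T]
      rw [← Real.rpow_add hT0, ← Real.rpow_add hT0, ← Real.rpow_add hT0]
      exact Real.rpow_le_rpow_of_exponent_le (by linarith) (by linarith)
    calc _ = (volume.real E + 4) * ((Real.exp 9 * S₂) ^ 2 * (T ^ c₅ * T ^ (c / 4))) := by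
          rw [← e4, ← hq2]; ring
      _ ≤ ((V + 4) * T ^ (1 - c / 2)) * ((Real.exp 9 * S₂) ^ 2 * (T ^ c₅ * T ^ (c / 4))) :=
          mul_le_mul_of_nonneg_right e3 (by positivity)
      _ = (V + 4) * (Real.exp 9 * S₂) ^ 2 * (T ^ (1 - c / 2) * (T ^ c₅ * T ^ (c / 4))) := by ring
      _ ≤ (V + 4) * (Real.exp 9 * S₂) ^ 2 * (T ^ (-c₅) * T) :=
          mul_le_mul_of_nonneg_left e5 (by positivity)
      _ = _ := by ring
  have t3 : 0 ≤ V * T ^ (-c₅) * T := by positivity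
  calc _ ≤ K * (2 + K) * (1 + S₁) * T ^ (-c₅) * T +
        (V + 4) * (Real.exp 9 * S₂) ^ 2 * T ^ (-c₅) * T := add_le_add t1 t2
    _ ≤ C * T ^ (-c₅) * T := by rw [hC]; linarith
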